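/- **Setting.** Let $N\ge 1$, let $I\subset[0,\infty)$ be an interval containing $0$, let $\Lambda$ be a Hermitian $N\times N$ matrix, $S$ a symmetric $N\times N$ matrix, and $z_t\in\mathbb C_+$ ($t\in I$). Let $M\in\mathbb C^{N\times N}$ (independent of $t$) satisfy $$M=\big(\Lambda-z_t-t\,\mathcal S(M)\big)^{-1}\quad\text{for all }t\in I,\qquad \mathcal S(M)=\operatorname{diag}\Big(\sum_j S_{ij}M_{jj}\Big)_i .$$ Put $M(+)=M$, $M(-)=M^*$, let $F_a$ be the matrix with the single nonzero entry $1$ at $(a,a)$, and let $S_t=tS$. For $\sigma_i\in\{+,-\}$ and $a_i\in\{1,\dots,N\}$ define $$\widehat{\mathcal M}^{(n)}_{\boldsymbol\sigma,\mathbf a}=\operatorname{Tr}\prod_{i=1}^n M(\sigma_i)F_{a_i},\qquad \widehat M^{(\sigma,\sigma')}_{ab}=\operatorname{Tr}\big(M(\sigma)F_aM(\sigma')F_b\big),\qquad \widehat\Theta_t^{(\sigma,\sigma')}=\big(1-\widehat M^{(\sigma,\sigma')}S_t\big)^{-1}.$$ **Primitive loops.** These are the solutions $\widehat{\mathcal K}^{(n)}_{t,\boldsymbol\sigma,\mathbf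 a}$ ($n\ge2$, $t\in I$) of the system $$\partial_t\widehat{\mathcal K}^{(n)}_{t,\boldsymbol\sigma,\mathbf a}=\sum_{1\le k<\ell\le n}\sum_{c,d}\widehat{\mathcal K}^{(n+k-\ell+1)}_{t,(\sigma_1,\dots,\sigma_k,\sigma_\ell,\dots,\sigma_n),(a_1,\dots,a_{k-1},c,a_\ell,\dots,a_n)}\,S_{cd}\,\widehat{\mathcal K}^{(\ell-k+1)}_{t,(\sigma_k,\dots,\sigma_\ell),(a_k,\dots,a_{\ell-1},d)},\qquad \widehat{\mathcal K}^{(n)}_{0,\boldsymbol\sigma,\mathbf a}=\widehat{\mathcal M}^{(n)}_{\boldsymbol\sigma,\mathbf a}.$$ **Canonical tree partitions.** For $n\ge3$ let $\mathrm{TSP}_n$ be the set of isomorphism classes (isomorphisms fixing the leaves) of finite trees whose leaves are exactly the vertices $a_1,\dots,a_n$ of an oriented $n$-gon, whose other (internal) vertices have degree at least $3$, and which are planar in the polygon: every directed edge lies on exactly one of the paths $p_k$ of the tree from $a_{k-1}$ to $a_k$ ($k=1,\dots,n$, $a_0=a_n$). The region $R_k$ is bounded by the side $(a_{k-1},a_k)$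 and $p_k$, and carries the charge $\sigma_k$. In the $M$-graph of such a tree $\Gamma$, every internal vertex $v$ is replaced by a cycle with one vertex $b_{v,w}$ for each neighbour $w$ of $v$; an edge $\{v,w\}$ between internal vertices becomes $\{b_{v,w},b_{w,v}\}$, and an external edge $\{a_k,v\}$ becomes $\{a_k,b_{v,a_k}\}$. The charge $q$ of a vertex of the $M$-graph is $\sigma_k$ for the unique $k$ such that $p_k$ runs through its non-cycle edge towards that vertex. In particular $q(a_k)=\sigma_k$, and $q(b_{v,w})=\sigma_k$ when $p_k$ contains $w\to v$. If $R_{k_1},\dots,R_{k_\delta}$, $k_1<\dots<k_\delta$, are the regions around $v$ and $p_{k_j}$ leaves $v$ towards $w_j$, put $\mathcal F(v)=\operatorname{Tr}\prod_{j=1}^{\delta}M(\sigma_{k_j})F_{b_{v,w_j}}$. The value of the $M$-graph is $$\Gamma^M_{t,\boldsymbol\sigma,\mathbf a}=\sum_{\mathbf b}\ \prod_v\mathcal F(v)\prod_{\text{external }(a_k,b)}\big(\widehat\Theta_t^{(q(a_k),q(b))}\big)_{a_kb}\prod_{\text{internal }(b,b')}\big(S_t\widehat\Theta_t^{(q(b),q(b'))}\big)_{bb'},$$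 where the sum is over all values in $\{1,\dots,N\}$ of all the $b_{v,w}$. (By symmetry of $S$ the orientation of an internal edge is irrelevant.) **Claim.** If $\widehat{\mathcal K}$ is a system of primitive loops on $I$, then for every $t\in I$ all the matrices $1-\widehat M^{(\sigma,\sigma')}S_t$ are invertible, $$\widehat{\mathcal K}^{(2)}_{t,(\sigma_1,\sigma_2),(a,b)}=\big(\widehat\Theta_t^{(\sigma_1,\sigma_2)}\widehat M^{(\sigma_1,\sigma_2)}\big)_{ab},$$ and for all $n\ge3$, $\boldsymbol\sigma$ and $\mathbf a$ $$\widehat{\mathcal K}^{(n)}_{t,\boldsymbol\sigma,\mathbf a}=\sum_{\Gamma\in\mathrm{TSP}_n}\Gamma^M_{t,\boldsymbol\sigma,\mathbf a}.$$ In particular a system of primitive loops on $I$ is unique. Conversely, if all the matrices $1-\widehat M^{(\sigma,\sigma')}S_t$ are invertible for every $t\in I$, then a system of primitive loops on $I$ exists. -/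

import Mathlib

open scoped Matrix BigOperators

/-! ## Charges, `M`-loops and propagators -/

/-- The two charges `+` and `-`. -/
inductive Charge : Type
  | plus : Charge
  | minus : Charge

/-- `M(+) = M` and `M(-) = M^*`. -/
def chargeMatrix {ι : Type*} (M : Matrix ι ι ℂ) : Charge → Matrix ι ι ℂ
  | Charge.plus => M
  | Charge.minus => Mᴴ

/-- The linear operator `𝒮`: `𝒮(X)` is diagonal with entries `𝒮(X)_{ii} = ∑_j S_{ij} X_{jj}`. -/
def varianceOp {ι : Type*} [Fintype ι] [DecidableEq ι] (S X : Matrix ι ι ℂ) : Matrix ι ι ℂ :=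
  Matrix.diagonal fun i => ∑ j, S i j * X j j

/-- The `M`-loop `Tr ∏_j (M(σ_j) F_{a_j})` of a list of pairs `(σ_j, a_j)`, where `F_a` is the matrix
whose only nonzero entry is a `1` at `(a, a)`. -/
noncomputable def mLoopList {ι : Type*} [Fintype ι] [DecidableEq ι] (M : Matrix ι ι ℂ)
    (w : List (Charge × ι)) : ℂ :=
  Matrix.trace (w.map fun p => chargeMatrix M p.1 * Matrix.single p.2 p.2 (1 : ℂ)).prod

/-- The `M`-loop `Tr ∏_{j=1}^n (M(σ_j) F_{a_j})` of length `n`. -/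
noncomputable def mLoop {ι : Type*} [Fintype ι] [DecidableEq ι] (M : Matrix ι ι ℂ)
    {n : ℕ} (σ : Fin n → Charge) (a : Fin n → ι) : ℂ :=
  mLoopList M (List.ofFn fun j => (σ j, a j))

/-- `M̂^{(σ,σ')}_{ab} = Tr (M(σ) F_a M(σ') F_b)`. -/
noncomputable def mHat {ι : Type*} [Fintype ι] [DecidableEq ι] (M : Matrix ι ι ℂ)
    (σ σ' : Charge) : Matrix ι ι ℂ :=
  Matrix.of fun a b => Matrix.trace (chargeMatrix M σ * Matrix.single a a (1 : ℂ) *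
    chargeMatrix M σ' * Matrix.single b b (1 : ℂ))

/-- `S_t = t S`. -/
noncomputable def sT {ι : Type*} (S : Matrix ι ι ℂ) (t : ℝ) : Matrix ι ι ℂ := (t : ℂ) • S

/-- `Θ̂_t^{(σ,σ')} = (1 - M̂^{(σ,σ')} S_t)⁻¹` (meaningful when `1 - M̂^{(σ,σ')} S_t` is invertible). -/
noncomputable def thetaHat {ι : Type*} [Fintype ι] [DecidableEq ι] (M S : Matrix ι ι ℂ) (t : ℝ)
    (σ σ' : Charge) : Matrix ι ι ℂ :=
  (1 - mHat M σ σ' * sT S t)⁻¹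

/-- `1 - M̂^{(σ,σ')} S_t` is invertible for all charges, so that all propagators `Θ̂_t` exist. -/
def PropagatorsExist {ι : Type*} [Fintype ι] [DecidableEq ι] (M S : Matrix ι ι ℂ) (t : ℝ) : Prop :=
  ∀ σ σ' : Charge, IsUnit (1 - mHat M σ σ' * sT S t)

/-! ## The primitive equations

Sides and vertices are indexed from `0`: position `i : Fin n` stands for the index `i + 1`. -/

/-- Charges `(σ_1, …, σ_k, σ_ℓ, …, σ_n)` of the left cut-and-glue operator. -/
def glueLeftCharge {n : ℕ} (k l : Fin n) (σ : Fin n → Charge) :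
    Fin (n + 1 - (l.val - k.val)) → Charge := fun i =>
  if h : i.val ≤ k.val then σ ⟨i.val, by omega⟩
  else σ ⟨i.val + (l.val - k.val) - 1, by omega⟩

/-- Vertices `(a_1, …, a_{k-1}, c, a_ℓ, …, a_n)` of the left cut-and-glue operator. -/
def glueLeftVertex {ι : Type*} {n : ℕ} (k l : Fin n) (c : ι) (a : Fin n → ι) :
    Fin (n + 1 - (l.val - k.val)) → ι := fun i =>
  if h : i.val < k.val then a ⟨i.val, by omega⟩
  else if h' : i.val = k.val then c
  else a ⟨i.val + (l.val - k.val) - 1, by omega⟩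

/-- Charges `(σ_k, …, σ_ℓ)` of the right cut-and-glue operator. -/
def glueRightCharge {n : ℕ} (k l : Fin n) (σ : Fin n → Charge) :
    Fin (l.val - k.val + 1) → Charge := fun i =>
  σ ⟨k.val + i.val, by omega⟩

/-- Vertices `(a_k, …, a_{ℓ-1}, d)` of the right cut-and-glue operator. -/
def glueRightVertex {ι : Type*} {n : ℕ} (k l : Fin n) (d : ι) (a : Fin n → ι) :
    Fin (l.val - k.val + 1) → ι := fun i =>
  if i.val < l.val - k.val then a ⟨k.val + i.val, by omega⟩ else d

/-- A family `K n t σ a` of loops (of all lengths `n ≥ 2`) solves the system of primitive equations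
on the time set `I ∋ 0`, with the `M`-loops as initial data. -/
structure IsPrimitiveLoops {ι : Type*} [Fintype ι] [DecidableEq ι] (M S : Matrix ι ι ℂ) (I : Set ℝ)
    (K : (n : ℕ) → ℝ → (Fin n → Charge) → (Fin n → ι) → ℂ) : Prop where
  initial : ∀ n : ℕ, 2 ≤ n → ∀ (σ : Fin n → Charge) (a : Fin n → ι), K n 0 σ a = mLoop M σ a
  equation : ∀ n : ℕ, 2 ≤ n → ∀ (σ : Fin n → Charge) (a : Fin n → ι), ∀ t ∈ I,
    HasDerivWithinAt (fun s => K n s σ a)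
      (∑ p : Fin n × Fin n with p.1 < p.2, ∑ c : ι, ∑ d : ι,
        K (n + 1 - (p.2.val - p.1.val)) t (glueLeftCharge p.1 p.2 σ) (glueLeftVertex p.1 p.2 c a) *
          S c d *
          K (p.2.val - p.1.val + 1) t (glueRightCharge p.1 p.2 σ) (glueRightVertex p.1 p.2 d a))
      I t

/-! ## Canonical tree partitions -/

/-- The unique path between two vertices of a tree. -/
noncomputable def treePath {V : Type*} {G : SimpleGraph V} (hG : G.IsTree) (u v : V) : G.Walk u v :=
  (hG.existsUnique_path u v).exists.choose

theorem treePath_isPath {V : Type*} {G : SimpleGraph V} (hG : G.IsTree) (u v : V) :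
    (treePath hG u v).IsPath :=
  (hG.existsUnique_path u v).exists.choose_spec

theorem eq_treePath {V : Type*} {G : SimpleGraph V} (hG : G.IsTree) {u v : V} (p : G.Walk u v)
    (hp : p.IsPath) : p = treePath hG u v :=
  (hG.existsUnique_path u v).unique hp (treePath_isPath hG u v)

/-- A concrete tree of interior edges of a canonical partition of the oriented `n`-gon with vertices
`a_1, …, a_n` in counterclockwise order. The external vertices (the polygon vertices) are `Sum.inl k`
and the internal vertices are `Sum.inr v`. The leaves are exactly the external vertices and internal
vertices have degree at least three. The region `R_k` is bounded by the side `(a_{k-1}, a_k)` (`k - 1`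
is cyclic) and the path `p_k` of the tree from `a_{k-1}` to `a_k`. Planarity: every interior edge
borders exactly two regions, which traverse it in opposite directions, i.e. every directed edge of the
tree lies on exactly one of the paths `p_k`. -/
structure CanonicalTree (n : ℕ) [NeZero n] where
  numInner : ℕ
  graph : SimpleGraph (Fin n ⊕ Fin numInner)
  isTree : graph.IsTree
  ncard_external : ∀ k : Fin n, (graph.neighborSet (Sum.inl k)).ncard = 1
  ncard_internal : ∀ v : Fin numInner, 3 ≤ (graph.neighborSet (Sum.inr v)).ncard
  planar : ∀ d : graph.Dart, ∃! k : Fin n,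
    d ∈ (treePath isTree (Sum.inl (k - 1)) (Sum.inl k)).darts

namespace CanonicalTree

variable {n : ℕ} [NeZero n]

/-- The canonical directed path `p_k` from `a_{k-1}` to `a_k`. -/
noncomputable def path (Γ : CanonicalTree n) (k : Fin n) :
    Γ.graph.Walk (Sum.inl (k - 1)) (Sum.inl k) :=
  treePath Γ.isTree (Sum.inl (k - 1)) (Sum.inl k)

/-- The vertices of the `M`-graph are the directed edges of the tree: `d = (v → w)` with `v` internal
is the vertex of the `M`-loop replacing `v` that is attached towards the neighbour `w`, and `d` with
`d.fst = Sum.inl k` is the external vertex `a_k`. The unlabeled edge at `d` joins `d` and `d.symm`.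
The principal region of `d` is the region `R_k` whose path `p_k` runs through that unlabeled edge
towards `d`. -/
noncomputable def principalRegion (Γ : CanonicalTree n) (d : Γ.graph.Dart) : Fin n :=
  (Γ.planar d.symm).exists.choose

theorem principalRegion_spec (Γ : CanonicalTree n) (d : Γ.graph.Dart) :
    d.symm ∈ (Γ.path (Γ.principalRegion d)).darts :=
  (Γ.planar d.symm).exists.choose_spec

theorem eq_principalRegion (Γ : CanonicalTree n) {d : Γ.graph.Dart} {k : Fin n}
    (h : d.symm ∈ (Γ.path k).darts) : k = Γ.principalRegion d :=
  (Γ.planar d.symm).unique h (Γ.principalRegion_spec d)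

/-- The charge of a vertex of the `M`-graph is the charge of its principal region. -/
noncomputable def charge (Γ : CanonicalTree n) (σ : Fin n → Charge) (d : Γ.graph.Dart) : Charge :=
  σ (Γ.principalRegion d)

/-- The vertices `b_{i,j}` on the `M`-loops. -/
abbrev LoopVertex (Γ : CanonicalTree n) : Type := {d : Γ.graph.Dart // ∃ v, d.fst = Sum.inr v}

/-- The matrix index carried by a vertex of the `M`-graph: `a_k` at the external vertex `a_k`, and
`b_{i,j}` at a vertex of an `M`-loop. -/
def index {ι : Type*} (Γ : CanonicalTree n) (a : Fin n → ι) (b : Γ.LoopVertex → ι)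
    (d : Γ.graph.Dart) : ι :=
  match h : d.fst with
  | Sum.inl k => a k
  | Sum.inr v => b ⟨d, v, h⟩

open Classical in
/-- The `M`-loop replacing the internal vertex `v`, as a list. The regions around `v` are met
counterclockwise in increasing cyclic order of their labels. Each `R_k` with `p_k` running through `v`
contributes one `M`-edge of charge `σ_k`, and that edge ends at the vertex of the loop through which
`p_k` leaves `v`. -/
noncomputable def loopList {ι : Type*} (Γ : CanonicalTree n) (σ : Fin n → Charge)
    (b : Γ.graph.Dart → ι) (v : Fin Γ.numInner) : List (Charge × ι) :=
  (List.finRange n).flatMap fun k =>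
    ((Γ.path k).darts.filter fun d => d.fst = Sum.inr v).map fun d => (σ k, b d)

open Classical in
/-- The value of the `M`-graph at fixed indices `b`: the product of its `M`-loops, of
`Θ̂_t^{(q(a_k), q(b))}_{a_k b}` over the external edges `(a_k, b)`, and of
`(S_t Θ̂_t^{(q(b), q(b'))})_{b b'}` over the internal edges `(b, b') = R_k ∩ R_ℓ`. By symmetry of `S`,
the orientation chosen for an internal edge is irrelevant; it is chosen so that `k < ℓ`. -/
noncomputable def unsummedValue {ι : Type*} [Fintype ι] [DecidableEq ι] (Γ : CanonicalTree n)
    (M S : Matrix ι ι ℂ) (t : ℝ) (σ : Fin n → Charge) (a : Fin n → ι) (b : Γ.LoopVertex → ι) : ℂ :=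
  (∏ v : Fin Γ.numInner, mLoopList M (Γ.loopList σ (Γ.index a b) v)) *
  (∏ d : Γ.graph.Dart with ∃ k, d.fst = Sum.inl k,
    thetaHat M S t (Γ.charge σ d) (Γ.charge σ d.symm) (Γ.index a b d) (Γ.index a b d.symm)) *
  (∏ d : Γ.graph.Dart with (∃ v, d.fst = Sum.inr v) ∧ (∃ w, d.snd = Sum.inr w) ∧
      Γ.principalRegion d < Γ.principalRegion d.symm,
    (sT S t * thetaHat M S t (Γ.charge σ d) (Γ.charge σ d.symm))
      (Γ.index a b d) (Γ.index a b d.symm))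

open Classical in
/-- The value of the `M`-graph: sum over all indices `b_{i,j}` of the `M`-loop vertices. -/
noncomputable def value {ι : Type*} [Fintype ι] [DecidableEq ι] (Γ : CanonicalTree n)
    (M S : Matrix ι ι ℂ) (t : ℝ) (σ : Fin n → Charge) (a : Fin n → ι) : ℂ :=
  ∑ b : Γ.LoopVertex → ι, Γ.unsummedValue M S t σ a b

/-- Graph isomorphism of canonical trees, fixing the polygon vertices. -/
def Iso (Γ Γ' : CanonicalTree n) : Prop :=
  ∃ φ : Γ.graph ≃g Γ'.graph, ∀ k : Fin n, φ (Sum.inl k) = Sum.inl k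

instance setoid (n : ℕ) [NeZero n] : Setoid (CanonicalTree n) where
  r := Iso
  iseqv :=
    { refl := fun _ => ⟨SimpleGraph.Iso.refl, fun _ => rfl⟩
      symm := fun {_ _} ⟨φ, h⟩ => ⟨φ.symm, fun k => by
        rw [← h k]; exact φ.symm_apply_apply _⟩
      trans := fun {_ _ _} ⟨φ, h⟩ ⟨ψ, h'⟩ => ⟨φ.trans ψ, fun k => by
        change ψ (φ _) = _
        rw [h, h']⟩ }

end CanonicalTree

/-- Canonical tree partitions of the `n`-gon: isomorphism classes of canonical trees. -/
def TSP (n : ℕ) [NeZero n] : Type := Quotient (CanonicalTree.setoid n)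

namespace CanonicalTree

variable {n : ℕ} [NeZero n]

section Invariance

variable {Γ Γ' : CanonicalTree n} (φ : Γ.graph ≃g Γ'.graph)

/-- The bijection of directed edges induced by an isomorphism. -/
def dartEquiv : Γ.graph.Dart ≃ Γ'.graph.Dart where
  toFun := fun d => ⟨(φ d.fst, φ d.snd), φ.map_rel_iff.2 d.adj⟩
  invFun := fun d => ⟨(φ.symm d.fst, φ.symm d.snd), φ.symm.map_rel_iff.2 d.adj⟩
  left_inv := fun d => by ext <;> simp
  right_inv := fun d => by ext <;> simp

theorem dartEquiv_fst (d : Γ.graph.Dart) : (dartEquiv φ d).fst = φ d.fst := rfl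

theorem dartEquiv_snd (d : Γ.graph.Dart) : (dartEquiv φ d).snd = φ d.snd := rfl

theorem dartEquiv_symm' (d : Γ.graph.Dart) : (dartEquiv φ d).symm = dartEquiv φ d.symm := rfl

theorem path_darts_map (h : ∀ k : Fin n, φ (Sum.inl k) = Sum.inl k) (k : Fin n) :
    (Γ'.path k).darts = (Γ.path k).darts.map (dartEquiv φ) := by
  have hp : ((Γ.path k).map φ.toHom).IsPath :=
    (treePath_isPath Γ.isTree _ _).map φ.injective
  have e1 : φ.toHom (Sum.inl (k - 1)) = Sum.inl (k - 1) := h _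
  have e2 : φ.toHom (Sum.inl k) = Sum.inl k := h _
  have key := eq_treePath Γ'.isTree (((Γ.path k).map φ.toHom).copy e1 e2) (by simpa using hp)
  have : Γ'.path k = ((Γ.path k).map φ.toHom).copy e1 e2 := key.symm
  rw [this, SimpleGraph.Walk.darts_copy, SimpleGraph.Walk.darts_map]
  rfl

theorem principalRegion_map (h : ∀ k : Fin n, φ (Sum.inl k) = Sum.inl k) (d : Γ.graph.Dart) :
    Γ'.principalRegion (dartEquiv φ d) = Γ.principalRegion d := by
  symm
  apply eq_principalRegion
  rw [path_darts_map φ h, dartEquiv_symm']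
  exact List.mem_map_of_mem (Γ.principalRegion_spec d)

theorem fst_inr_iff (h : ∀ k : Fin n, φ (Sum.inl k) = Sum.inl k) (x : Fin n ⊕ Fin Γ.numInner) :
    (∃ v, φ x = Sum.inr v) ↔ ∃ v, x = Sum.inr v := by
  rcases x with k | v
  · simp [h]
  · refine ⟨fun _ => ⟨v, rfl⟩, fun _ => ?_⟩
    rcases hx : φ (Sum.inr v) with k | w
    · rw [← h k] at hx
      exact absurd (φ.injective hx) (by simp)
    · exact ⟨w, rfl⟩

theorem fst_inl_iff (h : ∀ k : Fin n, φ (Sum.inl k) = Sum.inl k) (x : Fin n ⊕ Fin Γ.numInner) :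
    (∃ k, φ x = Sum.inl k) ↔ ∃ k, x = Sum.inl k := by
  have h2 := fst_inr_iff φ h x
  rcases hx : φ x with k | v <;> rcases x with k' | v' <;> simp_all

/-- The bijection of internal vertices induced by an isomorphism fixing the external vertices. -/
noncomputable def innerEquiv (h : ∀ k : Fin n, φ (Sum.inl k) = Sum.inl k) :
    Fin Γ.numInner ≃ Fin Γ'.numInner :=
  Equiv.ofBijective (fun v => ((fst_inr_iff φ h (Sum.inr v)).2 ⟨v, rfl⟩).choose) <| by
    have hs : ∀ v, φ (Sum.inr v) = Sum.inr ((fst_inr_iff φ h (Sum.inr v)).2 ⟨v, rfl⟩).choose :=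
      fun v => ((fst_inr_iff φ h (Sum.inr v)).2 ⟨v, rfl⟩).choose_spec
    constructor
    · intro v w hvw
      have : φ (Sum.inr v) = φ (Sum.inr w) := by
        rw [hs v, hs w]
        exact congrArg Sum.inr hvw
      exact Sum.inr_injective (φ.injective this)
    · intro w
      obtain ⟨x, hx⟩ := φ.surjective (Sum.inr w)
      obtain ⟨v, rfl⟩ := (fst_inr_iff φ h x).1 ⟨w, hx⟩
      exact ⟨v, Sum.inr_injective ((hs v).symm.trans hx)⟩

theorem innerEquiv_spec (h : ∀ k : Fin n, φ (Sum.inl k) = Sum.inl k) (v : Fin Γ.numInner) :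
    φ (Sum.inr v) = Sum.inr (innerEquiv φ h v) :=
  ((fst_inr_iff φ h (Sum.inr v)).2 ⟨v, rfl⟩).choose_spec

/-- The bijection of loop vertices induced by an isomorphism fixing the external vertices. -/
def loopVertexEquiv (h : ∀ k : Fin n, φ (Sum.inl k) = Sum.inl k) :
    Γ.LoopVertex ≃ Γ'.LoopVertex :=
  (dartEquiv φ).subtypeEquiv fun d => (fst_inr_iff φ h d.fst).symm

theorem index_inl {ι : Type*} (Γ : CanonicalTree n) (a : Fin n → ι) (b : Γ.LoopVertex → ι)
    (d : Γ.graph.Dart) (k : Fin n) (hd : d.fst = Sum.inl k) : Γ.index a b d = a k := by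
  unfold index
  split
  · rename_i k' h
    rw [hd] at h
    rw [Sum.inl_injective h]
  · rename_i v h
    rw [hd] at h
    cases h

theorem index_inr {ι : Type*} (Γ : CanonicalTree n) (a : Fin n → ι) (b : Γ.LoopVertex → ι)
    (d : Γ.graph.Dart) (hd : ∃ v, d.fst = Sum.inr v) : Γ.index a b d = b ⟨d, hd⟩ := by
  obtain ⟨v, hv⟩ := hd
  unfold index
  split
  · rename_i k' h
    rw [hv] at h
    cases h
  · rfl

theorem index_map {ι : Type*} (h : ∀ k : Fin n, φ (Sum.inl k) = Sum.inl k) (a : Fin n → ι)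
    (b : Γ'.LoopVertex → ι) (d : Γ.graph.Dart) :
    Γ'.index a b (dartEquiv φ d) = Γ.index a (fun x => b (loopVertexEquiv φ h x)) d := by
  rcases hd : d.fst with k | v
  · rw [index_inl Γ a _ d k hd, index_inl Γ' a b _ k (by rw [dartEquiv_fst, hd, h])]
  · rw [index_inr Γ a _ d ⟨v, hd⟩, index_inr Γ' a b _ ((fst_inr_iff φ h d.fst).2 ⟨v, hd⟩)]
    rfl

theorem loopList_map {ι : Type*} (h : ∀ k : Fin n, φ (Sum.inl k) = Sum.inl k) (σ : Fin n → Charge)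
    (b : Γ'.graph.Dart → ι) (v : Fin Γ.numInner) :
    Γ'.loopList σ b (innerEquiv φ h v) = Γ.loopList σ (fun d => b (dartEquiv φ d)) v := by
  unfold loopList
  congr 1
  funext k
  rw [path_darts_map φ h, List.filter_map, List.map_map]
  have : ((fun d : Γ'.graph.Dart => decide (d.fst = Sum.inr (innerEquiv φ h v))) ∘ dartEquiv φ)
      = fun d : Γ.graph.Dart => decide (d.fst = Sum.inr v) := by
    funext d
    simp only [Function.comp, dartEquiv_fst, ← innerEquiv_spec φ h v, φ.injective.eq_iff]
  rw [this]
  rfl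

theorem value_eq_of_iso {ι : Type*} [Fintype ι] [DecidableEq ι]
    (h : ∀ k : Fin n, φ (Sum.inl k) = Sum.inl k)
    (M S : Matrix ι ι ℂ) (t : ℝ) (σ : Fin n → Charge) (a : Fin n → ι) :
    Γ.value M S t σ a = Γ'.value M S t σ a := by
  classical
  unfold value
  symm
  refine Fintype.sum_equiv ((loopVertexEquiv φ h).symm.arrowCongr (Equiv.refl ι)) _ _ fun b => ?_
  have hb : ((loopVertexEquiv φ h).symm.arrowCongr (Equiv.refl ι)) b =
      fun x => b (loopVertexEquiv φ h x) := rfl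
  rw [hb]
  unfold unsummedValue charge
  congr 1
  · congr 1
    · refine (Fintype.prod_equiv (innerEquiv φ h) _ _ fun v => ?_).symm
      rw [loopList_map]
      simp only [index_map φ h]
    · refine (Finset.prod_equiv (dartEquiv φ) (fun d => ?_) fun d _ => ?_).symm
      · simp [dartEquiv_fst, fst_inl_iff φ h]
      · simp only [dartEquiv_symm', index_map φ h, principalRegion_map φ h]
  · refine (Finset.prod_equiv (dartEquiv φ) (fun d => ?_) fun d _ => ?_).symm
    · simp [dartEquiv_fst, dartEquiv_snd, fst_inr_iff φ h, dartEquiv_symm',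
        principalRegion_map φ h]
    · simp only [dartEquiv_symm', index_map φ h, principalRegion_map φ h]

end Invariance

theorem numInner_lt (Γ : CanonicalTree n) : Γ.numInner < n := by
  classical
  have hdeg : ∀ x, Γ.graph.degree x = (Γ.graph.neighborSet x).ncard := fun x => by
    rw [← SimpleGraph.card_neighborSet_eq_degree, ← Nat.card_eq_fintype_card]
    rfl
  have h1 := Γ.graph.sum_degrees_eq_twice_card_edges
  have h2 := Γ.isTree.card_edgeFinset
  rw [Fintype.sum_sum_type] at h1
  have h3 : ∑ k : Fin n, Γ.graph.degree (Sum.inl k) = n := by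
    simp [hdeg, Γ.ncard_external]
  have h4 : ∑ _v : Fin Γ.numInner, 3 ≤ ∑ v : Fin Γ.numInner, Γ.graph.degree (Sum.inr v) :=
    Finset.sum_le_sum fun v _ => by rw [hdeg]; exact Γ.ncard_internal v
  simp only [Finset.sum_const, Finset.card_univ, Fintype.card_fin, smul_eq_mul] at h4
  simp only [Fintype.card_sum, Fintype.card_fin] at h2
  omega

instance finite (n : ℕ) [NeZero n] : Finite (CanonicalTree n) := by
  refine Finite.of_injective
    (fun Γ : CanonicalTree n =>
      (⟨⟨Γ.numInner, Γ.numInner_lt⟩, Γ.graph⟩ :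
        Σ m : Fin n, SimpleGraph (Fin n ⊕ Fin m.val))) ?_
  rintro ⟨m, G, _, _, _, _⟩ ⟨m', G', _, _, _, _⟩ hΓ
  simp only [Sigma.mk.injEq, Fin.mk.injEq] at hΓ
  obtain ⟨rfl, hG⟩ := hΓ
  cases eq_of_heq hG
  rfl

end CanonicalTree

noncomputable instance TSP.fintype (n : ℕ) [NeZero n] : Fintype (TSP n) :=
  haveI : Finite (TSP n) := Quotient.finite _
  Fintype.ofFinite _

/-- The value `Γ^M_{t,σ,a}` of the `M`-graph of a canonical tree partition `Γ`. -/
noncomputable def TSP.value {n : ℕ} [NeZero n] {ι : Type*} [Fintype ι] [DecidableEq ι]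
    (Γ : TSP n) (M S : Matrix ι ι ℂ) (t : ℝ) (σ : Fin n → Charge) (a : Fin n → ι) : ℂ :=
  Quotient.lift (fun T : CanonicalTree n => T.value M S t σ a)
    (fun _ _ hiso => by
      obtain ⟨φ, h⟩ := hiso
      exact CanonicalTree.value_eq_of_iso φ h M S t σ a) Γ

/-!
# Primitive loops as sums over canonical tree partitions

The tree sums solve the primitive equations, and the equations have at most one solution.

*Solution.* The two-point function `Θ̂_t M̂` satisfies the Riccati equation `X' = X S X`, because
`Θ̂_t' = Θ̂_t M̂ S Θ̂_t`. For `n ≥ 3` the derivative of the value of a tree is a sum over its edges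
(`CanonicalTree.hasDerivAt_value`), in which the factor of one edge is replaced by its derivative. On
the external edge at `a_k` this multiplies the value by `Θ̂_t M̂ S` on the left
(`CanonicalTree.replacedValue_leafDart`), which is the term of the pair of adjacent regions `k`, `k + 1`
of the primitive equation; this includes the pair `(1, n)` by the symmetry of `Θ̂_t M̂`
(`sum_glueTerm`). On the internal edge `R_k ∩ R_ℓ` the derivative of `S_t Θ̂_t` factorizes as
`(Θ̂_t)ᵀ S Θ̂_t`, and cutting the tree there leaves two trees with one new leaf each, whose values carry
the two factors `Θ̂_t` (`CanonicalTree.Split.sum_value_mul_value`). Cutting is a bijection between the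
trees with a marked edge `R_k ∩ R_ℓ` and the pairs of trees in the two polygons with `n + k - ℓ + 1` and
`ℓ - k + 1` sides (`CanonicalTree.sum_cut`), so that the sum over trees and internal edges is the sum
over the pairs of non-adjacent regions in the primitive equation. At `t = 0` every tree with an internal
edge vanishes and the star gives the `M`-loop (`treeLoops_zero`).

Planarity is handled through sides: removing an edge of a tree splits its vertices into two sides, and a
directed edge lies on the path from `a_{k-1}` to `a_k` if and only if it separates these two leaves.
Thus a tree is planar if and only if the leaves beyond each directed edge form one cyclic interval, a
condition that is easily transported between a tree and its two pieces (`Collapse`, `Branch`).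

*Uniqueness.* If `X` denotes the two-point loops of a solution, then `W = (1 - t M̂ S) X - M̂` satisfies
the linear equation `W' = W S X` with `W = 0` at time `0`, so it vanishes by Gronwall's inequality. Hence
`1 + X S_t` is inverse to `1 - M̂ S_t` and `X = Θ̂_t M̂`. For `n ≥ 3` the pairs of adjacent regions give
the terms that are linear in the loops of length `n`, with coefficients known from `n = 2`, and all other
terms involve shorter loops only, so that the difference of two solutions vanishes by induction on `n`
and Gronwall's inequality (`IsPrimitiveLoops.eq_treeLoops`).
-/

/-! ### Sides of an edge of a tree -/

/-- `A` is the far side of the directed edge `u → v`: it contains `v` but not `u`, and `u → v` is the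
only directed edge that enters it. -/
structure IsSide {V : Type*} (G : SimpleGraph V) (u v : V) (A : Set V) : Prop where
  fst_notMem : u ∉ A
  snd_mem : v ∈ A
  eq_of_adj : ∀ {x y}, G.Adj x y → x ∉ A → y ∈ A → x = u ∧ y = v

/-- The vertices that remain connected to `v` when the edge between `u` and `v` is deleted. In a tree
this is the far side of `u → v`. -/
def edgeSide {V : Type*} (G : SimpleGraph V) (u v : V) : Set V :=
  {x | (G.deleteEdges {s(u, v)}).Reachable v x}

theorem SimpleGraph.Preconnected.forall_of_adj {V : Type*} {G : SimpleGraph V}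
    (hG : G.Preconnected) {P : V → Prop} {x : V} (hx : P x)
    (h : ∀ x y, G.Adj x y → P x → P y) (y : V) : P y := by
  obtain ⟨p⟩ := hG x y
  induction p with
  | nil => exact hx
  | cons hadj _ ih => exact ih (h _ _ hadj hx)

namespace IsSide

variable {V : Type*} {G : SimpleGraph V} {u v : V} {A A' : Set V}

theorem compl (h : IsSide G u v A) : IsSide G v u Aᶜ where
  fst_notMem := fun h' => h' h.snd_mem
  snd_mem := h.fst_notMem
  eq_of_adj := fun hadj hx hy => (h.eq_of_adj hadj.symm hy (not_not.1 hx)).symm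

theorem subset (hG : G.Preconnected) (h : IsSide G u v A) (h' : IsSide G u v A') : A ⊆ A' := by
  intro x hx
  by_contra hx'
  refine (hG.forall_of_adj (P := fun x => x ∈ A ∧ x ∉ A') ⟨hx, hx'⟩ ?_ u).1 |> h.fst_notMem
  rintro x y hxy ⟨h1, h2⟩
  have hy : y ∈ A := by
    by_contra hy
    exact h2 ((h.eq_of_adj hxy.symm hy h1).2 ▸ h'.snd_mem)
  refine ⟨hy, fun hy' => ?_⟩
  exact h.fst_notMem ((h'.eq_of_adj hxy h2 hy').1 ▸ h1)

theorem unique (hG : G.Preconnected) (h : IsSide G u v A) (h' : IsSide G u v A') : A = A' :=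
  (h.subset hG h').antisymm (h'.subset hG h)

theorem mem_iff_of_adj (h : IsSide G u v A) {x y : V} (hxy : G.Adj x y)
    (h1 : ¬ (x = u ∧ y = v)) (h2 : ¬ (x = v ∧ y = u)) : x ∈ A ↔ y ∈ A := by
  constructor
  · intro hx
    by_contra hy
    exact h2 (h.eq_of_adj hxy.symm hy hx).symm
  · intro hy
    by_contra hx
    exact h1 (h.eq_of_adj hxy hx hy)

theorem comap {V' : Type*} {G' : SimpleGraph V'} (f : G' ↪g G) {u v : V'}
    (h : IsSide G (f u) (f v) A) : IsSide G' u v (f ⁻¹' A) where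
  fst_notMem := h.fst_notMem
  snd_mem := h.snd_mem
  eq_of_adj := fun hadj hx hy =>
    (h.eq_of_adj (f.map_rel_iff.2 hadj) hx hy).imp (fun e => f.injective e) fun e => f.injective e

theorem walk_mem (h : IsSide G u v A) {x y : V} (p : G.Walk x y) (hx : x ∈ A)
    (hu : u ∉ p.support) : y ∈ A := by
  induction p with
  | nil => exact hx
  | @cons a b c hadj p ih =>
    rw [SimpleGraph.Walk.support_cons, List.mem_cons, not_or] at hu
    refine ih ?_ hu.2
    by_contra hb
    have := h.compl.eq_of_adj hadj (not_not.2 hx) hb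
    exact hu.2 (this.2 ▸ p.start_mem_support)

/-- A path of a tree runs through the edge `u → v` exactly if it starts outside and ends inside the
far side of that edge. -/
theorem mem_darts_iff {d : G.Dart} (h : IsSide G d.fst d.snd A) {x y : V} (p : G.Walk x y)
    (hp : p.IsPath) : d ∈ p.darts ↔ x ∉ A ∧ y ∈ A := by
  induction p with
  | nil => simp
  | @cons a b c hadj p ih =>
    rw [SimpleGraph.Walk.cons_isPath_iff] at hp
    rw [SimpleGraph.Walk.darts_cons, List.mem_cons, ih hp.1]
    by_cases h1 : a = d.fst ∧ b = d.snd
    · have hd : d = ⟨(a, b), hadj⟩ := by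
        ext
        · exact h1.1.symm
        · exact h1.2.symm
      have hb : b ∈ A := h1.2 ▸ h.snd_mem
      have ha : a ∉ A := h1.1 ▸ h.fst_notMem
      have hc : c ∈ A := h.walk_mem p hb (h1.1 ▸ hp.2)
      simp [hd, ha, hc]
    · have hd : d ≠ ⟨(a, b), hadj⟩ := fun hd => h1 (by rw [hd]; exact ⟨rfl, rfl⟩)
      by_cases h2 : a = d.snd ∧ b = d.fst
      · have hb : b ∉ A := h2.2 ▸ h.fst_notMem
        have ha : a ∈ A := h2.1 ▸ h.snd_mem
        have hc : c ∉ A := h.compl.walk_mem p hb (h2.1 ▸ hp.2)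
        simp [hd, ha, hc]
      · rw [h.mem_iff_of_adj hadj h1 h2]
        simp [hd]

end IsSide

theorem SimpleGraph.IsAcyclic.isSide_edgeSide {V : Type*} {G : SimpleGraph V} (hG : G.IsAcyclic)
    {u v : V} (huv : G.Adj u v) : IsSide G u v (edgeSide G u v) where
  fst_notMem := fun h =>
    (SimpleGraph.isBridge_iff.1 (SimpleGraph.isAcyclic_iff_forall_adj_isBridge.1 hG huv)) h.symm
  snd_mem := SimpleGraph.Reachable.refl _
  eq_of_adj := by
    intro x y hxy hx hy
    by_cases he : s(x, y) = s(u, v)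
    · rcases Sym2.eq_iff.1 he with h | h
      · exact h
      · exact absurd (h.1 ▸ SimpleGraph.Reachable.refl _) hx
    · refine absurd (hy.trans (SimpleGraph.Adj.reachable ?_)) hx
      rw [SimpleGraph.deleteEdges_adj]
      exact ⟨hxy.symm, by rwa [Set.mem_singleton_iff, @Sym2.eq_swap _ y x]⟩

/-- A graph is acyclic as soon as each of its directed edges has a far side. -/
theorem SimpleGraph.isAcyclic_of_isSide {V : Type*} {G : SimpleGraph V}
    (h : ∀ u v, G.Adj u v → ∃ A, IsSide G u v A) : G.IsAcyclic := by
  refine SimpleGraph.isAcyclic_iff_forall_adj_isBridge.2 fun u v huv => ?_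
  obtain ⟨A, hA⟩ := h u v huv
  rw [SimpleGraph.isBridge_iff]
  rintro ⟨p⟩
  have : ∀ {x y} (_ : (G.deleteEdges {s(u, v)}).Walk x y), x ∉ A → y ∉ A := by
    intro x y p
    induction p with
    | nil => exact id
    | @cons a b c hadj p ih =>
      intro ha
      refine ih fun hb => ?_
      rw [SimpleGraph.deleteEdges_adj] at hadj
      obtain ⟨rfl, rfl⟩ := hA.eq_of_adj hadj.1 ha hb
      exact hadj.2 rfl
  exact this p hA.fst_notMem hA.snd_mem

namespace CanonicalTree

variable {n : ℕ} [NeZero n] (Γ : CanonicalTree n)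

/-- The vertices of the tree beyond the directed edge `d`. -/
def side (d : Γ.graph.Dart) : Set (Fin n ⊕ Fin Γ.numInner) := edgeSide Γ.graph d.fst d.snd

theorem isSide (d : Γ.graph.Dart) : IsSide Γ.graph d.fst d.snd (Γ.side d) :=
  Γ.isTree.isAcyclic.isSide_edgeSide d.adj

theorem preconnected : Γ.graph.Preconnected := Γ.isTree.connected.preconnected

theorem eq_side {d : Γ.graph.Dart} {A} (h : IsSide Γ.graph d.fst d.snd A) : A = Γ.side d :=
  h.unique Γ.preconnected (Γ.isSide d)

theorem side_symm (d : Γ.graph.Dart) : Γ.side d.symm = (Γ.side d)ᶜ :=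
  (Γ.eq_side (d := d.symm) (Γ.isSide d).compl).symm

theorem mem_path_darts {d : Γ.graph.Dart} {k : Fin n} :
    d ∈ (Γ.path k).darts ↔ Sum.inl (k - 1) ∉ Γ.side d ∧ Sum.inl k ∈ Γ.side d :=
  (Γ.isSide d).mem_darts_iff _ (treePath_isPath Γ.isTree _ _)

theorem principalRegion_eq_iff {d : Γ.graph.Dart} {k : Fin n} :
    Γ.principalRegion d = k ↔ Sum.inl (k - 1) ∈ Γ.side d ∧ Sum.inl k ∉ Γ.side d := by
  have : Γ.principalRegion d = k ↔ d.symm ∈ (Γ.path k).darts :=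
    ⟨fun h => h ▸ Γ.principalRegion_spec d, fun h => (Γ.eq_principalRegion h).symm⟩
  rw [this, mem_path_darts, side_symm]
  simp

theorem mem_path_darts_iff {d : Γ.graph.Dart} {k : Fin n} :
    d ∈ (Γ.path k).darts ↔ Γ.principalRegion d.symm = k := by
  rw [principalRegion_eq_iff, mem_path_darts, side_symm]
  simp

/-- A tree is planar when the leaves beyond each directed edge form one cyclic interval. -/
theorem planar_of_existsUnique {V : Type*} {G : SimpleGraph V} (hG : G.IsTree) (leaf : Fin n → V)
    (side : G.Dart → Set V) (hside : ∀ d, IsSide G d.fst d.snd (side d))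
    (h : ∀ d, ∃! k, leaf (k - 1) ∉ side d ∧ leaf k ∈ side d) (d : G.Dart) :
    ∃! k : Fin n, d ∈ (treePath hG (leaf (k - 1)) (leaf k)).darts := by
  convert h d using 3 with k
  exact (hside d).mem_darts_iff _ (treePath_isPath hG _ _)

end CanonicalTree

/-! ### Branches of a canonical tree -/

/-- A cyclic block `block` of labels in `Fin n` is collapsed to one label. The order embedding `emb`
sends the `i`-th side of the smaller polygon to the corresponding side of the `n`-gon; it also sends
each vertex other than `special` to the corresponding vertex. The vertex `special` stands for the
whole block. -/
structure Collapse (n' n : ℕ) [NeZero n'] [NeZero n] where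
  special : Fin n'
  emb : Fin n' → Fin n
  block : Set (Fin n)
  strictMono : StrictMono emb
  emb_sub_one : ∀ i, i ≠ special + 1 → emb i - 1 = emb (i - 1)
  emb_mem_block : ∀ i, emb i ∈ block ↔ i = special
  sub_one_mem_block : emb (special + 1) - 1 ∈ block
  mem_block_of_notMem_range : ∀ j, j ∉ Set.range emb → j ∈ block ∧ j - 1 ∈ block

namespace Collapse

variable {n' n : ℕ} [NeZero n'] [NeZero n] (C : Collapse n' n)

/-- For a set of labels that does not separate the block, entering the set at `emb i` in the `n`-gon is
the same as entering its trace at `i` in the smaller polygon. -/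
theorem enters_iff {A : Set (Fin n)} (hA : ∀ j ∈ C.block, (j ∈ A ↔ C.emb C.special ∈ A)) (i : Fin n') :
    (C.emb i - 1 ∉ A ∧ C.emb i ∈ A) ↔ (C.emb (i - 1) ∉ A ∧ C.emb i ∈ A) := by
  by_cases hi : i = C.special + 1
  · subst hi
    rw [hA _ C.sub_one_mem_block, add_sub_cancel_right]
  · rw [C.emb_sub_one i hi]

theorem mem_range_of_enters {A : Set (Fin n)}
    (hA : ∀ j ∈ C.block, (j ∈ A ↔ C.emb C.special ∈ A)) {j : Fin n} (h1 : j - 1 ∉ A) (h2 : j ∈ A) :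
    j ∈ Set.range C.emb := by
  by_contra hj
  obtain ⟨h3, h4⟩ := C.mem_block_of_notMem_range j hj
  rw [hA _ h4] at h1
  rw [hA _ h3] at h2
  exact h1 h2

theorem existsUnique_enters_iff {A : Set (Fin n)}
    (hA : ∀ j ∈ C.block, (j ∈ A ↔ C.emb C.special ∈ A)) :
    (∃! j, j - 1 ∉ A ∧ j ∈ A) ↔ ∃! i, C.emb (i - 1) ∉ A ∧ C.emb i ∈ A := by
  constructor
  · rintro ⟨j, hj, huniq⟩
    obtain ⟨i, rfl⟩ := C.mem_range_of_enters hA hj.1 hj.2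
    refine ⟨i, (C.enters_iff hA i).1 hj, fun i' hi' => ?_⟩
    exact C.strictMono.injective (huniq _ ((C.enters_iff hA i').2 hi'))
  · rintro ⟨i, hi, huniq⟩
    refine ⟨C.emb i, (C.enters_iff hA i).2 hi, ?_⟩
    rintro j ⟨h1, h2⟩
    obtain ⟨i', rfl⟩ := C.mem_range_of_enters hA h1 h2
    rw [huniq i' ((C.enters_iff hA i').1 ⟨h1, h2⟩)]

end Collapse

namespace CanonicalTree

variable {n' n : ℕ} [NeZero n'] [NeZero n]

/-- An edge on the near side of `e` does not separate the vertices beyond `e`. -/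
theorem mem_side_iff_of_near (Γ : CanonicalTree n) {e d : Γ.graph.Dart}
    (h₁ : d.fst ∉ Γ.side e ∨ d.fst = e.snd) (h₂ : d.snd ∉ Γ.side e ∨ d.snd = e.snd) {x}
    (hx : x ∈ Γ.side e) : x ∈ Γ.side d ↔ e.snd ∈ Γ.side d := by
  -- Replacing the part of `Γ.side d` beyond `e` by all or nothing gives a far side of `d` again.
  let A : Set (Fin n ⊕ Fin Γ.numInner) :=
    {y | (y ∉ Γ.side e ∧ y ∈ Γ.side d) ∨ (y ∈ Γ.side e ∧ e.snd ∈ Γ.side d)}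
  have hsnd : e.snd ∈ Γ.side e := (Γ.isSide e).snd_mem
  have hnear : ∀ y, (y ∉ Γ.side e ∨ y = e.snd) → (y ∈ A ↔ y ∈ Γ.side d) := by
    rintro y (h | h)
    · simp [A, h]
    · simp [A, h, hsnd]
  have hside := Γ.isSide d
  have hA : IsSide Γ.graph d.fst d.snd A := by
    refine ⟨?_, ?_, ?_⟩
    · rw [hnear _ h₁]; exact hside.fst_notMem
    · rw [hnear _ h₂]; exact hside.snd_mem
    · intro y z hyz hy hz
      by_cases hye : y ∈ Γ.side e
      · by_cases hze : z ∈ Γ.side e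
        · rcases hz with hz | hz
          · exact absurd hze hz.1
          · exact absurd (Or.inr ⟨hye, hz.2⟩) hy
        · obtain ⟨rfl, rfl⟩ := (Γ.isSide e).eq_of_adj hyz.symm hze hye
          rw [hnear _ (Or.inr rfl)] at hy
          rw [hnear _ (Or.inl hze)] at hz
          exact hside.eq_of_adj hyz hy hz
      · by_cases hze : z ∈ Γ.side e
        · obtain ⟨rfl, rfl⟩ := (Γ.isSide e).eq_of_adj hyz hye hze
          rw [hnear _ (Or.inl hye)] at hy
          rw [hnear _ (Or.inr rfl)] at hz
          exact hside.eq_of_adj hyz hy hz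
        · rw [hnear _ (Or.inl hye)] at hy
          rw [hnear _ (Or.inl hze)] at hz
          exact hside.eq_of_adj hyz hy hz
  exact (Set.ext_iff.1 (Γ.eq_side hA) x).symm.trans (by simp [A, hx])

/-- The tree `Γ'` is the part of `Γ` on the near side of the directed edge `e`, with `e` kept as an
external edge: the special leaf of `Γ'` is the far end of `e`, and the leaves of `Γ` beyond `e` form the
collapsed block. -/
structure Branch (C : Collapse n' n) (Γ' : CanonicalTree n') (Γ : CanonicalTree n)
    (e : Γ.graph.Dart) where
  toEmb : Γ'.graph ↪g Γ.graph
  map_leaf : ∀ i, i ≠ C.special → toEmb (Sum.inl i) = Sum.inl (C.emb i)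
  map_special : toEmb (Sum.inl C.special) = e.snd
  mem_range_iff : ∀ x, x ∈ Set.range toEmb ↔ x ∉ Γ.side e ∨ x = e.snd
  leaf_mem_side_iff : ∀ j, Sum.inl j ∈ Γ.side e ↔ j ∈ C.block

namespace Branch

variable {C : Collapse n' n} {Γ' : CanonicalTree n'} {Γ : CanonicalTree n} {e : Γ.graph.Dart}
  (B : Branch C Γ' Γ e)

/-- The directed edges of a branch, as directed edges of the ambient tree. -/
def dart (d : Γ'.graph.Dart) : Γ.graph.Dart := B.toEmb.toHom.mapDart d

@[simp] theorem dart_fst (d : Γ'.graph.Dart) : (B.dart d).fst = B.toEmb d.fst := rfl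

@[simp] theorem dart_snd (d : Γ'.graph.Dart) : (B.dart d).snd = B.toEmb d.snd := rfl

theorem dart_symm (d : Γ'.graph.Dart) : B.dart d.symm = (B.dart d).symm := rfl

theorem dart_injective : Function.Injective B.dart := by
  intro d d' h
  ext
  · exact B.toEmb.injective (congrArg (fun d => d.fst) h)
  · exact B.toEmb.injective (congrArg (fun d => d.snd) h)

theorem preimage_side (d : Γ'.graph.Dart) : B.toEmb ⁻¹' Γ.side (B.dart d) = Γ'.side d :=
  Γ'.eq_side ((Γ.isSide (B.dart d)).comap B.toEmb)

theorem mem_side_dart_iff (d : Γ'.graph.Dart) {x} (hx : x ∈ Γ.side e) :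
    x ∈ Γ.side (B.dart d) ↔ e.snd ∈ Γ.side (B.dart d) :=
  Γ.mem_side_iff_of_near ((B.mem_range_iff _).1 ⟨d.fst, rfl⟩) ((B.mem_range_iff _).1 ⟨d.snd, rfl⟩) hx

theorem leaf_mem_side_dart_iff (d : Γ'.graph.Dart) (i : Fin n') :
    Sum.inl (C.emb i) ∈ Γ.side (B.dart d) ↔ Sum.inl i ∈ Γ'.side d := by
  rw [← B.preimage_side, Set.mem_preimage]
  by_cases hi : i = C.special
  · subst hi
    rw [B.map_special, B.mem_side_dart_iff]
    rw [B.leaf_mem_side_iff, C.emb_mem_block]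
  · rw [B.map_leaf i hi]

theorem block_mem_side_dart_iff (d : Γ'.graph.Dart) (j : Fin n) (hj : j ∈ C.block) :
    j ∈ {j | Sum.inl j ∈ Γ.side (B.dart d)} ↔
      C.emb C.special ∈ {j | Sum.inl j ∈ Γ.side (B.dart d)} := by
  rw [Set.mem_ofPred_eq, Set.mem_ofPred_eq, B.mem_side_dart_iff, ← B.mem_side_dart_iff]
  · rw [B.leaf_mem_side_iff, C.emb_mem_block]
  · rwa [B.leaf_mem_side_iff]

theorem dart_mem_path_iff (d : Γ'.graph.Dart) (i : Fin n') :
    B.dart d ∈ (Γ.path (C.emb i)).darts ↔ d ∈ (Γ'.path i).darts := by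
  rw [mem_path_darts, mem_path_darts, ← B.leaf_mem_side_dart_iff, ← B.leaf_mem_side_dart_iff]
  exact C.enters_iff (A := {j | Sum.inl j ∈ Γ.side (B.dart d)}) (B.block_mem_side_dart_iff d) i

theorem principalRegion_dart (d : Γ'.graph.Dart) :
    Γ.principalRegion (B.dart d) = C.emb (Γ'.principalRegion d) := by
  have := (B.dart_mem_path_iff d.symm (Γ'.principalRegion d)).2 (Γ'.principalRegion_spec d)
  exact (Γ.eq_principalRegion this).symm

theorem exists_map_inner (hn : ∃ v, e.snd = Sum.inr v) (u : Fin Γ'.numInner) :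
    ∃ v, B.toEmb (Sum.inr u) = Sum.inr v := by
  rcases h : B.toEmb (Sum.inr u) with j | v
  · exfalso
    obtain ⟨v, hv⟩ := hn
    have h1 : (Sum.inl j : Fin n ⊕ Fin Γ.numInner) ∈ Set.range B.toEmb := ⟨_, h⟩
    have h2 : j ∉ C.block := by
      rw [← B.leaf_mem_side_iff]
      rcases (B.mem_range_iff _).1 h1 with h3 | h3
      · exact h3
      · rw [hv] at h3; cases h3
    have h3 : j ∈ Set.range C.emb := by
      by_contra h3
      exact h2 (C.mem_block_of_notMem_range j h3).1
    obtain ⟨i, rfl⟩ := h3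
    rw [C.emb_mem_block] at h2
    rw [← B.map_leaf i h2] at h
    cases B.toEmb.injective h
  · exact ⟨v, rfl⟩

/-- Every neighbour of a vertex of the branch other than the special leaf is in the branch. -/
theorem exists_dart_eq {d : Γ.graph.Dart} {x} (hx : B.toEmb x = d.fst)
    (hs : x ≠ Sum.inl C.special) : ∃ d', B.dart d' = d ∧ d'.fst = x := by
  have h1 : d.fst ∉ Γ.side e := by
    rcases (B.mem_range_iff _).1 ⟨x, hx⟩ with h | h
    · exact h
    · rw [← B.map_special, ← hx] at h
      exact absurd (B.toEmb.injective h) hs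
  have h2 : d.snd ∈ Set.range B.toEmb := by
    rw [B.mem_range_iff]
    by_contra! h3
    exact h3.2 ((Γ.isSide e).eq_of_adj d.adj h1 h3.1).2
  obtain ⟨y, hy⟩ := h2
  refine ⟨⟨(x, y), ?_⟩, ?_, rfl⟩
  · rw [← B.toEmb.map_rel_iff]
    change Γ.graph.Adj (B.toEmb x) (B.toEmb y)
    rw [hx, hy]
    exact d.adj
  · ext
    · exact hx
    · exact hy

end Branch

/-! ### The loops of `M`-edges around the vertices of a branch -/

theorem length_filter_fst_le {V : Type*} [DecidableEq V] {G : SimpleGraph V} {u w : V} (p : G.Walk u w)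
    (hp : p.IsPath) (v : V) : (p.darts.filter fun d => d.fst = v).length ≤ 1 := by
  have h1 : (p.darts.map fun d => d.fst).Nodup := by
    rw [SimpleGraph.Walk.map_fst_darts]
    exact hp.support_nodup.sublist (List.dropLast_sublist _)
  have h2 := (List.filter_sublist (p := fun d : G.Dart => decide (d.fst = v)) (l := p.darts)).map
    (fun d : G.Dart => d.fst)
  have h3 := h1.sublist h2
  have h4 : ∀ y ∈ (p.darts.filter fun d => d.fst = v).map (fun d => d.fst), y = v := by
    intro y hy
    simp only [List.mem_map, List.mem_filter, decide_eq_true_eq] at hy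
    obtain ⟨d, hd, rfl⟩ := hy
    exact hd.2
  have h5 := List.eq_replicate_of_mem h4
  rw [h5, List.nodup_replicate] at h3
  simpa using h3

theorem _root_.List.eq_of_length_le_one {α : Type*} {l l' : List α} (h : l.length ≤ 1)
    (h' : l'.length ≤ 1) (hmem : ∀ x, x ∈ l ↔ x ∈ l') : l = l' := by
  match l, l', h, h' with
  | [], [], _, _ => rfl
  | [], [b], _, _ => exact absurd ((hmem b).2 (by simp)) (by simp)
  | [a], [], _, _ => exact absurd ((hmem a).1 (by simp)) (by simp)
  | [a], [b], _, _ =>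
    have := (hmem a).1 (by simp)
    simp only [List.mem_singleton] at this
    rw [this]

theorem _root_.List.flatMap_finRange_of_strictMono {α : Type*} {m k : ℕ} {f : Fin m → Fin k}
    (hf : StrictMono f) (g : Fin k → List α) (hg : ∀ j, j ∉ Set.range f → g j = []) :
    (List.finRange k).flatMap g = (List.finRange m).flatMap fun i => g (f i) := by
  classical
  have h1 : (List.finRange k).filter (fun j => j ∈ Set.range f) = (List.finRange m).map f := by
    refine List.Perm.eq_of_pairwise (le := (· < ·)) (fun a b _ _ h h' => absurd h (lt_asymm h'))
      ((List.pairwise_lt_finRange k).filter _) ?_ ?_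
    · exact (List.pairwise_lt_finRange m).map f fun a b h => hf h
    · rw [List.perm_ext_iff_of_nodup ((List.nodup_finRange k).filter _)
        ((List.nodup_finRange m).map hf.injective)]
      simp
  have h2 : ∀ l : List (Fin k), l.flatMap g = (l.filter fun j => j ∈ Set.range f).flatMap g := by
    intro l
    induction l with
    | nil => rfl
    | cons a l ih =>
      by_cases ha : a ∈ Set.range f
      · simp only [List.flatMap_cons, List.filter_cons, ha, decide_true, if_true, ih]
      · simp only [List.flatMap_cons, List.filter_cons, ha, decide_false, ih, hg a ha]
        simp
  rw [h2, h1, List.flatMap_map]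

theorem Branch.loopList_eq {ι : Type*} {C : Collapse n' n} {Γ' : CanonicalTree n'}
    {Γ : CanonicalTree n} {e : Γ.graph.Dart} (B : Branch C Γ' Γ e)
    (σ : Fin n → Charge) (b : Γ.graph.Dart → ι) (u : Fin Γ'.numInner) (v : Fin Γ.numInner)
    (huv : B.toEmb (Sum.inr u) = Sum.inr v) :
    Γ.loopList σ b v = Γ'.loopList (fun i => σ (C.emb i)) (fun d => b (B.dart d)) u := by
  classical
  unfold loopList
  rw [List.flatMap_finRange_of_strictMono C.strictMono]
  · congr 1
    funext i
    have : ((Γ.path (C.emb i)).darts.filter fun d => d.fst = Sum.inr v) =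
        ((Γ'.path i).darts.filter fun d => d.fst = Sum.inr u).map B.dart := by
      refine List.eq_of_length_le_one ?_ ?_ fun d => ?_
      · exact length_filter_fst_le _ (treePath_isPath _ _ _) _
      · rw [List.length_map]
        exact length_filter_fst_le _ (treePath_isPath _ _ _) _
      · simp only [List.mem_filter, decide_eq_true_eq, List.mem_map]
        constructor
        · rintro ⟨h1, h2⟩
          obtain ⟨d', rfl, hd'⟩ := B.exists_dart_eq (x := Sum.inr u) (huv.trans h2.symm) (by simp)
          exact ⟨d', ⟨(B.dart_mem_path_iff d' i).1 h1, hd'⟩, rfl⟩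
        · rintro ⟨d', ⟨h1, h2⟩, rfl⟩
          exact ⟨(B.dart_mem_path_iff d' i).2 h1, by rw [B.dart_fst, h2, huv]⟩
    rw [this, List.map_map]
    rfl
  · intro j hj
    rw [List.map_eq_nil_iff, List.filter_eq_nil_iff]
    intro d hd h
    rw [decide_eq_true_eq] at h
    obtain ⟨d', rfl, -⟩ := B.exists_dart_eq (x := Sum.inr u) (huv.trans h.symm) (by simp)
    refine hj ?_
    rw [mem_path_darts_iff, ← B.dart_symm, B.principalRegion_dart] at hd
    exact ⟨_, hd⟩

end CanonicalTree

/-! ### External edges and edge factors -/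

namespace CanonicalTree

variable {n : ℕ} [NeZero n] (Γ : CanonicalTree n)

theorem exists_leafDart (k : Fin n) : ∃ d : Γ.graph.Dart, d.fst = Sum.inl k := by
  obtain ⟨x, hx⟩ := Set.ncard_eq_one.1 (Γ.ncard_external k)
  have : x ∈ Γ.graph.neighborSet (Sum.inl k) := hx ▸ Set.mem_singleton x
  exact ⟨⟨(Sum.inl k, x), this⟩, rfl⟩

/-- The external edge at the leaf `a_k`, directed away from the leaf. -/
noncomputable def leafDart (k : Fin n) : Γ.graph.Dart := (Γ.exists_leafDart k).choose

@[simp] theorem leafDart_fst (k : Fin n) : (Γ.leafDart k).fst = Sum.inl k :=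
  (Γ.exists_leafDart k).choose_spec

theorem eq_leafDart {d : Γ.graph.Dart} {k : Fin n} (h : d.fst = Sum.inl k) : d = Γ.leafDart k := by
  obtain ⟨x, hx⟩ := Set.ncard_eq_one.1 (Γ.ncard_external k)
  have key : ∀ d : Γ.graph.Dart, d.fst = Sum.inl k → d.snd = x := by
    intro d hd
    have : d.snd ∈ Γ.graph.neighborSet (Sum.inl k) := by
      rw [SimpleGraph.mem_neighborSet, ← hd]
      exact d.adj
    rwa [hx] at this
  ext
  · rw [h, leafDart_fst]
  · rw [key d h, key _ (Γ.leafDart_fst k)]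

theorem exists_leafDart_snd (hn : 3 ≤ n) (k : Fin n) : ∃ v, (Γ.leafDart k).snd = Sum.inr v := by
  rcases h : (Γ.leafDart k).snd with j | v
  · exfalso
    have hj : (Γ.leafDart k).symm = Γ.leafDart j := Γ.eq_leafDart h
    have key := Γ.preconnected.forall_of_adj (P := fun x => x = Sum.inl k ∨ x = Sum.inl j)
      (x := Sum.inl k) (Or.inl rfl) (by
        rintro x y hxy (rfl | rfl)
        · right
          have := Γ.eq_leafDart (d := ⟨(Sum.inl k, y), hxy⟩) rfl
          rw [← h, ← this]
        · left
          have := Γ.eq_leafDart (d := ⟨(Sum.inl j, y), hxy⟩) rfl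
          rw [← hj] at this
          have h2 := congrArg (fun d => d.snd) this
          simpa using h2)
    have h3 : (Finset.univ : Finset (Fin n)) ⊆ {k, j} := by
      intro i _
      simpa using key (Sum.inl i)
    have := (Finset.card_le_card h3).trans Finset.card_le_two
    rw [Finset.card_univ, Fintype.card_fin] at this
    omega
  · exact ⟨v, rfl⟩

/-- The region `R_k` is the principal region of the leaf `a_k`. -/
theorem principalRegion_leafDart (k : Fin n) : Γ.principalRegion (Γ.leafDart k) = k := by
  have hk := Γ.principalRegion_spec (Γ.leafDart k)
  rw [mem_path_darts] at hk
  have h : IsSide Γ.graph (Γ.leafDart k).symm.fst (Γ.leafDart k).symm.snd {Sum.inl k} := by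
    refine ⟨fun h => ?_, ?_, ?_⟩
    · have := (Γ.leafDart k).snd_ne_fst
      rw [leafDart_fst] at this
      exact this h
    · exact Γ.leafDart_fst k
    · rintro x y hxy hx rfl
      have := Γ.eq_leafDart (d := ⟨(Sum.inl k, x), hxy.symm⟩) rfl
      rw [← this]
      exact ⟨rfl, rfl⟩
  rw [← Γ.eq_side h] at hk
  exact Sum.inl_injective hk.2

/-- The principal region of the vertex to which the leaf `a_k` is attached is `R_{k+1}`. -/
theorem principalRegion_leafDart_symm (k : Fin n) :
    Γ.principalRegion (Γ.leafDart k).symm = k + 1 := by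
  have hk := Γ.principalRegion_spec (Γ.leafDart k).symm
  rw [mem_path_darts, SimpleGraph.Dart.symm_symm] at hk
  have h : IsSide Γ.graph (Γ.leafDart k).fst (Γ.leafDart k).snd {Sum.inl k}ᶜ := by
    refine ⟨fun h => h (Γ.leafDart_fst k), fun h => ?_, ?_⟩
    · have := (Γ.leafDart k).snd_ne_fst
      rw [leafDart_fst] at this
      exact this h
    · intro x y hxy hx _
      obtain rfl : x = Sum.inl k := not_not.1 hx
      have := Γ.eq_leafDart (d := ⟨(Sum.inl k, y), hxy⟩) rfl
      rw [← this]
      exact ⟨rfl, rfl⟩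
  rw [← Γ.eq_side h] at hk
  exact sub_eq_iff_eq_add.1 (Sum.inl_injective (not_not.1 hk.1))

open Classical in
/-- One directed edge for each edge of the tree: external edges point away from the leaf, internal edges
`R_k ∩ R_ℓ` are directed so that the principal region `R_k` of the tail has `k < ℓ`. -/
noncomputable def orientedEdges : Finset Γ.graph.Dart :=
  {d | (∃ k, d.fst = Sum.inl k) ∨ ((∃ v, d.fst = Sum.inr v) ∧ (∃ w, d.snd = Sum.inr w) ∧
    Γ.principalRegion d < Γ.principalRegion d.symm)}

theorem mem_orientedEdges {d : Γ.graph.Dart} : d ∈ Γ.orientedEdges ↔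
    (∃ k, d.fst = Sum.inl k) ∨ ((∃ v, d.fst = Sum.inr v) ∧ (∃ w, d.snd = Sum.inr w) ∧
      Γ.principalRegion d < Γ.principalRegion d.symm) := by
  simp [orientedEdges]

variable {ι : Type*} [Fintype ι] [DecidableEq ι] (M S : Matrix ι ι ℂ) (t : ℝ)

open Classical in
/-- The matrix attached to an edge of the `M`-graph: `Θ̂_t` for an external edge, `S_t Θ̂_t` for an
internal edge. -/
noncomputable def edgeMatrix (σ : Fin n → Charge) (d : Γ.graph.Dart) : Matrix ι ι ℂ :=
  if ∃ k, d.fst = Sum.inl k then thetaHat M S t (Γ.charge σ d) (Γ.charge σ d.symm)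
  else sT S t * thetaHat M S t (Γ.charge σ d) (Γ.charge σ d.symm)

open Classical in
/-- The value of the `M`-graph at fixed indices `x`, without the factor of the edge `e`. -/
noncomputable def erasedValue (σ : Fin n → Charge) (x : Γ.graph.Dart → ι) (e : Γ.graph.Dart) : ℂ :=
  (∏ v : Fin Γ.numInner, mLoopList M (Γ.loopList σ x v)) *
    ∏ d ∈ Γ.orientedEdges.erase e, Γ.edgeMatrix M S t σ d (x d) (x d.symm)

theorem unsummedValue_eq (σ : Fin n → Charge) (a : Fin n → ι) (b : Γ.LoopVertex → ι) :
    Γ.unsummedValue M S t σ a b = (∏ v : Fin Γ.numInner, mLoopList M (Γ.loopList σ (Γ.index a b) v)) *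
      ∏ d ∈ Γ.orientedEdges,
        Γ.edgeMatrix M S t σ d (Γ.index a b d) (Γ.index a b d.symm) := by
  classical
  have h : Γ.orientedEdges = Finset.univ.filter (fun d : Γ.graph.Dart => ∃ k, d.fst = Sum.inl k) ∪
      Finset.univ.filter (fun d : Γ.graph.Dart => (∃ v, d.fst = Sum.inr v) ∧
        (∃ w, d.snd = Sum.inr w) ∧ Γ.principalRegion d < Γ.principalRegion d.symm) := by
    ext d
    simp [mem_orientedEdges]
  rw [h, Finset.prod_union, ← mul_assoc, unsummedValue]
  · congr 1
    · congr 1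
      refine Finset.prod_congr (by ext; simp) fun d hd => ?_
      rw [edgeMatrix, if_pos (by simpa using hd)]
    · refine Finset.prod_congr (by ext; simp) fun d hd => ?_
      rw [edgeMatrix, if_neg]
      simp only [Finset.mem_filter, Finset.mem_univ, true_and] at hd
      obtain ⟨⟨v, hv⟩, -⟩ := hd
      simp [hv]
  · rw [Finset.disjoint_left]
    intro d h1 h2
    simp only [Finset.mem_filter, Finset.mem_univ, true_and] at h1 h2
    obtain ⟨k, hk⟩ := h1
    obtain ⟨⟨v, hv⟩, -⟩ := h2
    rw [hk] at hv
    cases hv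

theorem unsummedValue_eq_erasedValue_mul (σ : Fin n → Charge) (a : Fin n → ι)
    (b : Γ.LoopVertex → ι) {e : Γ.graph.Dart} (he : e ∈ Γ.orientedEdges) :
    Γ.unsummedValue M S t σ a b = Γ.erasedValue M S t σ (Γ.index a b) e *
      Γ.edgeMatrix M S t σ e (Γ.index a b e) (Γ.index a b e.symm) := by
  classical
  rw [unsummedValue_eq, erasedValue, mul_assoc, Finset.prod_erase_mul _ _ he]

theorem loopList_congr {κ : Type*} (σ : Fin n → Charge) {x y : Γ.graph.Dart → κ} (v : Fin Γ.numInner)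
    (h : ∀ d : Γ.graph.Dart, d.fst = Sum.inr v → x d = y d) :
    Γ.loopList σ x v = Γ.loopList σ y v := by
  classical
  unfold loopList
  congr 1
  funext k
  refine List.map_congr_left fun d hd => ?_
  rw [List.mem_filter, decide_eq_true_eq] at hd
  rw [h d hd.2]

theorem leafDart_mem_orientedEdges (k : Fin n) : Γ.leafDart k ∈ Γ.orientedEdges :=
  Γ.mem_orientedEdges.2 (Or.inl ⟨k, Γ.leafDart_fst k⟩)

theorem symm_ne_leafDart (hn : 3 ≤ n) {d : Γ.graph.Dart} (hd : d ∈ Γ.orientedEdges) (k : Fin n) :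
    d.symm ≠ Γ.leafDart k := by
  intro h
  have h1 : d = (Γ.leafDart k).symm := by rw [← h, SimpleGraph.Dart.symm_symm]
  obtain ⟨v, hv⟩ := Γ.exists_leafDart_snd hn k
  have h2 : d.fst = Sum.inr v := by rw [h1]; exact hv
  have h3 : d.snd = Sum.inl k := by rw [h1]; exact Γ.leafDart_fst k
  rw [mem_orientedEdges, h2, h3] at hd
  simp at hd

/-- Without the factor of the external edge at `a_k`, the value does not involve the index `a_k`. -/
theorem erasedValue_leafDart_congr (hn : 3 ≤ n) (σ : Fin n → Charge) {x y : Γ.graph.Dart → ι}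
    (k : Fin n) (h : ∀ d, d ≠ Γ.leafDart k → x d = y d) :
    Γ.erasedValue M S t σ x (Γ.leafDart k) = Γ.erasedValue M S t σ y (Γ.leafDart k) := by
  classical
  unfold erasedValue
  congr 1
  · refine Finset.prod_congr rfl fun v _ => ?_
    rw [Γ.loopList_congr σ v fun d hd => h d ?_]
    rintro rfl
    simp at hd
  · refine Finset.prod_congr rfl fun d hd => ?_
    rw [Finset.mem_erase] at hd
    rw [h d hd.1, h d.symm (Γ.symm_ne_leafDart hn hd.2 k)]

theorem index_leafDart {κ : Type*} (a : Fin n → κ) (b : Γ.LoopVertex → κ) (k : Fin n) :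
    Γ.index a b (Γ.leafDart k) = a k :=
  Γ.index_inl a b _ k (Γ.leafDart_fst k)

theorem index_congr {κ : Type*} {a a' : Fin n → κ} (b : Γ.LoopVertex → κ) (k : Fin n)
    (h : ∀ j, j ≠ k → a j = a' j) (d : Γ.graph.Dart) (hd : d ≠ Γ.leafDart k) :
    Γ.index a b d = Γ.index a' b d := by
  rcases hf : d.fst with j | v
  · rw [Γ.index_inl a b d j hf, Γ.index_inl a' b d j hf]
    refine h j ?_
    rintro rfl
    exact hd (Γ.eq_leafDart hf)
  · rw [Γ.index_inr a b d ⟨v, hf⟩, Γ.index_inr a' b d ⟨v, hf⟩]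

/-! ### Cutting an internal edge -/

namespace Branch

variable {n' : ℕ} [NeZero n'] {C : Collapse n' n} {Γ' : CanonicalTree n'} {Γ : CanonicalTree n}
  {e : Γ.graph.Dart} (B : Branch C Γ' Γ e)

theorem dart_leafDart : B.dart (Γ'.leafDart C.special) = e.symm := by
  obtain ⟨x, hx⟩ := (B.mem_range_iff e.fst).2 (Or.inl (Γ.isSide e).fst_notMem)
  have hadj : Γ'.graph.Adj (Sum.inl C.special) x := by
    rw [← B.toEmb.map_rel_iff]
    change Γ.graph.Adj (B.toEmb _) (B.toEmb _)
    rw [B.map_special, hx]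
    exact e.adj.symm
  rw [← Γ'.eq_leafDart (d := ⟨(Sum.inl C.special, x), hadj⟩) rfl]
  ext
  · exact B.map_special
  · exact hx

theorem dart_symm_leafDart : B.dart (Γ'.leafDart C.special).symm = e := by
  rw [B.dart_symm, B.dart_leafDart, SimpleGraph.Dart.symm_symm]

theorem map_isLeaf_iff (hv : ∃ v, e.snd = Sum.inr v) {x} (hx : x ≠ Sum.inl C.special) :
    (∃ k, B.toEmb x = Sum.inl k) ↔ ∃ k, x = Sum.inl k := by
  rcases x with i | u
  · have hi : i ≠ C.special := fun h => hx (h ▸ rfl)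
    simp [B.map_leaf i hi]
  · obtain ⟨v, hv⟩ := B.exists_map_inner hv u
    simp [hv]

theorem map_isInner_iff (hv : ∃ v, e.snd = Sum.inr v) {x} (hx : x ≠ Sum.inl C.special) :
    (∃ k, B.toEmb x = Sum.inr k) ↔ ∃ k, x = Sum.inr k := by
  rcases x with i | u
  · have hi : i ≠ C.special := fun h => hx (h ▸ rfl)
    simp [B.map_leaf i hi]
  · obtain ⟨v, hv⟩ := B.exists_map_inner hv u
    simp [hv]

theorem charge_dart (σ : Fin n → Charge) (d : Γ'.graph.Dart) :
    Γ.charge σ (B.dart d) = Γ'.charge (fun i => σ (C.emb i)) d := by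
  rw [charge, charge, B.principalRegion_dart]

theorem fst_ne_of_ne {d : Γ'.graph.Dart} (hd : d ≠ Γ'.leafDart C.special) :
    d.fst ≠ Sum.inl C.special := fun h => hd (Γ'.eq_leafDart h)

theorem dart_mem_orientedEdges_iff (hv : ∃ v, e.snd = Sum.inr v) {d : Γ'.graph.Dart}
    (hd : d ≠ Γ'.leafDart C.special) (hd' : d.symm ≠ Γ'.leafDart C.special) :
    B.dart d ∈ Γ.orientedEdges ↔ d ∈ Γ'.orientedEdges := by
  have h1 := fst_ne_of_ne hd
  have h2 : d.snd ≠ Sum.inl C.special := fst_ne_of_ne hd'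
  rw [mem_orientedEdges, mem_orientedEdges, ← B.dart_symm, B.principalRegion_dart,
    B.principalRegion_dart, C.strictMono.lt_iff_lt, B.dart_fst, B.dart_snd, B.map_isLeaf_iff hv h1,
    B.map_isInner_iff hv h1, B.map_isInner_iff hv h2]

theorem edgeMatrix_dart (hv : ∃ v, e.snd = Sum.inr v) (σ : Fin n → Charge) {d : Γ'.graph.Dart}
    (hd : d ≠ Γ'.leafDart C.special) :
    Γ.edgeMatrix M S t σ (B.dart d) = Γ'.edgeMatrix M S t (fun i => σ (C.emb i)) d := by
  unfold edgeMatrix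
  rw [← B.dart_symm, B.charge_dart, B.charge_dart, B.dart_fst]
  simp only [B.map_isLeaf_iff hv (fst_ne_of_ne hd)]

theorem index_dart {κ : Type*} (hv : ∃ v, e.snd = Sum.inr v) {a : Fin n → κ} {a' : Fin n' → κ}
    (ha : ∀ i, i ≠ C.special → a' i = a (C.emb i)) {b : Γ.LoopVertex → κ} {b' : Γ'.LoopVertex → κ}
    (hb : ∀ (d : Γ'.LoopVertex) (d' : Γ.LoopVertex), B.dart d = d' → b d' = b' d) {d : Γ'.graph.Dart}
    (hd : d ≠ Γ'.leafDart C.special) :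
    Γ.index a b (B.dart d) = Γ'.index a' b' d := by
  rcases hf : d.fst with i | u
  · have hi : i ≠ C.special := by
      rintro rfl
      exact hd (Γ'.eq_leafDart hf)
    rw [Γ'.index_inl a' b' d i hf, Γ.index_inl a b _ (C.emb i) (by rw [dart_fst, hf, B.map_leaf i hi]),
      ha i hi]
  · have h : ∃ v, (B.dart d).fst = Sum.inr v := by
      rw [dart_fst, hf]
      exact B.exists_map_inner hv u
    rw [Γ'.index_inr a' b' d ⟨u, hf⟩, Γ.index_inr a b _ h]
    exact hb ⟨d, u, hf⟩ _ rfl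

end Branch

end CanonicalTree

namespace CanonicalTree

variable {n n₁ n₂ : ℕ} [NeZero n] [NeZero n₁] [NeZero n₂]

/-- The trees `Γ₁` and `Γ₂` are the two parts of `Γ` on either side of the internal edge `e`. The edge
`e` belongs to both parts, as the external edge at their special leaves. -/
structure Split (C₁ : Collapse n₁ n) (C₂ : Collapse n₂ n) (Γ₁ : CanonicalTree n₁)
    (Γ₂ : CanonicalTree n₂) (Γ : CanonicalTree n) (e : Γ.graph.Dart) where
  fst_inner : ∃ v, e.fst = Sum.inr v
  snd_inner : ∃ v, e.snd = Sum.inr v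
  left : Branch C₁ Γ₁ Γ e.symm
  right : Branch C₂ Γ₂ Γ e

namespace Split

variable {C₁ : Collapse n₁ n} {C₂ : Collapse n₂ n} {Γ₁ : CanonicalTree n₁}
  {Γ₂ : CanonicalTree n₂} {Γ : CanonicalTree n} {e : Γ.graph.Dart}
  (P : Split C₁ C₂ Γ₁ Γ₂ Γ e)

theorem left_dart_leafDart : P.left.dart (Γ₁.leafDart C₁.special) = e :=
  P.left.dart_leafDart.trans (SimpleGraph.Dart.symm_symm e)

theorem left_dart_symm_leafDart : P.left.dart (Γ₁.leafDart C₁.special).symm = e.symm :=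
  P.left.dart_symm_leafDart

theorem left_special : P.left.toEmb (Sum.inl C₁.special) = e.fst := P.left.map_special

theorem exists_left_or_right (z) : (∃ x, x ≠ Sum.inl C₁.special ∧ P.left.toEmb x = z) ∨
    ∃ y, y ≠ Sum.inl C₂.special ∧ P.right.toEmb y = z := by
  have hside := Γ.isSide e
  by_cases hz : z ∈ Γ.side e
  · left
    obtain ⟨x, rfl⟩ := (P.left.mem_range_iff z).2 (Or.inl (by rw [side_symm]; exact not_not.2 hz))
    refine ⟨x, ?_, rfl⟩
    rintro rfl
    rw [P.left_special] at hz
    exact hside.fst_notMem hz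
  · right
    obtain ⟨x, rfl⟩ := (P.right.mem_range_iff z).2 (Or.inl hz)
    refine ⟨x, ?_, rfl⟩
    rintro rfl
    rw [P.right.map_special] at hz
    exact hz hside.snd_mem

theorem eq_special_of_eq {x y} (h : P.left.toEmb x = P.right.toEmb y) :
    x = Sum.inl C₁.special ∨ y = Sum.inl C₂.special := by
  have h1 := (P.left.mem_range_iff _).1 ⟨x, rfl⟩
  have h2 := (P.right.mem_range_iff _).1 ⟨y, rfl⟩
  rw [side_symm, Set.mem_compl_iff, not_not, ← P.left.map_special, P.left.toEmb.injective.eq_iff] at h1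
  rw [← P.right.map_special, P.right.toEmb.injective.eq_iff, ← h] at h2
  tauto

theorem exists_dart_left_or_right (d : Γ.graph.Dart) :
    (∃ d', d' ≠ Γ₁.leafDart C₁.special ∧ P.left.dart d' = d) ∨
      ∃ d', d' ≠ Γ₂.leafDart C₂.special ∧ P.right.dart d' = d := by
  rcases P.exists_left_or_right d.fst with ⟨x, hx, h⟩ | ⟨x, hx, h⟩
  · obtain ⟨d', rfl, rfl⟩ := P.left.exists_dart_eq h hx
    exact Or.inl ⟨d', fun h' => hx (h' ▸ Γ₁.leafDart_fst _), rfl⟩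
  · obtain ⟨d', rfl, rfl⟩ := P.right.exists_dart_eq h hx
    exact Or.inr ⟨d', fun h' => hx (h' ▸ Γ₂.leafDart_fst _), rfl⟩

theorem eq_leafDart_of_eq {d d'} (h : P.left.dart d = P.right.dart d') :
    d = Γ₁.leafDart C₁.special ∨ d' = Γ₂.leafDart C₂.special :=
  (P.eq_special_of_eq (congrArg (fun d => d.fst) h)).imp Γ₁.eq_leafDart Γ₂.eq_leafDart

/-- The internal vertex of `Γ` that corresponds to an internal vertex of one of the two parts. -/
noncomputable def innerMap : Fin Γ₁.numInner ⊕ Fin Γ₂.numInner → Fin Γ.numInner :=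
  Sum.elim (fun u => (P.left.exists_map_inner P.fst_inner u).choose)
    fun u => (P.right.exists_map_inner P.snd_inner u).choose

theorem left_toEmb_inr (u) : P.left.toEmb (Sum.inr u) = Sum.inr (P.innerMap (Sum.inl u)) :=
  (P.left.exists_map_inner P.fst_inner u).choose_spec

theorem right_toEmb_inr (u) : P.right.toEmb (Sum.inr u) = Sum.inr (P.innerMap (Sum.inr u)) :=
  (P.right.exists_map_inner P.snd_inner u).choose_spec

theorem innerMap_bijective : Function.Bijective P.innerMap := by
  have key : ∀ u u', P.innerMap (Sum.inl u) ≠ P.innerMap (Sum.inr u') := by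
    intro u u' h
    have := P.eq_special_of_eq (x := Sum.inr u) (y := Sum.inr u')
      (by rw [left_toEmb_inr, right_toEmb_inr, h])
    simp at this
  constructor
  · rintro (u | u) (u' | u') h
    · have := (P.left_toEmb_inr u).trans (((congrArg Sum.inr h)).trans (P.left_toEmb_inr u').symm)
      rw [Sum.inr_injective (P.left.toEmb.injective this)]
    · exact absurd h (key u u')
    · exact absurd h.symm (key u' u)
    · have := (P.right_toEmb_inr u).trans (((congrArg Sum.inr h)).trans (P.right_toEmb_inr u').symm)
      rw [Sum.inr_injective (P.right.toEmb.injective this)]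
  · intro v
    rcases P.exists_left_or_right (Sum.inr v) with ⟨x, hx, h⟩ | ⟨x, hx, h⟩
    · obtain ⟨u, rfl⟩ := (P.left.map_isInner_iff P.fst_inner hx).1 ⟨v, h⟩
      exact ⟨Sum.inl u, Sum.inr_injective ((P.left_toEmb_inr u).symm.trans h)⟩
    · obtain ⟨u, rfl⟩ := (P.right.map_isInner_iff P.snd_inner hx).1 ⟨v, h⟩
      exact ⟨Sum.inr u, Sum.inr_injective ((P.right_toEmb_inr u).symm.trans h)⟩

/-- The loop vertex of `Γ` that corresponds to a loop vertex of one of the two parts. -/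
noncomputable def loopVertexMap : Γ₁.LoopVertex ⊕ Γ₂.LoopVertex → Γ.LoopVertex :=
  Sum.elim
    (fun d => ⟨P.left.dart d, by
      obtain ⟨d, u, hu⟩ := d
      exact ⟨_, by rw [Branch.dart_fst, hu, P.left_toEmb_inr]⟩⟩)
    fun d => ⟨P.right.dart d, by
      obtain ⟨d, u, hu⟩ := d
      exact ⟨_, by rw [Branch.dart_fst, hu, P.right_toEmb_inr]⟩⟩

theorem loopVertexMap_bijective : Function.Bijective P.loopVertexMap := by
  have key : ∀ d d', P.loopVertexMap (Sum.inl d) ≠ P.loopVertexMap (Sum.inr d') := by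
    rintro ⟨d, u, hu⟩ ⟨d', u', hu'⟩ h
    have h : P.left.dart d = P.right.dart d' := congrArg Subtype.val h
    rcases P.eq_leafDart_of_eq h with rfl | rfl
    · rw [leafDart_fst] at hu
      cases hu
    · rw [leafDart_fst] at hu'
      cases hu'
  constructor
  · rintro (d | d) (d' | d') h
    · rw [Subtype.ext (P.left.dart_injective (congrArg Subtype.val h))]
    · exact absurd h (key d d')
    · exact absurd h.symm (key d' d)
    · rw [Subtype.ext (P.right.dart_injective (congrArg Subtype.val h))]
  · rintro ⟨d, v, hv⟩
    rcases P.exists_dart_left_or_right d with ⟨d', hd', rfl⟩ | ⟨d', hd', rfl⟩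
    · obtain ⟨u, hu⟩ := (P.left.map_isInner_iff P.fst_inner (Branch.fst_ne_of_ne hd')).1 ⟨v, hv⟩
      exact ⟨Sum.inl ⟨d', u, hu⟩, rfl⟩
    · obtain ⟨u, hu⟩ := (P.right.map_isInner_iff P.snd_inner (Branch.fst_ne_of_ne hd')).1 ⟨v, hv⟩
      exact ⟨Sum.inr ⟨d', u, hu⟩, rfl⟩

variable {ι : Type*} [Fintype ι] [DecidableEq ι] (M S : Matrix ι ι ℂ) (t : ℝ)

theorem prod_orientedEdges_erase (hn₁ : 3 ≤ n₁) (hn₂ : 3 ≤ n₂) [DecidableEq Γ.graph.Dart]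
    [DecidableEq Γ₁.graph.Dart] [DecidableEq Γ₂.graph.Dart] (he : e ∈ Γ.orientedEdges)
    (f : Γ.graph.Dart → ℂ) :
    ∏ d ∈ Γ.orientedEdges.erase e, f d =
      (∏ d ∈ Γ₁.orientedEdges.erase (Γ₁.leafDart C₁.special), f (P.left.dart d)) *
        ∏ d ∈ Γ₂.orientedEdges.erase (Γ₂.leafDart C₂.special), f (P.right.dart d) := by
  have hsymm : e.symm ∉ Γ.orientedEdges := by
    rw [mem_orientedEdges] at he ⊢
    obtain ⟨v, hv⟩ := P.fst_inner
    obtain ⟨w, hw⟩ := P.snd_inner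
    have h1 : e.symm.fst = Sum.inr w := hw
    rw [hv] at he
    rw [h1, SimpleGraph.Dart.symm_symm]
    simp only [reduceCtorEq, exists_false, false_or] at he ⊢
    exact fun h => lt_asymm he.2.2 h.2.2
  have key : Γ.orientedEdges.erase e =
      (Γ₁.orientedEdges.erase (Γ₁.leafDart C₁.special)).map ⟨P.left.dart, P.left.dart_injective⟩ ∪
        (Γ₂.orientedEdges.erase (Γ₂.leafDart C₂.special)).map
          ⟨P.right.dart, P.right.dart_injective⟩ := by
    ext d
    simp only [Finset.mem_erase, Finset.mem_union, Finset.mem_map, Function.Embedding.coeFn_mk]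
    constructor
    · rintro ⟨hd, hd'⟩
      rcases P.exists_dart_left_or_right d with ⟨d', h1, rfl⟩ | ⟨d', h1, rfl⟩
      · refine Or.inl ⟨d', ⟨h1, ?_⟩, rfl⟩
        refine (P.left.dart_mem_orientedEdges_iff P.fst_inner h1 fun h => hsymm ?_).1 hd'
        rwa [← P.left_dart_leafDart, ← h, ← P.left.dart_symm, SimpleGraph.Dart.symm_symm]
      · refine Or.inr ⟨d', ⟨h1, ?_⟩, rfl⟩
        refine (P.right.dart_mem_orientedEdges_iff P.snd_inner h1 fun h => hd ?_).1 hd'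
        have h' : d' = (Γ₂.leafDart C₂.special).symm := by rw [← h, SimpleGraph.Dart.symm_symm]
        exact (congrArg _ h').trans P.right.dart_symm_leafDart
    · rintro (⟨d', ⟨h1, h2⟩, rfl⟩ | ⟨d', ⟨h1, h2⟩, rfl⟩)
      · refine ⟨fun h => h1 (P.left.dart_injective (h.trans P.left_dart_leafDart.symm)), ?_⟩
        exact (P.left.dart_mem_orientedEdges_iff P.fst_inner h1 (Γ₁.symm_ne_leafDart hn₁ h2 _)).2 h2
      · refine ⟨fun h => ?_, ?_⟩
        · have := P.right.dart_injective (h.trans P.right.dart_symm_leafDart.symm)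
          exact Γ₂.symm_ne_leafDart hn₂ h2 C₂.special (by rw [this, SimpleGraph.Dart.symm_symm])
        · exact (P.right.dart_mem_orientedEdges_iff P.snd_inner h1
            (Γ₂.symm_ne_leafDart hn₂ h2 _)).2 h2
  rw [key, Finset.prod_union, Finset.prod_map, Finset.prod_map]
  · rfl
  · rw [Finset.disjoint_left]
    simp only [Finset.mem_erase, Finset.mem_map, Function.Embedding.coeFn_mk, not_exists, not_and]
    rintro _ ⟨d, ⟨hd, -⟩, rfl⟩ d' ⟨hd', -⟩ h
    rcases P.eq_leafDart_of_eq h.symm with h | h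
    · exact hd h
    · exact hd' h

/-- Without the factor of `e`, the value of `Γ` at fixed indices is the product of the values of the
two parts without the factors of their special external edges. -/
theorem erasedValue_eq (hn₁ : 3 ≤ n₁) (hn₂ : 3 ≤ n₂) (he : e ∈ Γ.orientedEdges)
    (σ : Fin n → Charge) (x : Γ.graph.Dart → ι) :
    Γ.erasedValue M S t σ x e =
      Γ₁.erasedValue M S t (fun i => σ (C₁.emb i)) (fun d => x (P.left.dart d))
          (Γ₁.leafDart C₁.special) *
        Γ₂.erasedValue M S t (fun i => σ (C₂.emb i)) (fun d => x (P.right.dart d))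
          (Γ₂.leafDart C₂.special) := by
  classical
  unfold erasedValue
  have h1 : ∏ v : Fin Γ.numInner, mLoopList M (Γ.loopList σ x v) =
      (∏ u, mLoopList M (Γ₁.loopList (fun i => σ (C₁.emb i)) (fun d => x (P.left.dart d)) u)) *
        ∏ u, mLoopList M (Γ₂.loopList (fun i => σ (C₂.emb i)) (fun d => x (P.right.dart d)) u) := by
    rw [← Fintype.prod_bijective P.innerMap P.innerMap_bijective
      (fun u => mLoopList M (Γ.loopList σ x (P.innerMap u))) _ (fun _ => rfl), Fintype.prod_sum_type]
    congr 1
    · refine Finset.prod_congr rfl fun u _ => ?_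
      rw [P.left.loopList_eq σ x u _ (P.left_toEmb_inr u)]
    · refine Finset.prod_congr rfl fun u _ => ?_
      rw [P.right.loopList_eq σ x u _ (P.right_toEmb_inr u)]
  have h2 := P.prod_orientedEdges_erase hn₁ hn₂ he
    fun d => Γ.edgeMatrix M S t σ d (x d) (x d.symm)
  rw [h1]
  have h3 : ∏ d ∈ Γ₁.orientedEdges.erase (Γ₁.leafDart C₁.special),
      Γ.edgeMatrix M S t σ (P.left.dart d) (x (P.left.dart d)) (x (P.left.dart d).symm) =
      ∏ d ∈ Γ₁.orientedEdges.erase (Γ₁.leafDart C₁.special),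
      Γ₁.edgeMatrix M S t (fun i => σ (C₁.emb i)) d (x (P.left.dart d)) (x (P.left.dart d.symm)) := by
    refine Finset.prod_congr rfl fun d hd => ?_
    rw [P.left.edgeMatrix_dart M S t P.fst_inner σ (Finset.ne_of_mem_erase hd), P.left.dart_symm]
  have h4 : ∏ d ∈ Γ₂.orientedEdges.erase (Γ₂.leafDart C₂.special),
      Γ.edgeMatrix M S t σ (P.right.dart d) (x (P.right.dart d)) (x (P.right.dart d).symm) =
      ∏ d ∈ Γ₂.orientedEdges.erase (Γ₂.leafDart C₂.special),
      Γ₂.edgeMatrix M S t (fun i => σ (C₂.emb i)) d (x (P.right.dart d))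
        (x (P.right.dart d.symm)) := by
    refine Finset.prod_congr rfl fun d hd => ?_
    rw [P.right.edgeMatrix_dart M S t P.snd_inner σ (Finset.ne_of_mem_erase hd), P.right.dart_symm]
  rw [h3, h4] at h2
  refine (congrArg _ ?_).trans (mul_mul_mul_comm _ _ _ _)
  convert h2 using 2

end Split

/-- The sum of the values of the `M`-graph over the indices of the loop vertices, with the matrix of
the edge `e` replaced by `W`. -/
noncomputable def replacedValue {ι : Type*} [Fintype ι] [DecidableEq ι] (Γ : CanonicalTree n)
    (M S : Matrix ι ι ℂ) (t : ℝ) (σ : Fin n → Charge) (a : Fin n → ι) (e : Γ.graph.Dart)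
    (W : Matrix ι ι ℂ) : ℂ :=
  open Classical in
  ∑ b : Γ.LoopVertex → ι, Γ.erasedValue M S t σ (Γ.index a b) e *
    W (Γ.index a b e) (Γ.index a b e.symm)

variable {ι : Type*} [Fintype ι] [DecidableEq ι] (M S : Matrix ι ι ℂ) (t : ℝ)

theorem value_eq_replacedValue (Γ : CanonicalTree n) (σ : Fin n → Charge) (a : Fin n → ι)
    {e : Γ.graph.Dart} (he : e ∈ Γ.orientedEdges) :
    Γ.value M S t σ a = Γ.replacedValue M S t σ a e (Γ.edgeMatrix M S t σ e) := by
  classical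
  unfold value replacedValue
  refine Finset.sum_congr (by ext; simp) fun b _ => ?_
  rw [Γ.unsummedValue_eq_erasedValue_mul M S t σ a b he]

theorem edgeMatrix_leafDart (Γ : CanonicalTree n) (σ : Fin n → Charge) (k : Fin n) :
    Γ.edgeMatrix M S t σ (Γ.leafDart k) = thetaHat M S t (σ k) (σ (k + 1)) := by
  rw [edgeMatrix, if_pos ⟨k, Γ.leafDart_fst k⟩, charge, charge, principalRegion_leafDart,
    principalRegion_leafDart_symm]

theorem replacedValue_leafDart (hn : 3 ≤ n) (Γ : CanonicalTree n) (σ : Fin n → Charge)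
    (a : Fin n → ι) (k : Fin n) (W : Matrix ι ι ℂ) :
    Γ.replacedValue M S t σ a (Γ.leafDart k) (W * thetaHat M S t (σ k) (σ (k + 1))) =
      ∑ c, W (a k) c * Γ.value M S t σ (Function.update a k c) := by
  classical
  have h : ∀ c, Γ.value M S t σ (Function.update a k c) = ∑ b : Γ.LoopVertex → ι,
      Γ.erasedValue M S t σ (Γ.index a b) (Γ.leafDart k) *
        thetaHat M S t (σ k) (σ (k + 1)) c (Γ.index a b (Γ.leafDart k).symm) := by
    intro c
    rw [Γ.value_eq_replacedValue M S t _ _ (Γ.leafDart_mem_orientedEdges k), replacedValue]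
    refine Finset.sum_congr (by ext; simp) fun b _ => ?_
    have hidx : ∀ d, d ≠ Γ.leafDart k →
        Γ.index (Function.update a k c) b d = Γ.index a b d :=
      Γ.index_congr b k fun j hj => Function.update_of_ne hj _ _
    rw [Γ.erasedValue_leafDart_congr M S t hn σ k hidx, edgeMatrix_leafDart, index_leafDart,
      Function.update_self, hidx _ (SimpleGraph.Dart.symm_ne _)]
  simp_rw [h, Finset.mul_sum]
  rw [Finset.sum_comm, replacedValue]
  refine Finset.sum_congr (by ext; simp) fun b _ => ?_
  rw [index_leafDart, Matrix.mul_apply, Finset.mul_sum]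
  refine Finset.sum_congr rfl fun c _ => ?_
  ring

/-- Cutting the internal edge `e` of `Γ`: two trees joined by `S` at their special leaves have the value
of `Γ` with the matrix of `e` replaced by a product of the two external propagators and `S`. -/
theorem Split.sum_value_mul_value {C₁ : Collapse n₁ n} {C₂ : Collapse n₂ n} {Γ₁ : CanonicalTree n₁}
    {Γ₂ : CanonicalTree n₂} {Γ : CanonicalTree n} {e : Γ.graph.Dart} (P : Split C₁ C₂ Γ₁ Γ₂ Γ e)
    (hn₁ : 3 ≤ n₁) (hn₂ : 3 ≤ n₂) (he : e ∈ Γ.orientedEdges)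
    (σ : Fin n → Charge) (a : Fin n → ι) (a₁ : ι → Fin n₁ → ι) (a₂ : ι → Fin n₂ → ι)
    (h₁ : ∀ c i, i ≠ C₁.special → a₁ c i = a (C₁.emb i)) (h₁' : ∀ c, a₁ c C₁.special = c)
    (h₂ : ∀ c i, i ≠ C₂.special → a₂ c i = a (C₂.emb i)) (h₂' : ∀ c, a₂ c C₂.special = c) :
    ∑ c, ∑ d, Γ₁.value M S t (fun i => σ (C₁.emb i)) (a₁ c) * S c d *
        Γ₂.value M S t (fun i => σ (C₂.emb i)) (a₂ d) =
      Γ.replacedValue M S t σ a e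
        ((thetaHat M S t (Γ.charge σ e.symm) (Γ.charge σ e))ᵀ * Sᵀ *
          thetaHat M S t (Γ.charge σ e) (Γ.charge σ e.symm)) := by
  classical
  have hsym₁ : (Γ₁.leafDart C₁.special).symm ≠ Γ₁.leafDart C₁.special := SimpleGraph.Dart.symm_ne _
  have hsym₂ : (Γ₂.leafDart C₂.special).symm ≠ Γ₂.leafDart C₂.special := SimpleGraph.Dart.symm_ne _
  let E₁ := (Equiv.ofBijective _ P.loopVertexMap_bijective).symm.arrowCongr (Equiv.refl ι)
  let E := E₁.trans (Equiv.sumArrowEquivProdArrow _ _ ι)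
  have hE₁ : ∀ b (d : Γ₁.LoopVertex) (d' : Γ.LoopVertex), P.left.dart d = d' → b d' = (E b).1 d := by
    rintro b d ⟨d', hd'⟩ h
    simp only [E, E₁, Equiv.trans_apply, Equiv.arrowCongr, Equiv.sumArrowEquivProdArrow]
    congr 1
    exact Subtype.ext h.symm
  have hE₂ : ∀ b (d : Γ₂.LoopVertex) (d' : Γ.LoopVertex), P.right.dart d = d' → b d' = (E b).2 d := by
    rintro b d ⟨d', hd'⟩ h
    simp only [E, E₁, Equiv.trans_apply, Equiv.arrowCongr, Equiv.sumArrowEquivProdArrow]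
    congr 1
    exact Subtype.ext h.symm
  have hi₁ : ∀ c b d, d ≠ Γ₁.leafDart C₁.special →
      Γ.index a b (P.left.dart d) = Γ₁.index (a₁ c) (E b).1 d := fun c b d hd =>
    P.left.index_dart P.fst_inner (h₁ c) (hE₁ b) hd
  have hi₂ : ∀ c b d, d ≠ Γ₂.leafDart C₂.special →
      Γ.index a b (P.right.dart d) = Γ₂.index (a₂ c) (E b).2 d := fun c b d hd =>
    P.right.index_dart P.snd_inner (h₂ c) (hE₂ b) hd
  have hv₁ : ∀ c b, Γ₁.unsummedValue M S t (fun i => σ (C₁.emb i)) (a₁ c) (E b).1 =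
      Γ₁.erasedValue M S t (fun i => σ (C₁.emb i)) (fun d => Γ.index a b (P.left.dart d))
        (Γ₁.leafDart C₁.special) *
      thetaHat M S t (Γ.charge σ e) (Γ.charge σ e.symm) c (Γ.index a b e.symm) := by
    intro c b
    rw [Γ₁.unsummedValue_eq_erasedValue_mul M S t _ _ _ (Γ₁.leafDart_mem_orientedEdges C₁.special),
      index_leafDart, h₁', ← hi₁ c b _ hsym₁, P.left_dart_symm_leafDart, edgeMatrix,
      if_pos ⟨_, Γ₁.leafDart_fst _⟩, ← P.left.charge_dart, ← P.left.charge_dart,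
      P.left_dart_leafDart, P.left_dart_symm_leafDart]
    rw [Γ₁.erasedValue_leafDart_congr M S t hn₁ _ C₁.special fun d hd => (hi₁ c b d hd).symm]
  have hv₂ : ∀ c b, Γ₂.unsummedValue M S t (fun i => σ (C₂.emb i)) (a₂ c) (E b).2 =
      Γ₂.erasedValue M S t (fun i => σ (C₂.emb i)) (fun d => Γ.index a b (P.right.dart d))
        (Γ₂.leafDart C₂.special) *
      thetaHat M S t (Γ.charge σ e.symm) (Γ.charge σ e) c (Γ.index a b e) := by
    intro c b
    rw [Γ₂.unsummedValue_eq_erasedValue_mul M S t _ _ _ (Γ₂.leafDart_mem_orientedEdges C₂.special),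
      index_leafDart, h₂', ← hi₂ c b _ hsym₂, P.right.dart_symm_leafDart, edgeMatrix,
      if_pos ⟨_, Γ₂.leafDart_fst _⟩, ← P.right.charge_dart, ← P.right.charge_dart,
      P.right.dart_leafDart, P.right.dart_symm_leafDart]
    rw [Γ₂.erasedValue_leafDart_congr M S t hn₂ _ C₂.special fun d hd => (hi₂ c b d hd).symm]
  have hprod : ∀ c d, Γ₁.value M S t (fun i => σ (C₁.emb i)) (a₁ c) * S c d *
      Γ₂.value M S t (fun i => σ (C₂.emb i)) (a₂ d) = ∑ b : Γ.LoopVertex → ι,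
        Γ₁.unsummedValue M S t (fun i => σ (C₁.emb i)) (a₁ c) (E b).1 * S c d *
          Γ₂.unsummedValue M S t (fun i => σ (C₂.emb i)) (a₂ d) (E b).2 := by
    intro c d
    rw [Fintype.sum_equiv E _ (fun b => Γ₁.unsummedValue M S t (fun i => σ (C₁.emb i)) (a₁ c) b.1 *
      S c d * Γ₂.unsummedValue M S t (fun i => σ (C₂.emb i)) (a₂ d) b.2) fun _ => rfl,
      Fintype.sum_prod_type]
    unfold value
    rw [Finset.sum_mul, Finset.sum_mul]
    refine Finset.sum_congr (by ext; simp) fun b₁ _ => ?_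
    rw [Finset.mul_sum]
  have hcomm : ∑ c, ∑ d, Γ₁.value M S t (fun i => σ (C₁.emb i)) (a₁ c) * S c d *
      Γ₂.value M S t (fun i => σ (C₂.emb i)) (a₂ d) = ∑ b : Γ.LoopVertex → ι, ∑ c, ∑ d,
        Γ₁.unsummedValue M S t (fun i => σ (C₁.emb i)) (a₁ c) (E b).1 * S c d *
          Γ₂.unsummedValue M S t (fun i => σ (C₂.emb i)) (a₂ d) (E b).2 := by
    simp_rw [hprod]
    symm
    rw [Finset.sum_comm]
    refine Finset.sum_congr rfl fun d _ => ?_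
    rw [Finset.sum_comm]
  rw [hcomm, replacedValue]
  refine Finset.sum_congr (by ext; simp) fun b _ => ?_
  rw [P.erasedValue_eq M S t hn₁ hn₂ he]
  simp only [hv₁, hv₂, Matrix.mul_apply, Matrix.transpose_apply, Finset.mul_sum, Finset.sum_mul]
  have key : ∀ p q s r u : ℂ, p * q * s * (r * u) = p * r * (u * s * q) := by
    intros
    ring
  exact Finset.sum_congr rfl fun c _ => Finset.sum_congr rfl fun d _ => key _ _ _ _ _

end CanonicalTree

/-! ### Existence of branches -/

namespace CanonicalTree

variable {n n' : ℕ} [NeZero n] [NeZero n']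

theorem existsUnique_leaf_side (Γ : CanonicalTree n) (d : Γ.graph.Dart) :
    ∃! k : Fin n, Sum.inl (k - 1) ∉ Γ.side d ∧ Sum.inl k ∈ Γ.side d := by
  convert Γ.planar d using 3 with k
  exact Γ.mem_path_darts.symm

/-- The embedding `toEmb` of a branch, for a given enumeration of the internal vertices on the near
side. -/
def branchMap (C : Collapse n' n) (Γ : CanonicalTree n) (e : Γ.graph.Dart) {m : ℕ}
    (E : {u : Fin Γ.numInner // Sum.inr u ∉ Γ.side e} ≃ Fin m) :
    Fin n' ⊕ Fin m → Fin n ⊕ Fin Γ.numInner :=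
  Sum.elim (fun i => if i = C.special then e.snd else Sum.inl (C.emb i))
    fun u => Sum.inr (E.symm u).1

theorem exists_branch (C : Collapse n' n) (Γ : CanonicalTree n) (e : Γ.graph.Dart)
    (hblock : ∀ j, Sum.inl j ∈ Γ.side e ↔ j ∈ C.block) :
    ∃ Γ' : CanonicalTree n', Nonempty (Branch C Γ' Γ e) := by
  classical
  have hside := Γ.isSide e
  let E := Fintype.equivFin {u : Fin Γ.numInner // Sum.inr u ∉ Γ.side e}
  set m := Fintype.card {u : Fin Γ.numInner // Sum.inr u ∉ Γ.side e}
  set f := branchMap C Γ e E with hf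
  have hleaf : ∀ i, i ≠ C.special → f (Sum.inl i) = Sum.inl (C.emb i) := fun i hi => if_neg hi
  have hspecial : f (Sum.inl C.special) = e.snd := if_pos rfl
  have hinner : ∀ u, f (Sum.inr u) = Sum.inr (E.symm u).1 := fun u => rfl
  have hnot : ∀ x, x ≠ Sum.inl C.special → f x ∉ Γ.side e := by
    rintro (i | u) hx
    · have hi : i ≠ C.special := fun h => hx (h ▸ rfl)
      rw [hleaf i hi, hblock, C.emb_mem_block]
      exact hi
    · rw [hinner]
      exact (E.symm u).2
  have hinj : Function.Injective f := by
    intro x y hxy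
    by_cases hx : x = Sum.inl C.special
    · by_contra hy
      refine hnot y (fun h => hy (hx.trans h.symm)) ?_
      rw [← hxy, hx, hspecial]
      exact hside.snd_mem
    · by_cases hy : y = Sum.inl C.special
      · exfalso
        apply hnot x hx
        rw [hxy, hy, hspecial]
        exact hside.snd_mem
      · rcases x with i | u <;> rcases y with i' | u'
        · rw [hleaf i fun h => hx (h ▸ rfl), hleaf i' fun h => hy (h ▸ rfl)] at hxy
          rw [C.strictMono.injective (Sum.inl_injective hxy)]
        · rw [hleaf i fun h => hx (h ▸ rfl), hinner] at hxy
          cases hxy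
        · rw [hleaf i' fun h => hy (h ▸ rfl), hinner] at hxy
          cases hxy
        · rw [hinner, hinner] at hxy
          rw [E.symm.injective (Subtype.ext (Sum.inr_injective hxy))]
  have hrange : ∀ x, x ∈ Set.range f ↔ x ∉ Γ.side e ∨ x = e.snd := by
    intro x
    constructor
    · rintro ⟨y, rfl⟩
      by_cases hy : y = Sum.inl C.special
      · exact Or.inr (hy ▸ hspecial)
      · exact Or.inl (hnot y hy)
    · rintro (hx | rfl)
      · rcases x with j | u
        · rw [hblock] at hx
          obtain ⟨i, rfl⟩ : j ∈ Set.range C.emb := by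
            by_contra hj
            exact hx (C.mem_block_of_notMem_range j hj).1
          rw [C.emb_mem_block] at hx
          exact ⟨Sum.inl i, hleaf i hx⟩
        · exact ⟨Sum.inr (E ⟨u, hx⟩), by rw [hinner, Equiv.symm_apply_apply]⟩
      · exact ⟨_, hspecial⟩
  let G := Γ.graph.comap f
  let F : G ↪g Γ.graph := SimpleGraph.Embedding.comap ⟨f, hinj⟩ Γ.graph
  -- Collapsing everything beyond `e` to the special leaf maps the tree onto its branch.
  let r : Fin n ⊕ Fin Γ.numInner → Fin n' ⊕ Fin m := fun x =>
    if h : ∃ y, f y = x then h.choose else Sum.inl C.special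
  have hr : ∀ y, r (f y) = y := by
    intro y
    have h : ∃ z, f z = f y := ⟨y, rfl⟩
    simp only [r, dif_pos h]
    exact hinj h.choose_spec
  have hfr : ∀ x, f (r x) = if x ∈ Γ.side e then e.snd else x := by
    intro x
    by_cases hx : x ∈ Set.range f
    · obtain ⟨y, rfl⟩ := hx
      rw [hr]
      split_ifs with h
      · rcases (hrange (f y)).1 ⟨y, rfl⟩ with h' | h'
        · exact absurd h h'
        · exact h'
      · rfl
    · have h1 : r x = Sum.inl C.special := dif_neg hx
      rw [hrange] at hx
      push Not at hx
      rw [h1, if_pos hx.1, hspecial]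
  have hr_adj : ∀ x y, Γ.graph.Adj x y → r x = r y ∨ G.Adj (r x) (r y) := by
    intro x y hxy
    have : f (r x) = f (r y) ∨ Γ.graph.Adj (f (r x)) (f (r y)) := by
      rw [hfr, hfr]
      split_ifs with h1 h2 h2
      · exact Or.inl rfl
      · right
        obtain ⟨-, rfl⟩ := hside.eq_of_adj hxy.symm h2 h1
        exact hxy
      · right
        obtain ⟨-, rfl⟩ := hside.eq_of_adj hxy h1 h2
        exact hxy
      · exact Or.inr hxy
    exact this.imp (fun h => hinj h) id
  have hconn : G.Connected := by
    refine (SimpleGraph.connected_iff _).2 ⟨fun x y => ?_, ⟨Sum.inl 0⟩⟩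
    have := Γ.preconnected.forall_of_adj (P := fun z => G.Reachable x (r z)) (x := f x)
      (by rw [hr]) (fun a b hab ha => by
        rcases hr_adj a b hab with h | h
        · rwa [← h]
        · exact ha.trans h.reachable) (f y)
    rwa [hr] at this
  have hGside : ∀ d : G.Dart, IsSide G d.fst d.snd (f ⁻¹' Γ.side (F.toHom.mapDart d)) := fun d =>
    (Γ.isSide (F.toHom.mapDart d)).comap F
  have htree : G.IsTree := ⟨hconn, SimpleGraph.isAcyclic_of_isSide fun u v huv =>
    ⟨_, hGside ⟨(u, v), huv⟩⟩⟩
  have hnear : ∀ y, f y ∉ Γ.side e ∨ f y = e.snd := fun y => (hrange _).1 ⟨y, rfl⟩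
  have hncard : ∀ x, x ≠ Sum.inl C.special →
      (G.neighborSet x).ncard = (Γ.graph.neighborSet (f x)).ncard := by
    intro x hx
    have : G.neighborSet x = f ⁻¹' Γ.graph.neighborSet (f x) := rfl
    rw [this, Set.ncard_preimage_of_injective_subset_range hinj]
    intro y hy
    rw [hrange]
    by_contra! h
    exact h.2 (hside.eq_of_adj hy (hnot x hx) h.1).2
  refine ⟨⟨m, G, htree, ?_, ?_, ?_⟩, ⟨⟨F, hleaf, hspecial, hrange, hblock⟩⟩⟩
  · intro i
    by_cases hi : i = C.special
    · obtain ⟨w, hw⟩ := (hrange e.fst).2 (Or.inl hside.fst_notMem)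
      rw [Set.ncard_eq_one]
      refine ⟨w, Set.ext fun y => ?_⟩
      have : y ∈ G.neighborSet (Sum.inl i) ↔ Γ.graph.Adj e.snd (f y) := by
        rw [hi, ← hspecial]
        rfl
      rw [this, Set.mem_singleton_iff]
      constructor
      · intro hy
        have hy' : f y ∉ Γ.side e := by
          rcases hnear y with h | h
          · exact h
          · exact absurd h.symm hy.ne
        exact hinj ((hside.eq_of_adj hy.symm hy' hside.snd_mem).1.trans hw.symm)
      · rintro rfl
        rw [hw]
        exact e.adj.symm
    · rw [hncard _ fun h => hi (Sum.inl_injective h), hleaf i hi, Γ.ncard_external]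
  · intro u
    rw [hncard _ (by simp), hinner]
    exact Γ.ncard_internal _
  · refine planar_of_existsUnique htree Sum.inl (fun d => f ⁻¹' Γ.side (F.toHom.mapDart d)) hGside ?_
    intro d
    have hmem : ∀ x ∈ Γ.side e,
        (x ∈ Γ.side (F.toHom.mapDart d) ↔ e.snd ∈ Γ.side (F.toHom.mapDart d)) := fun x hx =>
      Γ.mem_side_iff_of_near (hnear d.fst) (hnear d.snd) hx
    have hs : Sum.inl (C.emb C.special) ∈ Γ.side e := by rw [hblock, C.emb_mem_block]
    have h := (C.existsUnique_enters_iff (A := {j | Sum.inl j ∈ Γ.side (F.toHom.mapDart d)})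
      fun j hj => (hmem _ ((hblock j).2 hj)).trans (hmem _ hs).symm).1
      (Γ.existsUnique_leaf_side (F.toHom.mapDart d))
    have hi : ∀ i, (Sum.inl i ∈ f ⁻¹' Γ.side (F.toHom.mapDart d) ↔
        C.emb i ∈ {j | Sum.inl j ∈ Γ.side (F.toHom.mapDart d)}) := by
      intro i
      by_cases hi : i = C.special
      · rw [hi, Set.mem_preimage, hspecial]
        exact (hmem _ hs).symm
      · rw [Set.mem_preimage, hleaf i hi]
        rfl
    convert h using 3 with i
    all_goals rw [hi]

/-! ### Gluing two trees along an edge -/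

/-- The graph `G` is the union of the images of two graphs under maps of their vertices. -/
def IsUnion {V₁ V₂ V : Type*} (G₁ : SimpleGraph V₁) (G₂ : SimpleGraph V₂) (f₁ : V₁ → V)
    (f₂ : V₂ → V) (G : SimpleGraph V) : Prop :=
  ∀ x y, G.Adj x y ↔ Relation.Map G₁.Adj f₁ f₁ x y ∨ Relation.Map G₂.Adj f₂ f₂ x y

theorem IsUnion.symm {V₁ V₂ V : Type*} {G₁ : SimpleGraph V₁} {G₂ : SimpleGraph V₂} {f₁ : V₁ → V}
    {f₂ : V₂ → V} {G : SimpleGraph V} (hG : IsUnion G₁ G₂ f₁ f₂ G) : IsUnion G₂ G₁ f₂ f₁ G :=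
  fun x y => (hG x y).trans or_comm

/-- Two trees are glued by identifying their special external edges with opposite directions: the
special leaf of each tree becomes the vertex `w` to which the special leaf of the other one was
attached. -/
structure Gluing {n₁ n₂ : ℕ} [NeZero n₁] [NeZero n₂] (C₁ : Collapse n₁ n) (C₂ : Collapse n₂ n)
    (Γ₁ : CanonicalTree n₁) (Γ₂ : CanonicalTree n₂) {m : ℕ} (w₁ : Fin n₁ ⊕ Fin Γ₁.numInner)
    (w₂ : Fin n₂ ⊕ Fin Γ₂.numInner) (f₁ : Fin n₁ ⊕ Fin Γ₁.numInner → Fin n ⊕ Fin m)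
    (f₂ : Fin n₂ ⊕ Fin Γ₂.numInner → Fin n ⊕ Fin m) : Prop where
  block_eq : C₂.block = C₁.blockᶜ
  adj₁ : ∀ x, Γ₁.graph.Adj (Sum.inl C₁.special) x ↔ x = w₁
  adj₂ : ∀ x, Γ₂.graph.Adj (Sum.inl C₂.special) x ↔ x = w₂
  inj₁ : Function.Injective f₁
  inj₂ : Function.Injective f₂
  leaf₁ : ∀ i, i ≠ C₁.special → f₁ (Sum.inl i) = Sum.inl (C₁.emb i)
  leaf₂ : ∀ i, i ≠ C₂.special → f₂ (Sum.inl i) = Sum.inl (C₂.emb i)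
  special₁ : f₁ (Sum.inl C₁.special) = f₂ w₂
  special₂ : f₂ (Sum.inl C₂.special) = f₁ w₁
  overlap : ∀ x y, f₁ x = f₂ y →
    (x = Sum.inl C₁.special ∧ y = w₂) ∨ (x = w₁ ∧ y = Sum.inl C₂.special)
  inner₁ : ∀ u, ∃ v, f₁ (Sum.inr u) = Sum.inr v
  inner₂ : ∀ u, ∃ v, f₂ (Sum.inr u) = Sum.inr v
  inner_cover : ∀ v, (∃ u, f₁ (Sum.inr u) = Sum.inr v) ∨ ∃ u, f₂ (Sum.inr u) = Sum.inr v

namespace Gluing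

variable {n₁ n₂ : ℕ} [NeZero n₁] [NeZero n₂] {C₁ : Collapse n₁ n} {C₂ : Collapse n₂ n}
    {Γ₁ : CanonicalTree n₁} {Γ₂ : CanonicalTree n₂} {m : ℕ} {w₁ : Fin n₁ ⊕ Fin Γ₁.numInner}
    {w₂ : Fin n₂ ⊕ Fin Γ₂.numInner} {f₁ : Fin n₁ ⊕ Fin Γ₁.numInner → Fin n ⊕ Fin m}
    {f₂ : Fin n₂ ⊕ Fin Γ₂.numInner → Fin n ⊕ Fin m}

theorem symm (H : Gluing C₁ C₂ Γ₁ Γ₂ w₁ w₂ f₁ f₂) : Gluing C₂ C₁ Γ₂ Γ₁ w₂ w₁ f₂ f₁ where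
  block_eq := by rw [H.block_eq, compl_compl]
  adj₁ := H.adj₂
  adj₂ := H.adj₁
  inj₁ := H.inj₂
  inj₂ := H.inj₁
  leaf₁ := H.leaf₂
  leaf₂ := H.leaf₁
  special₁ := H.special₂
  special₂ := H.special₁
  overlap := fun x y h => (H.overlap y x h.symm).symm.imp And.symm And.symm
  inner₁ := H.inner₂
  inner₂ := H.inner₁
  inner_cover := fun v => (H.inner_cover v).symm

variable {G : SimpleGraph (Fin n ⊕ Fin m)}

variable (H : Gluing C₁ C₂ Γ₁ Γ₂ w₁ w₂ f₁ f₂) (hG : IsUnion Γ₁.graph Γ₂.graph f₁ f₂ G)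

include H

theorem w₁_ne : w₁ ≠ Sum.inl C₁.special := fun h => Γ₁.graph.irrefl ((H.adj₁ _).2 h.symm)

theorem eq_w₁ {x} (h : Γ₁.graph.Adj x (Sum.inl C₁.special)) : x = w₁ := (H.adj₁ x).1 h.symm

theorem leaf_mem_block {j : Fin n} (hj : j ∈ C₁.block) :
    ∃ i, i ≠ C₂.special ∧ f₂ (Sum.inl i) = Sum.inl j := by
  have hj' : j ∉ C₂.block := by rw [H.block_eq]; exact not_not.2 hj
  obtain ⟨i, rfl⟩ : j ∈ Set.range C₂.emb := by
    by_contra h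
    exact hj' (C₂.mem_block_of_notMem_range j h).1
  rw [C₂.emb_mem_block] at hj'
  exact ⟨i, hj', H.leaf₂ i hj'⟩

theorem cover (z) : (∃ x, x ≠ Sum.inl C₁.special ∧ f₁ x = z) ∨
    ∃ y, y ≠ Sum.inl C₂.special ∧ f₂ y = z := by
  rcases z with j | v
  · by_cases hj : j ∈ C₁.block
    · obtain ⟨i, hi, h⟩ := H.leaf_mem_block hj
      exact Or.inr ⟨_, fun h => hi (Sum.inl_injective h), h⟩
    · obtain ⟨i, hi, h⟩ := H.symm.leaf_mem_block (j := j) (by rw [H.block_eq]; exact hj)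
      exact Or.inl ⟨_, fun h => hi (Sum.inl_injective h), h⟩
  · rcases H.inner_cover v with ⟨u, hu⟩ | ⟨u, hu⟩
    · exact Or.inl ⟨_, by simp, hu⟩
    · exact Or.inr ⟨_, by simp, hu⟩

/-- A set of vertices of the first tree, extended over the second tree by its status at the special
leaf. -/
def extend (f₁ : Fin n₁ ⊕ Fin Γ₁.numInner → Fin n ⊕ Fin m)
    (f₂ : Fin n₂ ⊕ Fin Γ₂.numInner → Fin n ⊕ Fin m) (C₁ : Collapse n₁ n) (C₂ : Collapse n₂ n)
    (A : Set (Fin n₁ ⊕ Fin Γ₁.numInner)) : Set (Fin n ⊕ Fin m) :=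
  {z | (∃ x, x ≠ Sum.inl C₁.special ∧ f₁ x = z ∧ x ∈ A) ∨
      (∃ y, y ≠ Sum.inl C₂.special ∧ f₂ y = z ∧ Sum.inl C₁.special ∈ A)}

theorem mem_extend_left (A : Set (Fin n₁ ⊕ Fin Γ₁.numInner)) (x) :
    f₁ x ∈ extend f₁ f₂ C₁ C₂ A ↔ x ∈ A := by
  constructor
  · rintro (⟨x', -, h, hA⟩ | ⟨y, hy, h, hA⟩)
    · rwa [← H.inj₁ h]
    · rcases H.overlap _ _ h.symm with ⟨rfl, -⟩ | ⟨-, rfl⟩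
      · exact hA
      · exact absurd rfl hy
  · intro hA
    by_cases hx : x = Sum.inl C₁.special
    · subst hx
      exact Or.inr ⟨w₂, H.symm.w₁_ne, H.special₁.symm, hA⟩
    · exact Or.inl ⟨x, hx, rfl, hA⟩

theorem mem_extend_right (A : Set (Fin n₁ ⊕ Fin Γ₁.numInner)) {y} (hy : y ≠ Sum.inl C₂.special) :
    f₂ y ∈ extend f₁ f₂ C₁ C₂ A ↔ Sum.inl C₁.special ∈ A := by
  constructor
  · rintro (⟨x, hx, h, hA⟩ | ⟨y, hy, h, hA⟩)
    · rcases H.overlap _ _ h with ⟨rfl, -⟩ | ⟨-, rfl⟩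
      · exact hA
      · exact absurd rfl hy
    · exact hA
  · exact fun hA => Or.inr ⟨y, hy, rfl, hA⟩

section

include hG

theorem adj_iff (x y) : G.Adj (f₁ x) (f₁ y) ↔ Γ₁.graph.Adj x y := by
  rw [hG]
  constructor
  · rintro (⟨a, b, hab, ha, hb⟩ | ⟨a, b, hab, ha, hb⟩)
    · rwa [← H.inj₁ ha, ← H.inj₁ hb]
    · rcases H.overlap _ _ ha.symm with ⟨rfl, rfl⟩ | ⟨rfl, rfl⟩ <;>
        rcases H.overlap _ _ hb.symm with ⟨rfl, rfl⟩ | ⟨rfl, rfl⟩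
      · exact absurd rfl hab.ne
      · exact (H.adj₁ _).2 rfl
      · exact ((H.adj₁ _).2 rfl).symm
      · exact absurd rfl hab.ne
  · exact fun h => Or.inl ⟨x, y, h, rfl, rfl⟩

theorem exists_of_adj {x z} (hx : x ≠ Sum.inl C₁.special) (h : G.Adj (f₁ x) z) :
    ∃ y, f₁ y = z ∧ Γ₁.graph.Adj x y := by
  rcases (hG _ _).1 h with ⟨a, b, hab, ha, rfl⟩ | ⟨a, b, hab, ha, rfl⟩
  · exact ⟨b, rfl, H.inj₁ ha ▸ hab⟩
  · rcases H.overlap _ _ ha.symm with ⟨rfl, -⟩ | ⟨rfl, rfl⟩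
    · exact absurd rfl hx
    · rw [H.adj₂] at hab
      subst hab
      exact ⟨_, H.special₁, ((H.adj₁ _).2 rfl).symm⟩

theorem ncard_neighborSet {x} (hx : x ≠ Sum.inl C₁.special) :
    (G.neighborSet (f₁ x)).ncard = (Γ₁.graph.neighborSet x).ncard := by
  have : G.neighborSet (f₁ x) = f₁ '' Γ₁.graph.neighborSet x := by
    ext z
    constructor
    · intro hz
      obtain ⟨y, rfl, hy⟩ := H.exists_of_adj hG hx hz
      exact ⟨y, hy, rfl⟩
    · rintro ⟨y, hy, rfl⟩
      exact (H.adj_iff hG x y).2 hy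
  rw [this, Set.ncard_image_of_injective _ H.inj₁]

theorem isSide_extend {u v} {A : Set (Fin n₁ ⊕ Fin Γ₁.numInner)} (hA : IsSide Γ₁.graph u v A) :
    IsSide G (f₁ u) (f₁ v) (extend f₁ f₂ C₁ C₂ A) where
  fst_notMem := by
    rw [H.mem_extend_left]
    exact hA.fst_notMem
  snd_mem := by
    rw [H.mem_extend_left]
    exact hA.snd_mem
  eq_of_adj := by
    have key : ∀ {x y}, Γ₁.graph.Adj x y → f₁ x ∉ extend f₁ f₂ C₁ C₂ A →
        f₁ y ∈ extend f₁ f₂ C₁ C₂ A → f₁ x = f₁ u ∧ f₁ y = f₁ v := by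
      intro x y hxy hx hy
      rw [H.mem_extend_left] at hx hy
      exact (hA.eq_of_adj hxy hx hy).imp (congrArg f₁) (congrArg f₁)
    intro z z' hzz' hz hz'
    rcases (hG _ _).1 hzz' with ⟨x, y, hxy, rfl, rfl⟩ | ⟨x, y, hxy, rfl, rfl⟩
    · exact key hxy hz hz'
    · have hw := (H.adj₁ _).2 rfl
      by_cases hx : x = Sum.inl C₂.special
      · subst hx
        obtain rfl := (H.adj₂ _).1 hxy
        rw [H.special₂] at hz ⊢
        rw [← H.special₁] at hz' ⊢
        exact key hw.symm hz hz'
      · by_cases hy : y = Sum.inl C₂.special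
        · subst hy
          obtain rfl := (H.adj₂ _).1 hxy.symm
          rw [H.special₂] at hz' ⊢
          rw [← H.special₁] at hz ⊢
          exact key hw hz hz'
        · rw [H.mem_extend_right A hx] at hz
          rw [H.mem_extend_right A hy] at hz'
          exact absurd hz' hz

theorem exists_isSide_of_map {x y} (h : Relation.Map Γ₁.graph.Adj f₁ f₁ x y) :
    ∃ A, IsSide G x y A ∧ ∃! k : Fin n, Sum.inl (k - 1) ∉ A ∧ Sum.inl k ∈ A := by
  obtain ⟨u, v, huv, rfl, rfl⟩ := h
  let d : Γ₁.graph.Dart := ⟨(u, v), huv⟩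
  refine ⟨_, H.isSide_extend hG (Γ₁.isSide d), ?_⟩
  have hblock : ∀ j ∈ C₁.block,
      (Sum.inl j ∈ extend f₁ f₂ C₁ C₂ (Γ₁.side d) ↔ Sum.inl C₁.special ∈ Γ₁.side d) := by
    intro j hj
    obtain ⟨i, hi, hij⟩ := H.leaf_mem_block hj
    rw [← hij, H.mem_extend_right _ fun h => hi (Sum.inl_injective h)]
  have hs := hblock _ ((C₁.emb_mem_block C₁.special).2 rfl)
  have hi : ∀ i, (Sum.inl (C₁.emb i) ∈ extend f₁ f₂ C₁ C₂ (Γ₁.side d) ↔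
      Sum.inl i ∈ Γ₁.side d) := by
    intro i
    by_cases hi : i = C₁.special
    · rw [hi, hs]
    · rw [← H.leaf₁ i hi, H.mem_extend_left]
  refine (C₁.existsUnique_enters_iff (A := {j | Sum.inl j ∈ extend f₁ f₂ C₁ C₂ (Γ₁.side d)})
    fun j hj => (hblock j hj).trans hs.symm).2 ?_
  convert Γ₁.existsUnique_leaf_side d using 3 with i
  · exact not_congr (hi _)
  · exact hi _

theorem exists_isSide {x y} (h : G.Adj x y) :
    ∃ A, IsSide G x y A ∧ ∃! k : Fin n, Sum.inl (k - 1) ∉ A ∧ Sum.inl k ∈ A :=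
  ((hG x y).1 h).elim (H.exists_isSide_of_map hG) (H.symm.exists_isSide_of_map hG.symm)

theorem isTree : G.IsTree := by
  refine ⟨(SimpleGraph.connected_iff _).2 ⟨?_, ⟨Sum.inl 0⟩⟩, SimpleGraph.isAcyclic_of_isSide
    fun u v huv => (H.exists_isSide hG huv).imp fun _ h => h.1⟩
  let F₁ : Γ₁.graph →g G := ⟨f₁, fun h => (H.adj_iff hG _ _).2 h⟩
  let F₂ : Γ₂.graph →g G := ⟨f₂, fun h => (H.symm.adj_iff hG.symm _ _).2 h⟩
  have h : ∀ z, G.Reachable (f₁ w₁) z := by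
    intro z
    rcases H.cover z with ⟨x, -, rfl⟩ | ⟨y, -, rfl⟩
    · exact (Γ₁.preconnected w₁ x).map F₁
    · rw [← H.special₂]
      exact (Γ₂.preconnected (Sum.inl C₂.special) y).map F₂
  exact fun x y => (h x).symm.trans (h y)

theorem ncard_leaf (j : Fin n) : (G.neighborSet (Sum.inl j)).ncard = 1 := by
  rcases H.cover (Sum.inl j) with ⟨x, hx, h⟩ | ⟨x, hx, h⟩
  · rw [← h, H.ncard_neighborSet hG hx]
    rcases x with i | u
    · exact Γ₁.ncard_external i
    · obtain ⟨v, hv⟩ := H.inner₁ u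
      rw [hv] at h
      cases h
  · rw [← h, H.symm.ncard_neighborSet hG.symm hx]
    rcases x with i | u
    · exact Γ₂.ncard_external i
    · obtain ⟨v, hv⟩ := H.inner₂ u
      rw [hv] at h
      cases h

theorem le_ncard_inner (v : Fin m) : 3 ≤ (G.neighborSet (Sum.inr v)).ncard := by
  rcases H.inner_cover v with ⟨u, hu⟩ | ⟨u, hu⟩
  · rw [← hu, H.ncard_neighborSet hG (by simp)]
    exact Γ₁.ncard_internal u
  · rw [← hu, H.symm.ncard_neighborSet hG.symm (by simp)]
    exact Γ₂.ncard_internal u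

/-- The canonical tree obtained by gluing two canonical trees. -/
noncomputable def tree : CanonicalTree n where
  numInner := m
  graph := G
  isTree := H.isTree hG
  ncard_external := H.ncard_leaf hG
  ncard_internal := H.le_ncard_inner hG
  planar := by
    choose A hA hA' using fun d : G.Dart => H.exists_isSide hG d.adj
    exact planar_of_existsUnique (H.isTree hG) Sum.inl A hA hA'

end

/-- The first tree is a branch of every tree whose graph is the glued graph. -/
def branch (Γ : CanonicalTree n) (g₁ : Fin n₁ ⊕ Fin Γ₁.numInner → Fin n ⊕ Fin Γ.numInner)
    (g₂ : Fin n₂ ⊕ Fin Γ₂.numInner → Fin n ⊕ Fin Γ.numInner)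
    (H : Gluing C₁ C₂ Γ₁ Γ₂ w₁ w₂ g₁ g₂) (hG : IsUnion Γ₁.graph Γ₂.graph g₁ g₂ Γ.graph)
    (e : Γ.graph.Dart) (h1 : e.fst = g₁ w₁) (h2 : e.snd = g₁ (Sum.inl C₁.special)) :
    Branch C₁ Γ₁ Γ e := by
  have hside : Γ.side e = extend g₁ g₂ C₁ C₂ {Sum.inl C₁.special} := by
    refine (Γ.eq_side ?_).symm
    rw [h1, h2]
    refine H.isSide_extend hG ⟨H.w₁_ne, rfl, ?_⟩
    rintro x y hxy - rfl
    exact ⟨H.eq_w₁ hxy, rfl⟩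
  refine ⟨⟨⟨g₁, H.inj₁⟩, H.adj_iff hG _ _⟩, H.leaf₁, h2.symm, ?_, ?_⟩
  · intro z
    rw [hside, h2]
    change z ∈ Set.range g₁ ↔ _
    constructor
    · rintro ⟨x, rfl⟩
      rw [H.mem_extend_left, H.inj₁.eq_iff]
      exact (em _).symm
    · rintro (hz | rfl)
      · rcases H.cover z with ⟨x, -, rfl⟩ | ⟨y, hy, rfl⟩
        · exact ⟨x, rfl⟩
        · exact absurd ((H.mem_extend_right {Sum.inl C₁.special} hy).2 rfl) hz
      · exact ⟨_, rfl⟩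
  · intro j
    rw [hside]
    by_cases hj : j ∈ C₁.block
    · obtain ⟨i, hi, hij⟩ := H.leaf_mem_block hj
      rw [← hij, H.mem_extend_right _ fun h => hi (Sum.inl_injective h)]
      simp [hj]
    · obtain ⟨i, hi, hij⟩ := H.symm.leaf_mem_block (j := j) (by rw [H.block_eq]; exact hj)
      rw [← hij, H.mem_extend_left]
      simp [hi, hj]

end Gluing

theorem adj_leaf_iff (Γ : CanonicalTree n) (k : Fin n) (x) :
    Γ.graph.Adj (Sum.inl k) x ↔ x = (Γ.leafDart k).snd := by
  constructor
  · intro h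
    rw [← Γ.eq_leafDart (d := ⟨(Sum.inl k, x), h⟩) rfl]
  · rintro rfl
    have := (Γ.leafDart k).adj
    rwa [leafDart_fst] at this

/-- The map of the vertices of one tree into the vertices of the glued tree: `g` embeds the internal
vertices, and the special leaf goes to `v`. -/
def gluingMap {n₁ m₁ m : ℕ} [NeZero n₁] (C₁ : Collapse n₁ n) (g : Fin m₁ → Fin m) (v : Fin m) :
    Fin n₁ ⊕ Fin m₁ → Fin n ⊕ Fin m :=
  Sum.elim (fun i => if i = C₁.special then Sum.inr v else Sum.inl (C₁.emb i)) fun u => Sum.inr (g u)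

theorem gluingMap_special {n₁ m₁ m : ℕ} [NeZero n₁] (C₁ : Collapse n₁ n) (g : Fin m₁ → Fin m)
    (v : Fin m) : gluingMap C₁ g v (Sum.inl C₁.special) = Sum.inr v := if_pos rfl

theorem gluingMap_leaf {n₁ m₁ m : ℕ} [NeZero n₁] (C₁ : Collapse n₁ n) (g : Fin m₁ → Fin m)
    (v : Fin m) {i} (hi : i ≠ C₁.special) : gluingMap C₁ g v (Sum.inl i) = Sum.inl (C₁.emb i) :=
  if_neg hi

theorem gluingMap_injective {n₁ m₁ m : ℕ} [NeZero n₁] (C₁ : Collapse n₁ n) {g : Fin m₁ → Fin m}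
    (hg : Function.Injective g) {v : Fin m} (hv : ∀ u, g u ≠ v) :
    Function.Injective (gluingMap C₁ g v) := by
  rintro (i | u) (i' | u') h
  · by_cases hi : i = C₁.special <;> by_cases hi' : i' = C₁.special
    · rw [hi, hi']
    · rw [hi, gluingMap_special, gluingMap_leaf C₁ g v hi'] at h
      cases h
    · rw [hi', gluingMap_special, gluingMap_leaf C₁ g v hi] at h
      cases h
    · rw [gluingMap_leaf C₁ g v hi, gluingMap_leaf C₁ g v hi'] at h
      rw [C₁.strictMono.injective (Sum.inl_injective h)]
  · by_cases hi : i = C₁.special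
    · rw [hi, gluingMap_special] at h
      exact absurd (Sum.inr_injective h).symm (hv _)
    · rw [gluingMap_leaf C₁ g v hi] at h
      cases h
  · by_cases hi' : i' = C₁.special
    · rw [hi', gluingMap_special] at h
      exact absurd (Sum.inr_injective h) (hv _)
    · rw [gluingMap_leaf C₁ g v hi'] at h
      cases h
  · rw [hg (Sum.inr_injective h)]

/-- Two trees with complementary collapsed blocks are the two parts of a tree that is cut along an
internal edge. -/
theorem exists_split {n₁ n₂ : ℕ} [NeZero n₁] [NeZero n₂] (hn₁ : 3 ≤ n₁) (hn₂ : 3 ≤ n₂)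
    (C₁ : Collapse n₁ n) (C₂ : Collapse n₂ n) (hC : C₂.block = C₁.blockᶜ) (Γ₁ : CanonicalTree n₁)
    (Γ₂ : CanonicalTree n₂) :
    ∃ (Γ : CanonicalTree n) (e : Γ.graph.Dart), Nonempty (Split C₁ C₂ Γ₁ Γ₂ Γ e) := by
  obtain ⟨w₁, hw₁⟩ := Γ₁.exists_leafDart_snd hn₁ C₁.special
  obtain ⟨w₂, hw₂⟩ := Γ₂.exists_leafDart_snd hn₂ C₂.special
  let m := Γ₁.numInner + Γ₂.numInner
  let g₁ : Fin Γ₁.numInner → Fin m := Fin.castAdd Γ₂.numInner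
  let g₂ : Fin Γ₂.numInner → Fin m := Fin.natAdd Γ₁.numInner
  have hg : ∀ u u', g₁ u ≠ g₂ u' := by
    intro u u' h
    have := congrArg Fin.val h
    simp only [g₁, g₂, Fin.val_castAdd, Fin.val_natAdd] at this
    omega
  have hg₁ : Function.Injective g₁ := Fin.castAdd_injective _ _
  have hg₂ : Function.Injective g₂ := Fin.natAdd_injective _ _
  have H : Gluing C₁ C₂ Γ₁ Γ₂ (Sum.inr w₁) (Sum.inr w₂) (gluingMap C₁ g₁ (g₂ w₂))
      (gluingMap C₂ g₂ (g₁ w₁)) := by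
    refine ⟨hC, ?_, ?_, gluingMap_injective C₁ hg₁ fun u => hg u _,
      gluingMap_injective C₂ hg₂ fun u => (hg _ u).symm, fun i => gluingMap_leaf C₁ _ _,
      fun i => gluingMap_leaf C₂ _ _, gluingMap_special C₁ _ _, gluingMap_special C₂ _ _, ?_,
      fun u => ⟨_, rfl⟩, fun u => ⟨_, rfl⟩, ?_⟩
    · intro x
      rw [adj_leaf_iff, hw₁]
    · intro x
      rw [adj_leaf_iff, hw₂]
    · rintro (i | u) (i' | u') h
      · by_cases hi : i = C₁.special <;> by_cases hi' : i' = C₂.special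
        · rw [hi, hi', gluingMap_special, gluingMap_special] at h
          exact absurd (Sum.inr_injective h).symm (hg _ _)
        · rw [hi, gluingMap_special, gluingMap_leaf C₂ _ _ hi'] at h
          cases h
        · rw [hi', gluingMap_special, gluingMap_leaf C₁ _ _ hi] at h
          cases h
        · rw [gluingMap_leaf C₁ _ _ hi, gluingMap_leaf C₂ _ _ hi'] at h
          have h := Sum.inl_injective h
          rw [← C₂.emb_mem_block, ← h, hC, Set.mem_compl_iff, not_not, C₁.emb_mem_block] at hi'
          exact absurd hi' hi
      · by_cases hi : i = C₁.special
        · rw [hi, gluingMap_special] at h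
          left
          exact ⟨by rw [hi], by rw [hg₂ (Sum.inr_injective h)]⟩
        · rw [gluingMap_leaf C₁ _ _ hi] at h
          cases h
      · by_cases hi' : i' = C₂.special
        · rw [hi', gluingMap_special] at h
          right
          exact ⟨by rw [hg₁ (Sum.inr_injective h)], by rw [hi']⟩
        · rw [gluingMap_leaf C₂ _ _ hi'] at h
          cases h
      · exact absurd (Sum.inr_injective h) (hg _ _)
    · intro v
      refine Fin.addCases (fun u => Or.inl ⟨u, rfl⟩) (fun u => Or.inr ⟨u, rfl⟩) v
  let G : SimpleGraph (Fin n ⊕ Fin m) :=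
    { Adj := fun x y => Relation.Map Γ₁.graph.Adj (gluingMap C₁ g₁ (g₂ w₂)) (gluingMap C₁ g₁ (g₂ w₂)) x y ∨
        Relation.Map Γ₂.graph.Adj (gluingMap C₂ g₂ (g₁ w₁)) (gluingMap C₂ g₂ (g₁ w₁)) x y
      symm := ⟨by
        rintro x y (⟨a, b, hab, ha, hb⟩ | ⟨a, b, hab, ha, hb⟩)
        · exact Or.inl ⟨b, a, hab.symm, hb, ha⟩
        · exact Or.inr ⟨b, a, hab.symm, hb, ha⟩⟩
      loopless := ⟨by
        rintro x (⟨a, b, hab, ha, hb⟩ | ⟨a, b, hab, ha, hb⟩)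
        · exact hab.ne (H.inj₁ (ha.trans hb.symm))
        · exact hab.ne (H.inj₂ (ha.trans hb.symm))⟩ }
  have hG : IsUnion Γ₁.graph Γ₂.graph (gluingMap C₁ g₁ (g₂ w₂)) (gluingMap C₂ g₂ (g₁ w₁)) G :=
    fun x y => Iff.rfl
  let Γ := H.tree hG
  have hadj : Γ.graph.Adj (gluingMap C₁ g₁ (g₂ w₂) (Sum.inl C₁.special))
      (gluingMap C₁ g₁ (g₂ w₂) (Sum.inr w₁)) := (H.adj_iff hG _ _).2 ((H.adj₁ _).2 rfl)
  let e : Γ.graph.Dart := ⟨(_, _), hadj⟩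
  have h1 : e.fst = gluingMap C₂ g₂ (g₁ w₁) (Sum.inr w₂) := H.special₁
  have h2 : e.snd = gluingMap C₂ g₂ (g₁ w₁) (Sum.inl C₂.special) := H.special₂.symm
  exact ⟨Γ, e, ⟨⟨⟨_, h1⟩, ⟨_, rfl⟩, Gluing.branch Γ _ _ H hG e.symm rfl rfl,
    Gluing.branch Γ _ _ H.symm hG.symm e h1 h2⟩⟩⟩

end CanonicalTree

/-! ### Collapsing the two sides of a pair of regions -/

theorem Fin.val_sub_one' {n : ℕ} [NeZero n] (i : Fin n) :
    (i - 1).val = if i.val = 0 then n - 1 else i.val - 1 := by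
  obtain ⟨m, rfl⟩ := Nat.exists_eq_succ_of_ne_zero (NeZero.ne n)
  have h : i = 0 ↔ i.val = 0 := Fin.ext_iff
  rw [Fin.coe_sub_one]
  simp only [h]
  rfl

theorem Fin.val_add_one' {n : ℕ} [NeZero n] (i : Fin n) :
    (i + 1).val = if i.val + 1 = n then 0 else i.val + 1 := by
  obtain ⟨m, rfl⟩ := Nat.exists_eq_succ_of_ne_zero (NeZero.ne n)
  rw [Fin.val_add_one]
  simp [Fin.ext_iff]

/-- The vertices `a_k, …, a_{l-1}` are collapsed to the vertex at position `k`, as in the left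
cut-and-glue operator. -/
def leftCollapse {n n₁ : ℕ} [NeZero n] [NeZero n₁] (k l : Fin n) (hkl : k.val + 2 ≤ l.val)
    (h₁ : n₁ = n + 1 - (l.val - k.val)) : Collapse n₁ n where
  special := ⟨k.val, by omega⟩
  emb := fun i => if h : i.val ≤ k.val then ⟨i.val, by omega⟩
    else ⟨i.val + (l.val - k.val) - 1, by omega⟩
  block := {j | k.val ≤ j.val ∧ j.val < l.val}
  strictMono := by
    intro i j hij
    rw [Fin.lt_def] at hij ⊢
    dsimp only
    split_ifs <;> dsimp only <;> omega
  emb_sub_one := by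
    intro i hi
    rw [Ne, Fin.ext_iff, Fin.val_add_one'] at hi
    dsimp only at hi
    have h := Fin.val_sub_one' i
    have h' := i.isLt
    rw [if_neg (by omega)] at hi
    apply Fin.ext
    rw [Fin.val_sub_one']
    split_ifs at h <;> split_ifs <;> dsimp only at * <;> omega
  emb_mem_block := by
    intro i
    rw [Fin.ext_iff]
    dsimp only [Set.mem_ofPred_eq]
    split_ifs <;> dsimp only [Set.mem_ofPred_eq] <;> omega
  sub_one_mem_block := by
    have h := Fin.val_add_one' (⟨k.val, by omega⟩ : Fin n₁)
    dsimp only at h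
    rw [if_neg (by omega)] at h
    dsimp only [Set.mem_ofPred_eq]
    rw [Fin.val_sub_one']
    split_ifs <;> dsimp only at * <;> omega
  mem_block_of_notMem_range := by
    intro j hj
    have key : k.val < j.val ∧ j.val < l.val := by
      by_contra hc
      apply hj
      by_cases h : j.val ≤ k.val
      · exact ⟨⟨j.val, by omega⟩, by dsimp only; rw [dif_pos h]⟩
      · refine ⟨⟨j.val + 1 - (l.val - k.val), by omega⟩, ?_⟩
        dsimp only
        rw [dif_neg (by omega)]
        apply Fin.ext
        dsimp only
        omega
    have h := Fin.val_sub_one' j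
    rw [if_neg (by omega)] at h
    exact ⟨⟨by omega, by omega⟩, ⟨by omega, by omega⟩⟩

/-- The vertices other than `a_k, …, a_{l-1}` are collapsed to the last vertex, as in the right
cut-and-glue operator. -/
def rightCollapse {n n₂ : ℕ} [NeZero n] [NeZero n₂] (k l : Fin n) (hkl : k < l)
    (h₂ : n₂ = l.val - k.val + 1) : Collapse n₂ n where
  special := ⟨l.val - k.val, by omega⟩
  emb := fun i => ⟨k.val + i.val, by have := i.isLt; omega⟩
  block := {j | ¬ (k.val ≤ j.val ∧ j.val < l.val)}
  strictMono := by
    intro i j hij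
    rw [Fin.lt_def] at hij ⊢
    dsimp only
    omega
  emb_sub_one := by
    intro i hi
    rw [Ne, Fin.ext_iff, Fin.val_add_one'] at hi
    dsimp only at hi
    have h := Fin.val_sub_one' i
    rw [if_pos (by omega)] at hi
    rw [if_neg hi] at h
    apply Fin.ext
    rw [Fin.val_sub_one']
    dsimp only
    split_ifs <;> omega
  emb_mem_block := by
    intro i
    rw [Fin.ext_iff]
    have := i.isLt
    dsimp only [Set.mem_ofPred_eq]
    omega
  sub_one_mem_block := by
    have h := Fin.val_add_one' (⟨l.val - k.val, by omega⟩ : Fin n₂)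
    dsimp only at h
    rw [if_pos (by omega)] at h
    dsimp only [Set.mem_ofPred_eq]
    rw [Fin.val_sub_one']
    dsimp only
    split_ifs <;> omega
  mem_block_of_notMem_range := by
    intro j hj
    have key : ¬ (k.val ≤ j.val ∧ j.val ≤ l.val) := by
      intro hc
      refine hj ⟨⟨j.val - k.val, by omega⟩, Fin.ext ?_⟩
      dsimp only
      omega
    have h := Fin.val_sub_one' j
    dsimp only [Set.mem_ofPred_eq]
    split_ifs at h <;> omega

theorem rightCollapse_block {n n₁ n₂ : ℕ} [NeZero n] [NeZero n₁] [NeZero n₂] (k l : Fin n)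
    (hkl : k.val + 2 ≤ l.val) (hkl' : k < l) (h₁ : n₁ = n + 1 - (l.val - k.val))
    (h₂ : n₂ = l.val - k.val + 1) :
    (rightCollapse k l hkl' h₂).block = (leftCollapse k l hkl h₁).blockᶜ := rfl

/-- A set of labels that is left only at `k` and entered only at `l`, with `k < l`, is the complement of
the labels from `k` to `l - 1`. -/
theorem Fin.mem_iff_of_unique_crossings {n : ℕ} [NeZero n] {A : Set (Fin n)} {k l : Fin n}
    (hkl : k < l) (hk : k ∉ A) (hl : l ∈ A) (hdown : ∀ j, j - 1 ∈ A → j ∉ A → j = k)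
    (hup : ∀ j, j - 1 ∉ A → j ∈ A → j = l) (j : Fin n) :
    j ∈ A ↔ ¬ (k.val ≤ j.val ∧ j.val < l.val) := by
  have hpred : ∀ (m : ℕ) (hm : m + 1 < n), (⟨m + 1, hm⟩ - 1 : Fin n) = ⟨m, by omega⟩ := by
    intro m hm
    apply Fin.ext
    rw [Fin.val_sub_one']
    simp
  have h1 : ∀ m, k.val ≤ m → ∀ hm : m < n, m < l.val → (⟨m, hm⟩ : Fin n) ∉ A := by
    intro m hkm
    induction m, hkm using Nat.le_induction with
    | base => exact fun _ _ => hk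
    | succ m hkm ih =>
      intro hm hml hmem
      have := hup ⟨m + 1, hm⟩ (by rw [hpred]; exact ih _ (by omega)) hmem
      rw [Fin.ext_iff] at this
      dsimp only at this
      omega
  have h2 : ∀ m, l.val ≤ m → ∀ hm : m < n, (⟨m, hm⟩ : Fin n) ∈ A := by
    intro m hlm
    induction m, hlm using Nat.le_induction with
    | base => exact fun _ => hl
    | succ m hlm ih =>
      intro hm
      by_contra hmem
      have := hdown ⟨m + 1, hm⟩ (by rw [hpred]; exact ih _) hmem
      rw [Fin.ext_iff] at this
      dsimp only at this
      rw [Fin.lt_def] at hkl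
      omega
  have h3 : ∀ m, ∀ hm : m < n, m < k.val → (⟨m, hm⟩ : Fin n) ∈ A := by
    intro m
    induction m with
    | zero =>
      intro hm hmk
      by_contra hmem
      have h0 : (⟨0, hm⟩ - 1 : Fin n) = ⟨n - 1, by omega⟩ := by
        apply Fin.ext
        rw [Fin.val_sub_one']
        simp
      have := hdown ⟨0, hm⟩ (by rw [h0]; exact h2 _ (by omega) _) hmem
      rw [Fin.ext_iff] at this
      dsimp only at this
      omega
    | succ m ih =>
      intro hm hmk
      by_contra hmem
      have := hdown ⟨m + 1, hm⟩ (by rw [hpred]; exact ih _ (by omega)) hmem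
      rw [Fin.ext_iff] at this
      dsimp only at this
      omega
  constructor
  · intro hj hc
    exact h1 _ hc.1 j.isLt hc.2 hj
  · intro hc
    by_cases hjk : j.val < k.val
    · exact h3 _ j.isLt hjk
    · exact h2 _ (by omega) j.isLt

namespace CanonicalTree

variable {n : ℕ} [NeZero n]

theorem leaf_mem_side_iff (Γ : CanonicalTree n) {e : Γ.graph.Dart}
    (h : Γ.principalRegion e < Γ.principalRegion e.symm) (j : Fin n) :
    Sum.inl j ∈ Γ.side e ↔
      ¬ ((Γ.principalRegion e).val ≤ j.val ∧ j.val < (Γ.principalRegion e.symm).val) := by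
  have h1 := Γ.principalRegion_eq_iff (d := e) (k := Γ.principalRegion e)
  have h2 := Γ.principalRegion_eq_iff (d := e.symm) (k := Γ.principalRegion e.symm)
  rw [side_symm] at h2
  refine Fin.mem_iff_of_unique_crossings (A := {j | Sum.inl j ∈ Γ.side e}) h (h1.1 rfl).2
    (not_not.1 (h2.1 rfl).2) ?_ ?_ j
  · intro j hj hj'
    exact (Γ.principalRegion_eq_iff.2 ⟨hj, hj'⟩).symm
  · intro j hj hj'
    refine (Γ.principalRegion_eq_iff.2 ?_).symm
    rw [side_symm]
    exact ⟨hj, not_not.2 hj'⟩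

/-- There are at least two leaves beyond an edge that ends at an internal vertex. -/
theorem exists_two_leaves (Γ : CanonicalTree n) {e : Γ.graph.Dart} (he : ∃ v, e.snd = Sum.inr v) :
    ∃ i j, i ≠ j ∧ Sum.inl i ∈ Γ.side e ∧ Sum.inl j ∈ Γ.side e := by
  obtain ⟨v, hv⟩ := he
  have h3 := Γ.ncard_internal v
  rw [← hv] at h3
  have hmem : e.fst ∈ Γ.graph.neighborSet e.snd := e.adj.symm
  have h2 : 1 < (Γ.graph.neighborSet e.snd \ {e.fst}).ncard := by
    rw [Set.ncard_sdiff_singleton_of_mem hmem]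
    omega
  obtain ⟨u₁, u₂, ⟨hu₁, hu₁'⟩, ⟨hu₂, hu₂'⟩, hne⟩ := (Set.one_lt_ncard_iff).1 h2
  have hside := Γ.isSide e
  have key : ∀ u (hu : Γ.graph.Adj e.snd u), u ≠ e.fst →
      ∀ x ∈ Γ.side ⟨(e.snd, u), hu⟩, x ∈ Γ.side e := by
    intro u hu hue x hx
    by_contra hxe
    have hue' : u ∈ Γ.side e := by
      by_contra h
      exact hue (hside.eq_of_adj hu.symm h hside.snd_mem).1
    have := Γ.mem_side_iff_of_near (e := e.symm) (d := ⟨(e.snd, u), hu⟩) (x := x)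
      (Or.inl (by rw [side_symm]; exact not_not.2 hside.snd_mem))
      (Or.inl (by rw [side_symm]; exact not_not.2 hue')) (by rw [side_symm]; exact hxe)
    have h' := (Γ.isSide ⟨(e.snd, u), hu⟩).eq_of_adj e.adj.symm
      (Γ.isSide ⟨(e.snd, u), hu⟩).fst_notMem (this.1 hx)
    exact hue h'.2.symm
  obtain ⟨i, ⟨-, hi⟩, -⟩ := Γ.existsUnique_leaf_side ⟨(e.snd, u₁), hu₁⟩
  obtain ⟨j, ⟨-, hj⟩, -⟩ := Γ.existsUnique_leaf_side ⟨(e.snd, u₂), hu₂⟩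
  refine ⟨i, j, ?_, key _ hu₁ hu₁' _ hi, key _ hu₂ hu₂' _ hj⟩
  rintro rfl
  have s₁ := Γ.isSide ⟨(e.snd, u₁), hu₁⟩
  have s₂ := Γ.isSide ⟨(e.snd, u₂), hu₂⟩
  have := Γ.mem_side_iff_of_near (e := ⟨(e.snd, u₁), hu₁⟩) (d := ⟨(e.snd, u₂), hu₂⟩)
    (Or.inl s₁.fst_notMem)
    (Or.inl fun h => hne (s₁.eq_of_adj hu₂ s₁.fst_notMem h).2.symm) hi
  exact hne (s₂.eq_of_adj hu₁ s₂.fst_notMem (this.1 hj)).2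

/-- The two regions on either side of an internal edge are not adjacent in the polygon. -/
theorem principalRegion_not_adjacent (Γ : CanonicalTree n) {e : Γ.graph.Dart}
    (h : Γ.principalRegion e < Γ.principalRegion e.symm) (h₁ : ∃ v, e.fst = Sum.inr v)
    (h₂ : ∃ v, e.snd = Sum.inr v) :
    (Γ.principalRegion e).val + 2 ≤ (Γ.principalRegion e.symm).val ∧
      (Γ.principalRegion e.symm).val + 2 ≤ n + (Γ.principalRegion e).val := by
  obtain ⟨i, j, hij, hi, hj⟩ := Γ.exists_two_leaves h₂
  obtain ⟨i', j', hij', hi', hj'⟩ := Γ.exists_two_leaves (e := e.symm) h₁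
  rw [Γ.leaf_mem_side_iff h] at hi hj
  rw [side_symm, Set.mem_compl_iff, Γ.leaf_mem_side_iff h] at hi' hj'
  rw [Ne, Fin.ext_iff] at hij hij'
  have := i.isLt
  have := j.isLt
  omega

/-! ### Uniqueness of the cut and of the gluing -/

variable {n' : ℕ} [NeZero n']

namespace Branch

variable {C : Collapse n' n} {Γ' Γ'' : CanonicalTree n'} {Γ Γ₀ : CanonicalTree n}

theorem iso {e : Γ.graph.Dart} (B : Branch C Γ' Γ e) (B' : Branch C Γ'' Γ e) : Iso Γ' Γ'' := by
  have h : Set.range B.toEmb = Set.range B'.toEmb := by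
    ext x
    rw [B.mem_range_iff, B'.mem_range_iff]
  let E : _ ≃ _ := ((Equiv.ofInjective _ B.toEmb.injective).trans (Equiv.setCongr h)).trans
    (Equiv.ofInjective _ B'.toEmb.injective).symm
  have hE : ∀ x, B'.toEmb (E x) = B.toEmb x := by
    intro x
    simp only [E, Equiv.trans_apply]
    rw [Equiv.apply_ofInjective_symm B'.toEmb.injective]
    rfl
  refine ⟨⟨E, fun {x y} => ?_⟩, fun k => ?_⟩
  · rw [← B'.toEmb.map_rel_iff, ← B.toEmb.map_rel_iff, hE, hE]
  · apply B'.toEmb.injective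
    refine (hE _).trans ?_
    by_cases hk : k = C.special
    · rw [hk, B.map_special, B'.map_special]
    · rw [B.map_leaf k hk, B'.map_leaf k hk]

/-- A branch may be replaced by an isomorphic tree. -/
def ofIso {e : Γ.graph.Dart} (B : Branch C Γ' Γ e) (φ : Γ''.graph ≃g Γ'.graph)
    (hφ : ∀ k : Fin n', φ (Sum.inl k) = Sum.inl k) : Branch C Γ'' Γ e where
  toEmb := φ.toEmbedding.trans B.toEmb
  map_leaf := fun i hi => (congrArg B.toEmb (hφ i)).trans (B.map_leaf i hi)
  map_special := (congrArg B.toEmb (hφ _)).trans B.map_special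
  mem_range_iff := fun x => by
    rw [← B.mem_range_iff]
    constructor
    · rintro ⟨y, rfl⟩
      exact ⟨_, rfl⟩
    · rintro ⟨y, rfl⟩
      exact ⟨φ.symm y, congrArg B.toEmb (φ.apply_symm_apply y)⟩
  leaf_mem_side_iff := B.leaf_mem_side_iff

theorem _root_.CanonicalTree.mem_side_dartEquiv (φ : Γ.graph ≃g Γ₀.graph) (e : Γ.graph.Dart) (x) :
    φ x ∈ Γ₀.side (dartEquiv φ e) ↔ x ∈ Γ.side e := by
  rw [← Γ.eq_side ((Γ₀.isSide (dartEquiv φ e)).comap φ.toEmbedding)]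
  rfl

/-- The ambient tree may be replaced by an isomorphic tree. -/
def mapIso {e : Γ.graph.Dart} (B : Branch C Γ' Γ e) (φ : Γ.graph ≃g Γ₀.graph)
    (hφ : ∀ k : Fin n, φ (Sum.inl k) = Sum.inl k) : Branch C Γ' Γ₀ (dartEquiv φ e) where
  toEmb := B.toEmb.trans φ.toEmbedding
  map_leaf := fun i hi => (congrArg φ (B.map_leaf i hi)).trans (hφ _)
  map_special := congrArg φ B.map_special
  mem_range_iff := fun x => by
    obtain ⟨x, rfl⟩ := φ.surjective x
    rw [mem_side_dartEquiv, dartEquiv_snd, φ.injective.eq_iff, ← B.mem_range_iff]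
    constructor
    · rintro ⟨y, hy⟩
      exact ⟨y, φ.injective hy⟩
    · rintro ⟨y, rfl⟩
      exact ⟨y, rfl⟩
  leaf_mem_side_iff := fun j => by
    rw [← hφ j, mem_side_dartEquiv, B.leaf_mem_side_iff]

end Branch

/-- An automorphism of a canonical tree that fixes the leaves fixes all directed edges, because each of
them lies on the path between two leaves. -/
theorem dartEquiv_eq_self (Γ : CanonicalTree n) (φ : Γ.graph ≃g Γ.graph)
    (hφ : ∀ k : Fin n, φ (Sum.inl k) = Sum.inl k) (d : Γ.graph.Dart) : dartEquiv φ d = d := by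
  have h1 := Γ.principalRegion_spec d.symm
  rw [SimpleGraph.Dart.symm_symm] at h1
  have h2 := path_darts_map φ hφ (Γ.principalRegion d.symm)
  have h3 : (Γ.path (Γ.principalRegion d.symm)).darts.map id =
      (Γ.path (Γ.principalRegion d.symm)).darts.map (dartEquiv φ) := by rw [List.map_id, ← h2]
  exact (List.map_inj_left.1 h3 d h1).symm

namespace Split

variable {n₁ n₂ : ℕ} [NeZero n₁] [NeZero n₂] {C₁ : Collapse n₁ n} {C₂ : Collapse n₂ n}
  {Γ₁ : CanonicalTree n₁} {Γ₂ : CanonicalTree n₂} {Γ Γ' : CanonicalTree n} {e : Γ.graph.Dart}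
  {e' : Γ'.graph.Dart}

theorem right_special (P : Split C₁ C₂ Γ₁ Γ₂ Γ e) :
    P.right.toEmb (Sum.inl C₂.special) = e.snd := P.right.map_special

theorem left_eq_right_iff (P : Split C₁ C₂ Γ₁ Γ₂ Γ e) (x y) :
    P.left.toEmb x = P.right.toEmb y ↔
      (x = Sum.inl C₁.special ∧ y = (Γ₂.leafDart C₂.special).snd) ∨
        (x = (Γ₁.leafDart C₁.special).snd ∧ y = Sum.inl C₂.special) := by
  have h1 : P.right.toEmb (Γ₂.leafDart C₂.special).snd = e.fst :=
    congrArg (fun d => d.snd) P.right.dart_leafDart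
  have h2 : P.left.toEmb (Γ₁.leafDart C₁.special).snd = e.snd :=
    congrArg (fun d => d.snd) P.left.dart_leafDart
  constructor
  · intro h
    rcases P.eq_special_of_eq h with rfl | rfl
    · rw [P.left_special, ← h1] at h
      exact Or.inl ⟨rfl, (P.right.toEmb.injective h).symm⟩
    · rw [P.right_special, ← h2] at h
      exact Or.inr ⟨P.left.toEmb.injective h, rfl⟩
  · rintro (⟨rfl, rfl⟩ | ⟨rfl, rfl⟩)
    · rw [h1, P.left_special]
    · rw [h2, P.right_special]

open Classical in
/-- The vertex of `Γ'` in the same position as a vertex of `Γ`, for two trees with the same parts. -/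
noncomputable def transfer (P : Split C₁ C₂ Γ₁ Γ₂ Γ e) (P' : Split C₁ C₂ Γ₁ Γ₂ Γ' e')
    (z : Fin n ⊕ Fin Γ.numInner) : Fin n ⊕ Fin Γ'.numInner :=
  if h : ∃ x, P.left.toEmb x = z then P'.left.toEmb h.choose
  else if h : ∃ y, P.right.toEmb y = z then P'.right.toEmb h.choose
  else Sum.inl 0

theorem transfer_left (P : Split C₁ C₂ Γ₁ Γ₂ Γ e) (P' : Split C₁ C₂ Γ₁ Γ₂ Γ' e') (x) :
    P.transfer P' (P.left.toEmb x) = P'.left.toEmb x := by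
  have h : ∃ x', P.left.toEmb x' = P.left.toEmb x := ⟨x, rfl⟩
  rw [transfer, dif_pos h, P.left.toEmb.injective h.choose_spec]

theorem transfer_right (P : Split C₁ C₂ Γ₁ Γ₂ Γ e) (P' : Split C₁ C₂ Γ₁ Γ₂ Γ' e') (y) :
    P.transfer P' (P.right.toEmb y) = P'.right.toEmb y := by
  by_cases h : ∃ x, P.left.toEmb x = P.right.toEmb y
  · rw [transfer, dif_pos h, P'.left_eq_right_iff, ← P.left_eq_right_iff]
    exact h.choose_spec
  · have h' : ∃ y', P.right.toEmb y' = P.right.toEmb y := ⟨y, rfl⟩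
    rw [transfer, dif_neg h, dif_pos h', P.right.toEmb.injective h'.choose_spec]

theorem transfer_transfer (P : Split C₁ C₂ Γ₁ Γ₂ Γ e) (P' : Split C₁ C₂ Γ₁ Γ₂ Γ' e') (z) :
    P'.transfer P (P.transfer P' z) = z := by
  rcases P.exists_left_or_right z with ⟨x, -, rfl⟩ | ⟨y, -, rfl⟩
  · rw [transfer_left, transfer_left]
  · rw [transfer_right, transfer_right]

theorem transfer_adj (P : Split C₁ C₂ Γ₁ Γ₂ Γ e) (P' : Split C₁ C₂ Γ₁ Γ₂ Γ' e') {z z'}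
    (h : Γ.graph.Adj z z') : Γ'.graph.Adj (P.transfer P' z) (P.transfer P' z') := by
  rcases P.exists_dart_left_or_right ⟨(z, z'), h⟩ with ⟨d, -, hd⟩ | ⟨d, -, hd⟩
  · have h1 : P.left.toEmb d.fst = z := congrArg (fun d => d.fst) hd
    have h2 : P.left.toEmb d.snd = z' := congrArg (fun d => d.snd) hd
    rw [← h1, ← h2, transfer_left, transfer_left]
    exact P'.left.toEmb.map_rel_iff.2 d.adj
  · have h1 : P.right.toEmb d.fst = z := congrArg (fun d => d.fst) hd
    have h2 : P.right.toEmb d.snd = z' := congrArg (fun d => d.snd) hd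
    rw [← h1, ← h2, transfer_right, transfer_right]
    exact P'.right.toEmb.map_rel_iff.2 d.adj

/-- Two trees that are cut into the same two parts are isomorphic, and the cut edges correspond. -/
theorem exists_iso (P : Split C₁ C₂ Γ₁ Γ₂ Γ e) (P' : Split C₁ C₂ Γ₁ Γ₂ Γ' e') :
    ∃ φ : Γ.graph ≃g Γ'.graph, (∀ k : Fin n, φ (Sum.inl k) = Sum.inl k) ∧ dartEquiv φ e = e' := by
  let φ : Γ.graph ≃g Γ'.graph :=
    { toFun := P.transfer P'
      invFun := P'.transfer P
      left_inv := P.transfer_transfer P'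
      right_inv := P'.transfer_transfer P
      map_rel_iff' := fun {z z'} => by
        refine ⟨fun h => ?_, P.transfer_adj P'⟩
        have := P'.transfer_adj P h
        change Γ.graph.Adj (P'.transfer P (P.transfer P' z)) (P'.transfer P (P.transfer P' z')) at this
        rwa [transfer_transfer, transfer_transfer] at this }
  refine ⟨φ, fun k => ?_, ?_⟩
  · change P.transfer P' (Sum.inl k) = Sum.inl k
    rcases P.exists_left_or_right (Sum.inl k) with ⟨x, hx, h⟩ | ⟨x, hx, h⟩
    · obtain ⟨i, rfl⟩ := (P.left.map_isLeaf_iff P.fst_inner hx).1 ⟨k, h⟩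
      have hi : i ≠ C₁.special := fun h => hx (h ▸ rfl)
      rw [← h, transfer_left, P'.left.map_leaf i hi]
      exact congrArg _ (Sum.inl_injective ((P.left.map_leaf i hi).symm.trans h))
    · obtain ⟨i, rfl⟩ := (P.right.map_isLeaf_iff P.snd_inner hx).1 ⟨k, h⟩
      have hi : i ≠ C₂.special := fun h => hx (h ▸ rfl)
      rw [← h, transfer_right, P'.right.map_leaf i hi]
      exact congrArg _ (Sum.inl_injective ((P.right.map_leaf i hi).symm.trans h))
  · ext
    · change P.transfer P' e.fst = e'.fst
      rw [← P.left_special, transfer_left, P'.left_special]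
    · change P.transfer P' e.snd = e'.snd
      rw [← P.right_special, transfer_right, P'.right_special]

end Split

end CanonicalTree

/-! ### Summing over the trees that contain a given internal edge -/

theorem Finset.sum_eq_sum_of_rel {α β : Type*} {s : Finset α} {s' : Finset β} {f : α → ℂ}
    {g : β → ℂ} (R : α → β → Prop) (h₁ : ∀ x ∈ s, ∃ y ∈ s', R x y) (h₂ : ∀ y ∈ s', ∃ x ∈ s, R x y)
    (h₃ : ∀ x x' y, R x y → R x' y → x = x') (h₄ : ∀ x y y', R x y → R x y' → y = y')
    (h₅ : ∀ x ∈ s, ∀ y ∈ s', R x y → f x = g y) : ∑ x ∈ s, f x = ∑ y ∈ s', g y := by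
  choose φ hφ hR using h₁
  refine Finset.sum_bij φ hφ ?_ ?_ fun x hx => h₅ x hx _ (hφ x hx) (hR x hx)
  · intro x hx x' hx' h
    exact h₃ _ _ _ (hR x hx) (h ▸ hR x' hx')
  · intro y hy
    obtain ⟨x, hx, hxy⟩ := h₂ y hy
    exact ⟨x, hx, h₄ _ _ _ (hR x hx) hxy⟩

theorem sum_sum_mul_sum_mul_sum {ι α β : Type*} [Fintype ι] [Fintype α] [Fintype β]
    (S : Matrix ι ι ℂ) (f : α → ι → ℂ) (g : β → ι → ℂ) :
    ∑ c, ∑ d, (∑ x, f x c) * S c d * ∑ y, g y d =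
      ∑ p : α × β, ∑ c, ∑ d, f p.1 c * S c d * g p.2 d := by
  have h : ∀ c d, (∑ x, f x c) * S c d * ∑ y, g y d = ∑ p : α × β, f p.1 c * S c d * g p.2 d := by
    intro c d
    rw [Fintype.sum_prod_type, Finset.sum_mul, Finset.sum_mul]
    exact Finset.sum_congr rfl fun x _ => Finset.mul_sum _ _ _
  simp_rw [h]
  rw [Finset.sum_comm]
  symm
  refine Eq.trans (Finset.sum_congr rfl fun p _ => Finset.sum_comm) ?_
  rw [Finset.sum_comm]
  exact Finset.sum_congr rfl fun d _ => Finset.sum_comm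

namespace TSP

variable {n : ℕ} [NeZero n]

/-- A tree that represents a canonical tree partition. -/
noncomputable def rep (T : TSP n) : CanonicalTree n := Quotient.out T

theorem mk_rep (T : TSP n) : Quotient.mk (CanonicalTree.setoid n) T.rep = T := Quotient.out_eq _

theorem value_eq {ι : Type*} [Fintype ι] [DecidableEq ι] (T : TSP n) (M S : Matrix ι ι ℂ) (t : ℝ)
    (σ : Fin n → Charge) (a : Fin n → ι) : T.value M S t σ a = T.rep.value M S t σ a := by
  conv_lhs => rw [← T.mk_rep]
  rfl

end TSP

namespace CanonicalTree

variable {n : ℕ} [NeZero n]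

open Classical in
/-- The internal edges of `Γ`, each with one orientation. -/
noncomputable def innerEdges (Γ : CanonicalTree n) : Finset Γ.graph.Dart :=
  {d | (∃ v, d.fst = Sum.inr v) ∧ (∃ w, d.snd = Sum.inr w) ∧
    Γ.principalRegion d < Γ.principalRegion d.symm}

theorem mem_innerEdges (Γ : CanonicalTree n) {d : Γ.graph.Dart} : d ∈ Γ.innerEdges ↔
    (∃ v, d.fst = Sum.inr v) ∧ (∃ w, d.snd = Sum.inr w) ∧
      Γ.principalRegion d < Γ.principalRegion d.symm := by
  simp [innerEdges]

theorem innerEdges_subset (Γ : CanonicalTree n) : Γ.innerEdges ⊆ Γ.orientedEdges := fun _ hd =>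
  Γ.mem_orientedEdges.2 (Or.inr (Γ.mem_innerEdges.1 hd))

variable {ι : Type*} [Fintype ι] [DecidableEq ι] (M S : Matrix ι ι ℂ) (t : ℝ)

/-- The derivative of the matrix `S_t Θ̂_t` of an internal edge: two external edges joined by `S`. -/
noncomputable def cutMatrix (Γ : CanonicalTree n) (σ : Fin n → Charge) (e : Γ.graph.Dart) :
    Matrix ι ι ℂ :=
  (thetaHat M S t (Γ.charge σ e.symm) (Γ.charge σ e))ᵀ * Sᵀ *
    thetaHat M S t (Γ.charge σ e) (Γ.charge σ e.symm)

open Classical in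
/-- Cutting the internal edge between `R_k` and `R_l` in all trees that have one produces all pairs of
trees of the two smaller polygons, each pair once. -/
theorem sum_cut {n₁ n₂ : ℕ} [NeZero n₁] [NeZero n₂] (k l : Fin n) (hkl : k.val + 2 ≤ l.val)
    (hkl' : k < l) (hn : l.val + 2 ≤ n + k.val) (h₁ : n₁ = n + 1 - (l.val - k.val))
    (h₂ : n₂ = l.val - k.val + 1) (σ : Fin n → Charge) (a : Fin n → ι) (a₁ : ι → Fin n₁ → ι)
    (a₂ : ι → Fin n₂ → ι)
    (ha₁ : ∀ c i, i ≠ (leftCollapse k l hkl h₁).special → a₁ c i = a ((leftCollapse k l hkl h₁).emb i))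
    (ha₁' : ∀ c, a₁ c (leftCollapse k l hkl h₁).special = c)
    (ha₂ : ∀ c i, i ≠ (rightCollapse k l hkl' h₂).special →
      a₂ c i = a ((rightCollapse k l hkl' h₂).emb i))
    (ha₂' : ∀ c, a₂ c (rightCollapse k l hkl' h₂).special = c) :
    ∑ T : TSP n, ∑ e ∈ T.rep.innerEdges.filter
        (fun e => (T.rep.principalRegion e, T.rep.principalRegion e.symm) = (k, l)),
        T.rep.replacedValue M S t σ a e (T.rep.cutMatrix M S t σ e) =
      ∑ c, ∑ d, (∑ T₁ : TSP n₁,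
          T₁.value M S t (fun i => σ ((leftCollapse k l hkl h₁).emb i)) (a₁ c)) * S c d *
        ∑ T₂ : TSP n₂, T₂.value M S t (fun i => σ ((rightCollapse k l hkl' h₂).emb i)) (a₂ d) := by
  set C₁ := leftCollapse k l hkl h₁ with hC₁
  set C₂ := rightCollapse k l hkl' h₂ with hC₂
  have hn₁ : 3 ≤ n₁ := by omega
  have hn₂ : 3 ≤ n₂ := by omega
  have hmem : ∀ {Γ₁ : CanonicalTree n₁} {Γ₂ : CanonicalTree n₂} {Γ : CanonicalTree n}
      {e : Γ.graph.Dart}, Split C₁ C₂ Γ₁ Γ₂ Γ e →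
      e ∈ Γ.innerEdges ∧ (Γ.principalRegion e, Γ.principalRegion e.symm) = (k, l) := by
    intro Γ₁ Γ₂ Γ e P
    have h1 : Γ.principalRegion e = k := by
      rw [← P.left_dart_leafDart, P.left.principalRegion_dart, principalRegion_leafDart]
      exact Fin.ext (by simp [hC₁, leftCollapse])
    have h2 : Γ.principalRegion e.symm = l := by
      rw [← P.right.dart_leafDart, P.right.principalRegion_dart, principalRegion_leafDart]
      apply Fin.ext
      simp only [hC₂, rightCollapse]
      omega
    exact ⟨Γ.mem_innerEdges.2 ⟨P.fst_inner, P.snd_inner, by rw [h1, h2]; exact hkl'⟩,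
      by rw [h1, h2]⟩
  have hR : ∑ c, ∑ d, (∑ T₁ : TSP n₁, T₁.value M S t (fun i => σ (C₁.emb i)) (a₁ c)) * S c d *
        ∑ T₂ : TSP n₂, T₂.value M S t (fun i => σ (C₂.emb i)) (a₂ d) =
      ∑ T : TSP n₁ × TSP n₂, ∑ c, ∑ d, T.1.value M S t (fun i => σ (C₁.emb i)) (a₁ c) * S c d *
        T.2.value M S t (fun i => σ (C₂.emb i)) (a₂ d) :=
    sum_sum_mul_sum_mul_sum S _ _
  rw [hR, Finset.sum_sigma']
  refine Finset.sum_eq_sum_of_rel (fun x y => ∃ (Γ₁ : CanonicalTree n₁) (Γ₂ : CanonicalTree n₂),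
    Quotient.mk (CanonicalTree.setoid n₁) Γ₁ = y.1 ∧ Quotient.mk (CanonicalTree.setoid n₂) Γ₂ = y.2 ∧
      Nonempty (Split C₁ C₂ Γ₁ Γ₂ x.1.rep x.2)) ?_ ?_ ?_ ?_ ?_
  · rintro ⟨T, e⟩ he
    simp only [Finset.mem_sigma, Finset.mem_univ, true_and, Finset.mem_filter, mem_innerEdges,
      Prod.mk.injEq] at he
    obtain ⟨⟨hfst, hsnd, hlt⟩, hk, hl⟩ := he
    have hleaf := T.rep.leaf_mem_side_iff hlt
    rw [hk, hl] at hleaf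
    obtain ⟨Γ₁, ⟨B₁⟩⟩ := exists_branch C₁ T.rep e.symm fun j => by
      rw [side_symm, Set.mem_compl_iff, hleaf, not_not]
      rfl
    obtain ⟨Γ₂, ⟨B₂⟩⟩ := exists_branch C₂ T.rep e hleaf
    exact ⟨(Quotient.mk _ Γ₁, Quotient.mk _ Γ₂), Finset.mem_univ _, Γ₁, Γ₂, rfl, rfl,
      ⟨⟨hfst, hsnd, B₁, B₂⟩⟩⟩
  · rintro ⟨T₁, T₂⟩ -
    obtain ⟨Γ, e, ⟨P⟩⟩ := exists_split hn₁ hn₂ C₁ C₂ (rightCollapse_block k l hkl hkl' h₁ h₂)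
      T₁.rep T₂.rep
    obtain ⟨φ, hφ⟩ : Iso Γ (TSP.rep (Quotient.mk (CanonicalTree.setoid n) Γ)) :=
      Quotient.exact (TSP.mk_rep _).symm
    let P' : Split C₁ C₂ T₁.rep T₂.rep _ (dartEquiv φ e) :=
      ⟨(fst_inr_iff φ hφ _).2 P.fst_inner, (fst_inr_iff φ hφ _).2 P.snd_inner, P.left.mapIso φ hφ,
        P.right.mapIso φ hφ⟩
    refine ⟨⟨Quotient.mk _ Γ, dartEquiv φ e⟩, ?_, T₁.rep, T₂.rep, T₁.mk_rep, T₂.mk_rep, ⟨P'⟩⟩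
    rw [Finset.mem_sigma, Finset.mem_filter]
    exact ⟨Finset.mem_univ _, hmem P'⟩
  · rintro ⟨T, e⟩ ⟨T', e'⟩ ⟨T₁, T₂⟩ ⟨Γ₁, Γ₂, rfl, rfl, ⟨P⟩⟩ ⟨Γ₁', Γ₂', h1, h2, ⟨P'⟩⟩
    obtain ⟨φ₁, hφ₁⟩ : Iso Γ₁ Γ₁' := Quotient.exact h1.symm
    obtain ⟨φ₂, hφ₂⟩ : Iso Γ₂ Γ₂' := Quotient.exact h2.symm
    let P'' : Split C₁ C₂ Γ₁ Γ₂ T'.rep e' :=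
      ⟨P'.fst_inner, P'.snd_inner, P'.left.ofIso φ₁ hφ₁, P'.right.ofIso φ₂ hφ₂⟩
    obtain ⟨φ, hφ, he⟩ := P.exists_iso P''
    have hT : T = T' := by
      rw [← T.mk_rep, ← T'.mk_rep]
      exact Quotient.sound ⟨φ, hφ⟩
    subst hT
    rw [← he, dartEquiv_eq_self _ φ hφ]
  · rintro ⟨T, e⟩ ⟨T₁, T₂⟩ ⟨T₁', T₂'⟩ ⟨Γ₁, Γ₂, h1, h2, ⟨P⟩⟩ ⟨Γ₁', Γ₂', h1', h2', ⟨P'⟩⟩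
    have e1 : T₁ = T₁' := h1.symm.trans ((Quotient.sound (P.left.iso P'.left)).trans h1')
    have e2 : T₂ = T₂' := h2.symm.trans ((Quotient.sound (P.right.iso P'.right)).trans h2')
    rw [e1, e2]
  · rintro ⟨T, e⟩ he ⟨T₁, T₂⟩ - ⟨Γ₁, Γ₂, rfl, rfl, ⟨P⟩⟩
    have he' := innerEdges_subset _ (hmem P).1
    exact (P.sum_value_mul_value M S t hn₁ hn₂ he' σ a a₁ a₂ ha₁ ha₁' ha₂ ha₂').symm

end CanonicalTree

/-! ### Derivatives of the propagators -/

section Propagator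

variable {ι : Type*} [Fintype ι] [DecidableEq ι] {M S : Matrix ι ι ℂ}

theorem mHat_transpose (M : Matrix ι ι ℂ) (σ σ' : Charge) : (mHat M σ σ')ᵀ = mHat M σ' σ := by
  ext a b
  simp only [mHat, Matrix.transpose_apply, Matrix.of_apply]
  rw [Matrix.mul_assoc, Matrix.trace_mul_comm, ← Matrix.mul_assoc]

theorem sT_transpose {κ : Type*} {S : Matrix κ κ ℂ} (hS : S.IsSymm) (t : ℝ) : (sT S t)ᵀ = sT S t := by
  rw [sT, Matrix.transpose_smul, hS.eq]

theorem thetaHat_mul {t : ℝ} {σ σ' : Charge} (h : IsUnit (1 - mHat M σ σ' * sT S t)) :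
    thetaHat M S t σ σ' * (1 - mHat M σ σ' * sT S t) = 1 :=
  Matrix.nonsing_inv_mul _ ((Matrix.isUnit_iff_isUnit_det _).1 h)

theorem mul_thetaHat {t : ℝ} {σ σ' : Charge} (h : IsUnit (1 - mHat M σ σ' * sT S t)) :
    (1 - mHat M σ σ' * sT S t) * thetaHat M S t σ σ' = 1 :=
  Matrix.mul_nonsing_inv _ ((Matrix.isUnit_iff_isUnit_det _).1 h)

theorem thetaHat_transpose (hS : S.IsSymm) (t : ℝ) (σ σ' : Charge) :
    (thetaHat M S t σ σ')ᵀ = (1 - sT S t * mHat M σ' σ)⁻¹ := by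
  rw [thetaHat, Matrix.transpose_nonsing_inv, Matrix.transpose_sub, Matrix.transpose_one,
    Matrix.transpose_mul, mHat_transpose, sT_transpose hS]

theorem thetaHat_transpose_eq (hS : S.IsSymm) {t : ℝ} {σ σ' : Charge}
    (h : IsUnit (1 - mHat M σ σ' * sT S t)) :
    (thetaHat M S t σ' σ)ᵀ = 1 + sT S t * thetaHat M S t σ σ' * mHat M σ σ' := by
  rw [thetaHat_transpose hS]
  apply Matrix.inv_eq_right_inv
  have h1 := mul_thetaHat h
  have : (1 - sT S t * mHat M σ σ') * (1 + sT S t * thetaHat M S t σ σ' * mHat M σ σ') =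
      1 - sT S t * mHat M σ σ' + sT S t *
        ((1 - mHat M σ σ' * sT S t) * thetaHat M S t σ σ') * mHat M σ σ' := by
    noncomm_ring
  rw [this, h1]
  noncomm_ring

/-- The two-point loop `Θ̂_t M̂` is symmetric under the exchange of its two ends. -/
theorem thetaHat_mul_mHat_symm (hS : S.IsSymm) {t : ℝ} {σ σ' : Charge}
    (h : IsUnit (1 - mHat M σ' σ * sT S t)) (a b : ι) :
    (thetaHat M S t σ σ' * mHat M σ σ') a b = (thetaHat M S t σ' σ * mHat M σ' σ) b a := by
  have h2 : mHat M σ' σ * (thetaHat M S t σ σ')ᵀ = thetaHat M S t σ' σ * mHat M σ' σ := by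
    rw [thetaHat_transpose_eq hS h]
    have : mHat M σ' σ * (1 + sT S t * thetaHat M S t σ' σ * mHat M σ' σ) =
        mHat M σ' σ - (1 - mHat M σ' σ * sT S t) * thetaHat M S t σ' σ * mHat M σ' σ +
          thetaHat M S t σ' σ * mHat M σ' σ := by noncomm_ring
    rw [this, mul_thetaHat h]
    noncomm_ring
  rw [← Matrix.transpose_apply (thetaHat M S t σ σ' * mHat M σ σ') b a, Matrix.transpose_mul,
    mHat_transpose, h2]

theorem continuous_sT {κ : Type*} (S : Matrix κ κ ℂ) : Continuous (sT S) :=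
  (Complex.continuous_ofReal).smul continuous_const

theorem continuousAt_thetaHat {t : ℝ} {σ σ' : Charge} (h : IsUnit (1 - mHat M σ σ' * sT S t)) :
    ContinuousAt (fun s => thetaHat M S s σ σ') t := by
  have hA : Continuous fun s => 1 - mHat M σ σ' * sT S s :=
    continuous_const.sub (continuous_const.matrix_mul (continuous_sT S))
  have hdet : (1 - mHat M σ σ' * sT S t).det ≠ 0 :=
    ((Matrix.isUnit_iff_isUnit_det _).1 h).ne_zero
  have : (fun s => thetaHat M S s σ σ') = fun s =>
      (1 - mHat M σ σ' * sT S s).det⁻¹ • (1 - mHat M σ σ' * sT S s).adjugate := by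
    funext s
    rw [thetaHat, Matrix.inv_def, Ring.inverse_eq_inv']
  rw [this]
  exact (hA.matrix_det.continuousAt.inv₀ hdet).smul hA.matrix_adjugate.continuousAt

theorem eventually_isUnit {t : ℝ} {σ σ' : Charge} (h : IsUnit (1 - mHat M σ σ' * sT S t)) :
    ∀ᶠ s in nhds t, IsUnit (1 - mHat M σ σ' * sT S s) := by
  have hA : Continuous fun s => (1 - mHat M σ σ' * sT S s).det :=
    (continuous_const.sub (continuous_const.matrix_mul (continuous_sT S))).matrix_det
  have hdet : (1 - mHat M σ σ' * sT S t).det ≠ 0 :=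
    ((Matrix.isUnit_iff_isUnit_det _).1 h).ne_zero
  filter_upwards [hA.continuousAt.eventually_ne hdet] with s hs
  exact (Matrix.isUnit_iff_isUnit_det _).2 (isUnit_iff_ne_zero.2 hs)

/-- The entries of the differential equation `∂_t Θ̂_t = Θ̂_t M̂ S Θ̂_t`. -/
theorem hasDerivAt_thetaHat {t : ℝ} {σ σ' : Charge} (h : IsUnit (1 - mHat M σ σ' * sT S t))
    (a b : ι) : HasDerivAt (fun s => thetaHat M S s σ σ' a b)
      ((thetaHat M S t σ σ' * mHat M σ σ' * S * thetaHat M S t σ σ') a b) t := by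
  rw [hasDerivAt_iff_tendsto_slope]
  have hcont : ContinuousAt
      (fun s => (thetaHat M S s σ σ' * mHat M σ σ' * S * thetaHat M S t σ σ') a b) t := by
    have h1 : ContinuousAt
        (fun s => thetaHat M S s σ σ' * mHat M σ σ' * S * thetaHat M S t σ σ') t := by
      have hc : Continuous fun X : Matrix ι ι ℂ => X * mHat M σ σ' * S * thetaHat M S t σ σ' :=
        ((continuous_id.matrix_mul continuous_const).matrix_mul continuous_const).matrix_mul
          continuous_const
      exact hc.continuousAt.comp (continuousAt_thetaHat h)
    exact ((continuous_id.matrix_elem a b).continuousAt).comp h1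
  refine Filter.Tendsto.congr' ?_ (hcont.tendsto.mono_left nhdsWithin_le_nhds)
  filter_upwards [nhdsWithin_le_nhds (eventually_isUnit h), self_mem_nhdsWithin] with s hs hne
  have hst : ((s : ℂ) - t) ≠ 0 := by
    rw [← Complex.ofReal_sub, Complex.ofReal_ne_zero]
    exact sub_ne_zero.2 hne
  -- The resolvent identity for `Θ̂_s` and `Θ̂_t`.
  have key : thetaHat M S s σ σ' - thetaHat M S t σ σ' =
      ((s : ℂ) - t) • (thetaHat M S s σ σ' * mHat M σ σ' * S * thetaHat M S t σ σ') := by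
    have h1 := thetaHat_mul hs
    have h2 := mul_thetaHat h
    calc thetaHat M S s σ σ' - thetaHat M S t σ σ' =
        thetaHat M S s σ σ' * ((1 - mHat M σ σ' * sT S t) * thetaHat M S t σ σ') -
          thetaHat M S s σ σ' * (1 - mHat M σ σ' * sT S s) * thetaHat M S t σ σ' := by
          rw [h1, h2, mul_one, one_mul]
      _ = thetaHat M S s σ σ' * (mHat M σ σ' * (sT S s - sT S t)) * thetaHat M S t σ σ' := by
          noncomm_ring
      _ = _ := by
          rw [sT, sT, ← sub_smul]
          simp only [Matrix.mul_smul, Matrix.smul_mul, Matrix.mul_assoc]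
  have key' := congrFun (congrFun key a) b
  rw [Matrix.sub_apply, Matrix.smul_apply, smul_eq_mul] at key'
  rw [slope_def_module, key', Complex.real_smul, ← mul_assoc]
  push_cast
  rw [inv_mul_cancel₀ hst, one_mul]

/-- The derivative of `S_t Θ̂_t` factorizes, because `1 + S_t Θ̂_t M̂` is again a transposed propagator. -/
theorem hasDerivAt_sT_mul_thetaHat (hS : S.IsSymm) {t : ℝ} {σ σ' : Charge}
    (h : IsUnit (1 - mHat M σ σ' * sT S t)) (a b : ι) :
    HasDerivAt (fun s => (sT S s * thetaHat M S s σ σ') a b)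
      (((thetaHat M S t σ' σ)ᵀ * Sᵀ * thetaHat M S t σ σ') a b) t := by
  have hsum : HasDerivAt (fun s : ℝ => ∑ c, sT S s a c * thetaHat M S s σ σ' c b)
      (∑ c, (S a c * thetaHat M S t σ σ' c b + sT S t a c *
        (thetaHat M S t σ σ' * mHat M σ σ' * S * thetaHat M S t σ σ') c b)) t := by
    refine HasDerivAt.fun_sum fun c _ => ?_
    refine HasDerivAt.mul ?_ (hasDerivAt_thetaHat h c b)
    have := (Complex.ofRealCLM.hasDerivAt (x := t)).mul_const (S a c)
    simpa [sT] using this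
  have hval : ((thetaHat M S t σ' σ)ᵀ * Sᵀ * thetaHat M S t σ σ') a b =
      ∑ c, (S a c * thetaHat M S t σ σ' c b + sT S t a c *
        (thetaHat M S t σ σ' * mHat M σ σ' * S * thetaHat M S t σ σ') c b) := by
    rw [thetaHat_transpose_eq hS h, hS.eq, Finset.sum_add_distrib, ← Matrix.mul_apply,
      ← Matrix.mul_apply, ← Matrix.add_apply]
    noncomm_ring
  rw [hval]
  exact hsum

end Propagator

namespace CanonicalTree

variable {n : ℕ} [NeZero n] {ι : Type*} [Fintype ι] [DecidableEq ι] (M S : Matrix ι ι ℂ)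

open Classical in
/-- The derivative of the matrix attached to an edge. -/
noncomputable def edgeDeriv (Γ : CanonicalTree n) (t : ℝ) (σ : Fin n → Charge) (d : Γ.graph.Dart) :
    Matrix ι ι ℂ :=
  if ∃ k, d.fst = Sum.inl k then
    thetaHat M S t (Γ.charge σ d) (Γ.charge σ d.symm) * mHat M (Γ.charge σ d) (Γ.charge σ d.symm) * S *
      thetaHat M S t (Γ.charge σ d) (Γ.charge σ d.symm)
  else Γ.cutMatrix M S t σ d

variable {M S}

theorem hasDerivAt_edgeMatrix (hS : S.IsSymm) {t : ℝ} (h : PropagatorsExist M S t)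
    (Γ : CanonicalTree n) (σ : Fin n → Charge) (d : Γ.graph.Dart) (x y : ι) :
    HasDerivAt (fun s => Γ.edgeMatrix M S s σ d x y) (Γ.edgeDeriv M S t σ d x y) t := by
  unfold edgeMatrix edgeDeriv
  split_ifs
  · exact hasDerivAt_thetaHat (h _ _) x y
  · exact hasDerivAt_sT_mul_thetaHat hS (h _ _) x y

theorem hasDerivAt_value (hS : S.IsSymm) {t : ℝ} (h : PropagatorsExist M S t)
    (Γ : CanonicalTree n) (σ : Fin n → Charge) (a : Fin n → ι) :
    HasDerivAt (fun s => Γ.value M S s σ a)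
      (∑ d ∈ Γ.orientedEdges, Γ.replacedValue M S t σ a d (Γ.edgeDeriv M S t σ d)) t := by
  classical
  unfold value replacedValue
  rw [Finset.sum_comm]
  refine HasDerivAt.fun_sum fun b _ => ?_
  simp_rw [unsummedValue_eq]
  have h1 := HasDerivAt.fun_finsetProd (u := Γ.orientedEdges) fun d _ =>
    hasDerivAt_edgeMatrix hS h Γ σ d (Γ.index a b d) (Γ.index a b d.symm)
  have h2 := h1.const_mul (∏ v : Fin Γ.numInner, mLoopList M (Γ.loopList σ (Γ.index a b) v))
  convert! h2 using 1
  rw [Finset.mul_sum]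
  refine Finset.sum_congr rfl fun d _ => ?_
  rw [erasedValue, smul_eq_mul, mul_assoc]

theorem edgeDeriv_leafDart (Γ : CanonicalTree n) (t : ℝ) (σ : Fin n → Charge) (k : Fin n) :
    Γ.edgeDeriv M S t σ (Γ.leafDart k) = thetaHat M S t (σ k) (σ (k + 1)) *
      mHat M (σ k) (σ (k + 1)) * S * thetaHat M S t (σ k) (σ (k + 1)) := by
  rw [edgeDeriv, if_pos ⟨k, Γ.leafDart_fst k⟩, charge, charge, principalRegion_leafDart,
    principalRegion_leafDart_symm]

theorem edgeDeriv_of_mem_innerEdges (Γ : CanonicalTree n) (t : ℝ) (σ : Fin n → Charge)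
    {d : Γ.graph.Dart} (hd : d ∈ Γ.innerEdges) :
    Γ.edgeDeriv M S t σ d = Γ.cutMatrix M S t σ d := by
  obtain ⟨⟨v, hv⟩, -⟩ := Γ.mem_innerEdges.1 hd
  rw [edgeDeriv, if_neg]
  simp [hv]

theorem sum_orientedEdges (Γ : CanonicalTree n) (f : Γ.graph.Dart → ℂ) :
    ∑ d ∈ Γ.orientedEdges, f d = ∑ k, f (Γ.leafDart k) + ∑ d ∈ Γ.innerEdges, f d := by
  classical
  have hinj : Function.Injective Γ.leafDart := by
    intro k k' h
    have := congrArg (fun d => d.fst) h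
    simp only [leafDart_fst] at this
    exact Sum.inl_injective this
  have key : Γ.orientedEdges = Finset.univ.map ⟨Γ.leafDart, hinj⟩ ∪ Γ.innerEdges := by
    ext d
    rw [mem_orientedEdges, Finset.mem_union, mem_innerEdges]
    refine or_congr_left ?_
    simp only [Finset.mem_map, Finset.mem_univ, true_and, Function.Embedding.coeFn_mk]
    exact ⟨fun ⟨k, hk⟩ => ⟨k, (Γ.eq_leafDart hk).symm⟩, fun ⟨k, hk⟩ => ⟨k, hk ▸ Γ.leafDart_fst k⟩⟩
  rw [key, Finset.sum_union, Finset.sum_map]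
  · rfl
  · rw [Finset.disjoint_left]
    intro d hd hd'
    obtain ⟨⟨v, hv⟩, -⟩ := Γ.mem_innerEdges.1 hd'
    simp only [Finset.mem_map, Finset.mem_univ, true_and, Function.Embedding.coeFn_mk] at hd
    obtain ⟨k, rfl⟩ := hd
    rw [leafDart_fst] at hv
    cases hv

end CanonicalTree

/-! ### The right-hand side of the primitive equations -/

section GlueTerm

variable {ι : Type*}

theorem loops_congr (κ : (n : ℕ) → (Fin n → Charge) → (Fin n → ι) → ℂ) {m n : ℕ} (h : m = n)
    {σ : Fin m → Charge} {a : Fin m → ι} {σ' : Fin n → Charge} {a' : Fin n → ι}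
    (hσ : ∀ i, σ i = σ' (Fin.cast h i)) (ha : ∀ i, a i = a' (Fin.cast h i)) :
    κ m σ a = κ n σ' a' := by
  subst h
  rw [funext hσ, funext ha]
  rfl

theorem loops_two (κ : (n : ℕ) → (Fin n → Charge) → (Fin n → ι) → ℂ)
    (X : Charge → Charge → Matrix ι ι ℂ)
    (hX : ∀ (σ : Fin 2 → Charge) (a : Fin 2 → ι), κ 2 σ a = X (σ 0) (σ 1) (a 0) (a 1)) {m : ℕ}
    (h : m = 2) (σ : Fin m → Charge) (a : Fin m → ι) :
    κ m σ a = X (σ ⟨0, by omega⟩) (σ ⟨1, by omega⟩) (a ⟨0, by omega⟩) (a ⟨1, by omega⟩) := by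
  subst h
  exact hX σ a

variable [Fintype ι]

/-- The contribution of the pair `(k, l)` to the right-hand side of the primitive equation. -/
def glueTerm (S : Matrix ι ι ℂ) (κ : (n : ℕ) → (Fin n → Charge) → (Fin n → ι) → ℂ) {n : ℕ}
    (σ : Fin n → Charge) (a : Fin n → ι) (p : Fin n × Fin n) : ℂ :=
  ∑ c : ι, ∑ d : ι,
    κ (n + 1 - (p.2.val - p.1.val)) (glueLeftCharge p.1 p.2 σ) (glueLeftVertex p.1 p.2 c a) * S c d *
      κ (p.2.val - p.1.val + 1) (glueRightCharge p.1 p.2 σ) (glueRightVertex p.1 p.2 d a)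

/-- The pairs `k < l` of regions that are not adjacent in the polygon. Adjacency is cyclic, so the pair
of the first and the last region is excluded as well. -/
def admissiblePairs (n : ℕ) : Finset (Fin n × Fin n) :=
  {p | p.1.val + 2 ≤ p.2.val ∧ p.2.val + 2 ≤ n + p.1.val}

theorem mem_admissiblePairs {n : ℕ} {p : Fin n × Fin n} :
    p ∈ admissiblePairs n ↔ p.1.val + 2 ≤ p.2.val ∧ p.2.val + 2 ≤ n + p.1.val := by
  simp [admissiblePairs]

variable {S : Matrix ι ι ℂ} {κ : (n : ℕ) → (Fin n → Charge) → (Fin n → ι) → ℂ}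
  {X : Charge → Charge → Matrix ι ι ℂ}

/-- For adjacent regions, the right loop has length two and the left loop has length `n`. -/
theorem glueTerm_succ (hS : S.IsSymm)
    (hX : ∀ (σ : Fin 2 → Charge) (a : Fin 2 → ι), κ 2 σ a = X (σ 0) (σ 1) (a 0) (a 1)) {n : ℕ}
    (σ : Fin n → Charge) (a : Fin n → ι) {k l : Fin n} (hkl : l.val = k.val + 1) :
    glueTerm S κ σ a (k, l) =
      ∑ c, (X (σ k) (σ l) * S) (a k) c * κ n σ (Function.update a k c) := by
  unfold glueTerm
  refine Finset.sum_congr rfl fun c _ => ?_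
  rw [Matrix.mul_apply, Finset.sum_mul]
  refine Finset.sum_congr rfl fun d _ => ?_
  have h1 : κ (n + 1 - (l.val - k.val)) (glueLeftCharge k l σ) (glueLeftVertex k l c a) =
      κ n σ (Function.update a k c) := by
    refine loops_congr κ (by omega) (fun i => ?_) fun i => ?_
    · unfold glueLeftCharge
      split_ifs
      · rfl
      · exact congrArg σ (Fin.ext (by simp only [Fin.val_cast]; omega))
    · unfold glueLeftVertex
      split_ifs with h h'
      · rw [Function.update_of_ne]
        · rfl
        · exact fun hc => absurd (congrArg Fin.val hc) (by simp only [Fin.val_cast]; omega)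
      · rw [show Fin.cast _ i = k from Fin.ext h', Function.update_self]
      · rw [Function.update_of_ne]
        · exact congrArg a (Fin.ext (by simp only [Fin.val_cast]; omega))
        · exact fun hc => absurd (congrArg Fin.val hc) (by simp only [Fin.val_cast]; omega)
  have h2 : κ (l.val - k.val + 1) (glueRightCharge k l σ) (glueRightVertex k l d a) =
      X (σ k) (σ l) (a k) d := by
    rw [loops_two κ X hX (by omega)]
    have e1 : glueRightCharge k l σ ⟨0, by omega⟩ = σ k := rfl
    have e2 : glueRightCharge k l σ ⟨1, by omega⟩ = σ l := congrArg σ (Fin.ext hkl.symm)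
    have e3 : glueRightVertex k l d a ⟨0, by omega⟩ = a k := if_pos (by dsimp only; omega)
    have e4 : glueRightVertex k l d a ⟨1, by omega⟩ = d := if_neg (by dsimp only; omega)
    rw [e1, e2, e3, e4]
  rw [h1, h2, hS.apply]
  ring

/-- For the first and the last region, the left loop has length two and the right loop has length `n`. -/
theorem glueTerm_zero_last
    (hX : ∀ (σ : Fin 2 → Charge) (a : Fin 2 → ι), κ 2 σ a = X (σ 0) (σ 1) (a 0) (a 1))
    (hXS : ∀ σ σ' a b, X σ σ' a b = X σ' σ b a) {n : ℕ} (hn : 2 ≤ n)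
    (σ : Fin n → Charge) (a : Fin n → ι) {k l : Fin n} (hk : k.val = 0) (hl : l.val + 1 = n) :
    glueTerm S κ σ a (k, l) =
      ∑ c, (X (σ l) (σ k) * S) (a l) c * κ n σ (Function.update a l c) := by
  unfold glueTerm
  rw [Finset.sum_comm]
  refine Finset.sum_congr rfl fun d _ => ?_
  rw [Matrix.mul_apply, Finset.sum_mul]
  refine Finset.sum_congr rfl fun c _ => ?_
  have h1 : κ (n + 1 - (l.val - k.val)) (glueLeftCharge k l σ) (glueLeftVertex k l c a) =
      X (σ k) (σ l) c (a l) := by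
    rw [loops_two κ X hX (by omega)]
    have e1 : glueLeftCharge k l σ ⟨0, by omega⟩ = σ k :=
      (dif_pos (by dsimp only; omega)).trans (congrArg σ (Fin.ext hk.symm))
    have e2 : glueLeftCharge k l σ ⟨1, by omega⟩ = σ l :=
      (dif_neg (by dsimp only; omega)).trans (congrArg σ (Fin.ext (by dsimp only; omega)))
    have e3 : glueLeftVertex k l c a ⟨0, by omega⟩ = c :=
      (dif_neg (by dsimp only; omega)).trans (dif_pos hk.symm)
    have e4 : glueLeftVertex k l c a ⟨1, by omega⟩ = a l :=
      (dif_neg (by dsimp only; omega)).trans ((dif_neg (by dsimp only; omega)).trans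
        (congrArg a (Fin.ext (by dsimp only; omega))))
    rw [e1, e2, e3, e4]
  have h2 : κ (l.val - k.val + 1) (glueRightCharge k l σ) (glueRightVertex k l d a) =
      κ n σ (Function.update a l d) := by
    refine loops_congr κ (by omega) (fun i => ?_) fun i => ?_
    · exact congrArg σ (Fin.ext (by simp only [Fin.val_cast]; omega))
    · unfold glueRightVertex
      split_ifs with h
      · rw [Function.update_of_ne]
        · exact congrArg a (Fin.ext (by simp only [Fin.val_cast]; omega))
        · exact fun hc => absurd (congrArg Fin.val hc) (by simp only [Fin.val_cast]; omega)
      · rw [show Fin.cast _ i = l from Fin.ext (by simp only [Fin.val_cast]; omega),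
          Function.update_self]
  rw [h1, h2, hXS]

/-- In the primitive equation for `n ≥ 3`, the pairs of adjacent regions give the terms that are linear
in the loops of length `n`, with the two-point loops as coefficients. -/
theorem sum_glueTerm (hS : S.IsSymm)
    (hX : ∀ (σ : Fin 2 → Charge) (a : Fin 2 → ι), κ 2 σ a = X (σ 0) (σ 1) (a 0) (a 1))
    (hXS : ∀ σ σ' a b, X σ σ' a b = X σ' σ b a) {n : ℕ} [NeZero n] (hn : 3 ≤ n)
    (σ : Fin n → Charge) (a : Fin n → ι) :
    ∑ p : Fin n × Fin n with p.1 < p.2, glueTerm S κ σ a p =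
      ∑ k, ∑ c, (X (σ k) (σ (k + 1)) * S) (a k) c * κ n σ (Function.update a k c) +
        ∑ p ∈ admissiblePairs n, glueTerm S κ σ a p := by
  have h1 := Finset.sum_filter_add_sum_filter_not
    (Finset.univ.filter fun p : Fin n × Fin n => p.1 < p.2) (fun p => p ∈ admissiblePairs n)
    (glueTerm S κ σ a)
  have h2 : (Finset.univ.filter fun p : Fin n × Fin n => p.1 < p.2).filter
      (fun p => p ∈ admissiblePairs n) = admissiblePairs n := by
    ext p
    simp only [Finset.mem_filter, Finset.mem_univ, true_and, mem_admissiblePairs, Fin.lt_def]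
    omega
  rw [h2] at h1
  rw [← h1, add_comm]
  congr 1
  symm
  -- The regions on both sides of the vertex `a_k` are `k` and `k + 1`, where `k + 1` wraps around to `0`.
  refine Finset.sum_bij (fun k _ => if h : k.val + 1 < n then (k, ⟨k.val + 1, h⟩) else (0, k))
    ?_ ?_ ?_ ?_
  · intro k _
    have hk := k.isLt
    simp only [Finset.mem_filter, Finset.mem_univ, true_and, mem_admissiblePairs, Fin.lt_def]
    split_ifs <;> simp only [Fin.coe_ofNat_eq_mod, Nat.zero_mod] <;> omega
  · intro k _ k' _ h
    have hk := k.isLt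
    have hk' := k'.isLt
    split_ifs at h <;> rw [Prod.mk.injEq, Fin.ext_iff, Fin.ext_iff] at h <;>
      simp only [Fin.coe_ofNat_eq_mod, Nat.zero_mod] at h <;> apply Fin.ext <;> omega
  · rintro ⟨k, l⟩ h
    have hk := k.isLt
    have hl := l.isLt
    simp only [Finset.mem_filter, Finset.mem_univ, true_and, mem_admissiblePairs, Fin.lt_def] at h
    by_cases hkl : l.val = k.val + 1
    · refine ⟨k, Finset.mem_univ _, ?_⟩
      rw [dif_pos (by omega), Prod.mk.injEq]
      exact ⟨rfl, Fin.ext hkl.symm⟩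
    · refine ⟨l, Finset.mem_univ _, ?_⟩
      rw [dif_neg (by omega), Prod.mk.injEq]
      exact ⟨Fin.ext (by simp only [Fin.val_zero]; omega), rfl⟩
  · intro k _
    have hk := k.isLt
    have hk1 := Fin.val_add_one' k
    split_ifs with h
    · rw [if_neg (by omega)] at hk1
      rw [show (⟨k.val + 1, h⟩ : Fin n) = k + 1 from Fin.ext hk1.symm]
      exact (glueTerm_succ hS hX σ a hk1).symm
    · rw [if_pos (by omega)] at hk1
      have h0 : k + 1 = 0 := Fin.ext (by rw [hk1]; simp)
      rw [h0, glueTerm_zero_last hX hXS (by omega) σ a (by simp) (by omega)]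

end GlueTerm

/-! ### The tree sums solve the primitive equations -/

section TreeLoops

variable {ι : Type*} [Fintype ι] [DecidableEq ι]

/-- The candidate for the primitive loops: `Θ̂_t M̂` for `n = 2`, and the sum over all canonical tree
partitions for `n ≥ 3`. -/
noncomputable def treeLoops (M S : Matrix ι ι ℂ) :
    (n : ℕ) → ℝ → (Fin n → Charge) → (Fin n → ι) → ℂ
  | 0, _, _, _ => 0
  | 1, _, _, _ => 0
  | 2, t, σ, a => (thetaHat M S t (σ 0) (σ 1) * mHat M (σ 0) (σ 1)) (a 0) (a 1)
  | n + 3, t, σ, a => ∑ T : TSP (n + 3), T.value M S t σ a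

variable {M S : Matrix ι ι ℂ}

theorem treeLoops_eq {n : ℕ} [NeZero n] (hn : 3 ≤ n) (t : ℝ) (σ : Fin n → Charge) (a : Fin n → ι) :
    treeLoops M S n t σ a = ∑ T : TSP n, T.value M S t σ a := by
  obtain ⟨m, rfl⟩ := Nat.exists_eq_add_of_le' hn
  rfl

theorem sum_leafDart_replacedValue {n : ℕ} [NeZero n] (hn : 3 ≤ n) (t : ℝ) (σ : Fin n → Charge)
    (a : Fin n → ι) :
    ∑ T : TSP n, ∑ k, T.rep.replacedValue M S t σ a (T.rep.leafDart k)
        (T.rep.edgeDeriv M S t σ (T.rep.leafDart k)) =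
      ∑ k, ∑ c, (thetaHat M S t (σ k) (σ (k + 1)) * mHat M (σ k) (σ (k + 1)) * S) (a k) c *
        treeLoops M S n t σ (Function.update a k c) := by
  simp_rw [CanonicalTree.edgeDeriv_leafDart, CanonicalTree.replacedValue_leafDart M S t hn,
    treeLoops_eq hn, Finset.mul_sum, TSP.value_eq]
  rw [Finset.sum_comm]
  exact Finset.sum_congr rfl fun k _ => Finset.sum_comm

open Classical in
theorem sum_innerEdges_replacedValue {n : ℕ} [NeZero n] (t : ℝ) (σ : Fin n → Charge)
    (a : Fin n → ι) :
    ∑ T : TSP n, ∑ e ∈ T.rep.innerEdges, T.rep.replacedValue M S t σ a e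
        (T.rep.edgeDeriv M S t σ e) =
      ∑ p ∈ admissiblePairs n, glueTerm S (fun n => treeLoops M S n t) σ a p := by
  have h1 : ∀ T : TSP n, ∑ e ∈ T.rep.innerEdges, T.rep.replacedValue M S t σ a e
        (T.rep.edgeDeriv M S t σ e) = ∑ p ∈ admissiblePairs n, ∑ e ∈ T.rep.innerEdges.filter
        (fun e => (T.rep.principalRegion e, T.rep.principalRegion e.symm) = p),
        T.rep.replacedValue M S t σ a e (T.rep.cutMatrix M S t σ e) := by
    intro T
    rw [Finset.sum_fiberwise_of_maps_to
      (g := fun e => (T.rep.principalRegion e, T.rep.principalRegion e.symm))]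
    · refine Finset.sum_congr rfl fun e he => ?_
      rw [T.rep.edgeDeriv_of_mem_innerEdges t σ he]
    · intro e he
      obtain ⟨hfst, hsnd, hlt⟩ := T.rep.mem_innerEdges.1 he
      exact mem_admissiblePairs.2 (T.rep.principalRegion_not_adjacent hlt hfst hsnd)
  rw [Finset.sum_congr rfl fun T _ => h1 T, Finset.sum_comm]
  refine Finset.sum_congr rfl ?_
  rintro ⟨k, l⟩ hp
  obtain ⟨hkl, hn⟩ := mem_admissiblePairs.1 hp
  dsimp only at hkl hn
  have hk := k.isLt
  have hl := l.isLt
  have : NeZero (n + 1 - (l.val - k.val)) := ⟨by omega⟩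
  have hkl' : k < l := Fin.lt_def.2 (by omega)
  rw [CanonicalTree.sum_cut M S t k l hkl hkl' hn rfl rfl σ a (fun c => glueLeftVertex k l c a)
    (fun d => glueRightVertex k l d a)]
  · unfold glueTerm
    refine Finset.sum_congr rfl fun c _ => Finset.sum_congr rfl fun d _ => ?_
    change _ = treeLoops M S (n + 1 - (l.val - k.val)) t (glueLeftCharge k l σ)
        (glueLeftVertex k l c a) * S c d *
      treeLoops M S (l.val - k.val + 1) t (glueRightCharge k l σ) (glueRightVertex k l d a)
    rw [treeLoops_eq (n := n + 1 - (l.val - k.val)) (by omega),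
      treeLoops_eq (n := l.val - k.val + 1) (by omega)]
    have e1 : (fun i => σ ((leftCollapse k l hkl rfl).emb i)) = glueLeftCharge k l σ := by
      funext i
      unfold glueLeftCharge leftCollapse
      dsimp only
      split_ifs <;> rfl
    rw [e1]
    rfl
  · intro c i hi
    have hi' : i.val ≠ k.val := fun h => hi (Fin.ext h)
    unfold glueLeftVertex leftCollapse
    dsimp only
    split_ifs <;> first | rfl | omega
  · intro c
    unfold glueLeftVertex leftCollapse
    dsimp only
    rw [dif_neg (by omega), dif_pos rfl]
  · intro c i hi
    have hi' : i.val ≠ l.val - k.val := fun h => hi (Fin.ext h)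
    exact if_pos (by have := i.isLt; omega)
  · intro c
    exact if_neg (by simp [rightCollapse])

theorem hasDerivAt_treeLoops (hS : S.IsSymm) {t : ℝ} (h : PropagatorsExist M S t) {n : ℕ}
    (hn : 2 ≤ n) (σ : Fin n → Charge) (a : Fin n → ι) :
    HasDerivAt (fun s => treeLoops M S n s σ a)
      (∑ p : Fin n × Fin n with p.1 < p.2, glueTerm S (fun n => treeLoops M S n t) σ a p) t := by
  have hX : ∀ (σ : Fin 2 → Charge) (a : Fin 2 → ι), treeLoops M S 2 t σ a =
      (thetaHat M S t (σ 0) (σ 1) * mHat M (σ 0) (σ 1)) (a 0) (a 1) := fun _ _ => rfl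
  rcases hn.eq_or_lt with rfl | hn
  · have hp : (Finset.univ.filter fun p : Fin 2 × Fin 2 => p.1 < p.2) = {(0, 1)} := by decide
    rw [hp, Finset.sum_singleton, glueTerm_succ
      (X := fun σ σ' => thetaHat M S t σ σ' * mHat M σ σ') hS hX σ a rfl]
    have hsum : HasDerivAt
        (fun s => ∑ c, thetaHat M S s (σ 0) (σ 1) (a 0) c * mHat M (σ 0) (σ 1) c (a 1))
        (∑ c, (thetaHat M S t (σ 0) (σ 1) * mHat M (σ 0) (σ 1) * S * thetaHat M S t (σ 0) (σ 1))
          (a 0) c * mHat M (σ 0) (σ 1) c (a 1)) t :=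
      HasDerivAt.fun_sum fun c _ => (hasDerivAt_thetaHat (h _ _) _ _).mul_const _
    have hval : ∑ c, (thetaHat M S t (σ 0) (σ 1) * mHat M (σ 0) (σ 1) * S) (a 0) c *
        treeLoops M S 2 t σ (Function.update a 0 c) =
        ∑ c, (thetaHat M S t (σ 0) (σ 1) * mHat M (σ 0) (σ 1) * S * thetaHat M S t (σ 0) (σ 1))
          (a 0) c * mHat M (σ 0) (σ 1) c (a 1) := by
      rw [← Matrix.mul_apply, Matrix.mul_assoc _ (thetaHat M S t (σ 0) (σ 1)), Matrix.mul_apply]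
      refine Finset.sum_congr rfl fun c _ => ?_
      rw [hX, Function.update_self, Function.update_of_ne (by decide)]
    rw [hval]
    exact hsum
  · have : NeZero n := ⟨by omega⟩
    have hn : 3 ≤ n := hn
    rw [sum_glueTerm (X := fun σ σ' => thetaHat M S t σ σ' * mHat M σ σ') hS hX
      (fun σ σ' a b => thetaHat_mul_mHat_symm hS (h σ' σ) a b) hn]
    simp_rw [treeLoops_eq hn, TSP.value_eq]
    have hsum := HasDerivAt.fun_sum (u := (Finset.univ : Finset (TSP n))) fun T _ =>
      T.rep.hasDerivAt_value hS h σ a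
    convert! hsum using 1
    simp_rw [CanonicalTree.sum_orientedEdges]
    rw [Finset.sum_add_distrib, sum_leafDart_replacedValue hn, sum_innerEdges_replacedValue]
    simp_rw [treeLoops_eq hn, TSP.value_eq]

end TreeLoops

/-! ### Initial values -/

section InitialValues

variable {ι : Type*} [Fintype ι] [DecidableEq ι]

theorem sT_zero {κ : Type*} (S : Matrix κ κ ℂ) : sT S 0 = 0 := by
  simp [sT]

theorem thetaHat_zero (M S : Matrix ι ι ℂ) (σ σ' : Charge) : thetaHat M S 0 σ σ' = 1 := by
  rw [thetaHat, sT_zero, mul_zero, sub_zero, inv_one]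

theorem mHat_apply (M : Matrix ι ι ℂ) (σ : Fin 2 → Charge) (a : Fin 2 → ι) :
    mHat M (σ 0) (σ 1) (a 0) (a 1) = mLoop M σ a := by
  simp [mHat, mLoop, mLoopList, Matrix.mul_assoc]

namespace CanonicalTree

variable {n : ℕ} [NeZero n]

theorem principalRegion_ne_symm (Γ : CanonicalTree n) (d : Γ.graph.Dart) :
    Γ.principalRegion d ≠ Γ.principalRegion d.symm := by
  intro h
  have h1 := Γ.principalRegion_eq_iff.1 h
  have h2 := Γ.principalRegion_eq_iff.1 (rfl : Γ.principalRegion d.symm = _)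
  rw [side_symm] at h2
  exact h2.1 h1.1

theorem not_adj_inl (hn : 3 ≤ n) (Γ : CanonicalTree n) (j k : Fin n) :
    ¬ Γ.graph.Adj (Sum.inl j) (Sum.inl k) := by
  intro hjk
  obtain ⟨v, hv⟩ := Γ.exists_leafDart_snd hn j
  rw [← Γ.eq_leafDart (d := ⟨(_, _), hjk⟩) rfl] at hv
  cases hv

/-- A canonical tree without internal edges is a star. -/
theorem numInner_eq_one (hn : 3 ≤ n) (Γ : CanonicalTree n) (h : Γ.innerEdges = ∅) :
    Γ.numInner = 1 := by
  have hinner : ∀ v w, ¬ Γ.graph.Adj (Sum.inr v) (Sum.inr w) := by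
    intro v w hvw
    rcases (Γ.principalRegion_ne_symm ⟨(_, _), hvw⟩).lt_or_gt with hlt | hlt
    · have := Γ.mem_innerEdges.2 ⟨⟨v, rfl⟩, ⟨w, rfl⟩, hlt⟩
      simp [h] at this
    · have : SimpleGraph.Dart.symm ⟨(_, _), hvw⟩ ∈ Γ.innerEdges :=
        Γ.mem_innerEdges.2 ⟨⟨w, rfl⟩, ⟨v, rfl⟩, hlt⟩
      simp [h] at this
  obtain ⟨v, hv⟩ := Γ.exists_leafDart_snd hn 0
  have hP := Γ.preconnected.forall_of_adj
    (P := fun x => x = Sum.inr v ∨ ∃ k, x = Sum.inl k ∧ (Γ.leafDart k).snd = Sum.inr v)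
    (Or.inl rfl) fun x y hxy hx => by
      rcases hx with rfl | ⟨k, rfl, hk⟩
      · rcases y with k | w
        · refine Or.inr ⟨k, rfl, ?_⟩
          rw [← Γ.eq_leafDart (d := ⟨(_, _), hxy.symm⟩) rfl]
        · exact absurd hxy (hinner _ _)
      · rw [← Γ.eq_leafDart (d := ⟨(_, _), hxy⟩) rfl] at hk
        exact Or.inl hk
  have huniq : ∀ w, w = v := fun w => by
    rcases hP (Sum.inr w) with h | ⟨k, h, -⟩
    · exact Sum.inr_injective h
    · cases h
  rw [← Fintype.card_fin Γ.numInner]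
  exact Fintype.card_eq_one_iff.2 ⟨v, huniq⟩

section Star

variable {Γ : CanonicalTree n} (h : Γ.numInner = 1)
include h

theorem inner_eq_of_star (v w : Fin Γ.numInner) : v = w :=
  Fin.ext (by omega)

theorem not_adj_inr_of_star (v w : Fin Γ.numInner) : ¬ Γ.graph.Adj (Sum.inr v) (Sum.inr w) := by
  rw [inner_eq_of_star h v w]
  exact Γ.graph.loopless.irrefl _

theorem adj_inl_inr_of_star (hn : 3 ≤ n) (k : Fin n) (v : Fin Γ.numInner) :
    Γ.graph.Adj (Sum.inl k) (Sum.inr v) := by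
  obtain ⟨w, hw⟩ := Γ.exists_leafDart_snd hn k
  have := (Γ.leafDart k).adj
  rwa [hw, Γ.leafDart_fst, inner_eq_of_star h w v] at this

theorem leafDart_snd_of_star (hn : 3 ≤ n) (k : Fin n) (v : Fin Γ.numInner) :
    (Γ.leafDart k).snd = Sum.inr v := by
  rw [← Γ.eq_leafDart (d := ⟨(_, _), adj_inl_inr_of_star h hn k v⟩) rfl]

theorem exists_symm_eq_leafDart_of_star {d : Γ.graph.Dart} (hd : ∃ v, d.fst = Sum.inr v) :
    ∃ k, d.symm = Γ.leafDart k := by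
  obtain ⟨v, hv⟩ := hd
  rcases hs : d.snd with k | w
  · exact ⟨k, Γ.eq_leafDart hs⟩
  · have := d.adj
    rw [hv, hs] at this
    exact absurd this (not_adj_inr_of_star h v w)

theorem exists_eq_leafDart_of_star {d : Γ.graph.Dart} (hd : d ∈ Γ.orientedEdges) :
    ∃ k, d = Γ.leafDart k := by
  rcases Γ.mem_orientedEdges.1 hd with ⟨k, hk⟩ | ⟨⟨v, hv⟩, ⟨w, hw⟩, -⟩
  · exact ⟨k, Γ.eq_leafDart hk⟩
  · have := d.adj
    rw [hv, hw] at this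
    exact absurd this (not_adj_inr_of_star h v w)

theorem loopList_of_star {κ : Type*} (hn : 3 ≤ n) (σ : Fin n → Charge) (x : Γ.graph.Dart → κ)
    (v : Fin Γ.numInner) :
    Γ.loopList σ x v = List.ofFn fun k => (σ k, x (Γ.leafDart k).symm) := by
  classical
  rw [List.ofFn_eq_map, List.map_eq_flatMap, loopList]
  congr 1
  funext k
  rw [List.eq_of_length_le_one (l' := [(Γ.leafDart k).symm])
    (length_filter_fst_le (Γ.path k) (treePath_isPath Γ.isTree _ _) _) le_rfl fun d => ?_]
  · rfl
  · rw [List.mem_filter, decide_eq_true_eq, mem_path_darts_iff, List.mem_singleton]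
    constructor
    · rintro ⟨hk, hd⟩
      obtain ⟨j, hj⟩ := exists_symm_eq_leafDart_of_star h ⟨v, hd⟩
      rw [hj, principalRegion_leafDart] at hk
      rw [← hk, ← hj, SimpleGraph.Dart.symm_symm]
    · rintro rfl
      exact ⟨by rw [SimpleGraph.Dart.symm_symm, principalRegion_leafDart],
        leafDart_snd_of_star h hn k v⟩

/-- At time `0`, the propagators are trivial and the value of the star is the `M`-loop of its only
internal vertex. -/
theorem value_zero_of_star (hn : 3 ≤ n) (M S : Matrix ι ι ℂ) (σ : Fin n → Charge) (a : Fin n → ι) :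
    Γ.value M S 0 σ a = mLoop M σ a := by
  classical
  let v : Fin Γ.numInner := ⟨0, by omega⟩
  have hmem : ∀ k, ∃ w, (Γ.leafDart k).symm.fst = Sum.inr w :=
    fun k => ⟨v, leafDart_snd_of_star h hn k v⟩
  have hedge : ∀ b k, Γ.edgeMatrix M S 0 σ (Γ.leafDart k) (Γ.index a b (Γ.leafDart k))
      (Γ.index a b (Γ.leafDart k).symm) = if a k = b ⟨_, hmem k⟩ then 1 else 0 := by
    intro b k
    rw [edgeMatrix, if_pos ⟨k, Γ.leafDart_fst k⟩, thetaHat_zero, index_leafDart,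
      Γ.index_inr a b _ (hmem k), Matrix.one_apply]
  unfold value
  -- The propagators force the index of each loop vertex to be that of the leaf attached to it.
  rw [Fintype.sum_eq_single fun x : Γ.LoopVertex => a (Γ.principalRegion x.val.symm)]
  · rw [unsummedValue_eq, Finset.prod_eq_one (s := Γ.orientedEdges), mul_one,
      Fintype.prod_eq_single v fun w hw => absurd (inner_eq_of_star h w v) hw, loopList_of_star h hn,
      mLoop]
    · congr 2
      funext k
      rw [Γ.index_inr a _ _ (hmem k), SimpleGraph.Dart.symm_symm, principalRegion_leafDart]
    · intro d hd
      obtain ⟨k, rfl⟩ := exists_eq_leafDart_of_star h hd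
      rw [hedge, if_pos]
      rw [SimpleGraph.Dart.symm_symm, principalRegion_leafDart]
  · intro b hb
    obtain ⟨⟨d, hd⟩, hne⟩ := Function.ne_iff.1 hb
    obtain ⟨k, hk⟩ := exists_symm_eq_leafDart_of_star h hd
    obtain rfl : d = (Γ.leafDart k).symm := by rw [← hk, SimpleGraph.Dart.symm_symm]
    rw [unsummedValue_eq_erasedValue_mul _ _ _ _ _ _ _ (Γ.leafDart_mem_orientedEdges k), hedge,
      if_neg, mul_zero]
    rw [SimpleGraph.Dart.symm_symm, principalRegion_leafDart] at hne
    exact fun h => hne h.symm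

theorem iso_of_star (hn : 3 ≤ n) {Γ' : CanonicalTree n} (h' : Γ'.numInner = 1) : Iso Γ Γ' := by
  let f : Fin n ⊕ Fin Γ.numInner ≃ Fin n ⊕ Fin Γ'.numInner :=
    (Equiv.refl _).sumCongr (finCongr (h.trans h'.symm))
  refine ⟨⟨f, ?_⟩, fun k => rfl⟩
  rintro (j | v) (k | w)
  · exact iff_of_false (Γ'.not_adj_inl hn j k) (Γ.not_adj_inl hn j k)
  · exact iff_of_true (adj_inl_inr_of_star h' hn j _) (adj_inl_inr_of_star h hn j w)
  · exact iff_of_true (adj_inl_inr_of_star h' hn k _).symm (adj_inl_inr_of_star h hn k v).symm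
  · exact iff_of_false (not_adj_inr_of_star h' _ _) (not_adj_inr_of_star h v w)

end Star

theorem value_zero_of_mem_innerEdges {Γ : CanonicalTree n} {e : Γ.graph.Dart} (he : e ∈ Γ.innerEdges)
    (M S : Matrix ι ι ℂ) (σ : Fin n → Charge) (a : Fin n → ι) : Γ.value M S 0 σ a = 0 := by
  classical
  unfold value
  refine Finset.sum_eq_zero fun b _ => ?_
  obtain ⟨⟨v, hv⟩, -, -⟩ := Γ.mem_innerEdges.1 he
  rw [unsummedValue_eq_erasedValue_mul _ _ _ _ _ _ _ (Γ.innerEdges_subset he), edgeMatrix, if_neg,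
    sT_zero, zero_mul, Matrix.zero_apply, mul_zero]
  rintro ⟨k, hk⟩
  rw [hv] at hk
  cases hk

section StarTree

/-- The set of vertices beyond a directed edge of the star: the leaf it points to, or everything but
the leaf it leaves. -/
def starSide {n : ℕ} (d : (completeBipartiteGraph (Fin n) (Fin 1)).Dart) : Set (Fin n ⊕ Fin 1) :=
  if d.snd.isLeft then {d.snd} else {d.fst}ᶜ

theorem isSide_starSide {n : ℕ} (d : (completeBipartiteGraph (Fin n) (Fin 1)).Dart) :
    IsSide (completeBipartiteGraph (Fin n) (Fin 1)) d.fst d.snd (starSide d) := by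
  obtain ⟨⟨x, y⟩, hxy⟩ := d
  rcases x with j | v <;> rcases y with k | w
  · simp at hxy
  · refine ⟨by simp [starSide], by simp [starSide], ?_⟩
    rintro (x | x) (y | y) hxy hx hy <;> simp_all [starSide, eq_iff_true_of_subsingleton]
  · refine ⟨by simp [starSide], by simp [starSide], ?_⟩
    rintro (x | x) (y | y) hxy hx hy <;> simp_all [starSide, eq_iff_true_of_subsingleton]
  · simp at hxy

theorem isTree_star {n : ℕ} : (completeBipartiteGraph (Fin n) (Fin 1)).IsTree where
  connected := by
    have h : ∀ x, (completeBipartiteGraph (Fin n) (Fin 1)).Reachable x (Sum.inr 0) := by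
      rintro (k | v)
      · exact SimpleGraph.Adj.reachable (by simp)
      · rw [Subsingleton.elim v 0]
    exact ⟨fun x y => (h x).trans (h y).symm⟩
  isAcyclic := SimpleGraph.isAcyclic_of_isSide fun u v huv => ⟨_, isSide_starSide ⟨(u, v), huv⟩⟩

theorem existsUnique_starSide (hn : 3 ≤ n) (d : (completeBipartiteGraph (Fin n) (Fin 1)).Dart) :
    ∃! k : Fin n, (Sum.inl (k - 1) : Fin n ⊕ Fin 1) ∉ starSide d ∧ Sum.inl k ∈ starSide d := by
  have h1 : (1 : Fin n) ≠ 0 := by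
    rw [Ne, Fin.ext_iff, Fin.coe_ofNat_eq_mod, Nat.mod_eq_of_lt (by omega)]
    simp
  obtain ⟨⟨x, y⟩, hxy⟩ := d
  rcases x with j | v <;> rcases y with k | w
  · simp at hxy
  · refine ⟨j + 1, by simp [starSide, h1], fun i hi => ?_⟩
    simp only [starSide, Sum.isLeft_inr] at hi
    exact sub_eq_iff_eq_add.1 (Sum.inl_injective (not_not.1 hi.1))
  · refine ⟨k, by simp [starSide, h1], fun i hi => ?_⟩
    exact Sum.inl_injective (β := Fin 1) (by simpa [starSide] using hi.2)
  · simp at hxy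

/-- The star: a single internal vertex joined to all the leaves. -/
def star (hn : 3 ≤ n) : CanonicalTree n where
  numInner := 1
  graph := completeBipartiteGraph (Fin n) (Fin 1)
  isTree := isTree_star
  ncard_external k := by
    have : (completeBipartiteGraph (Fin n) (Fin 1)).neighborSet (Sum.inl k) = {Sum.inr 0} := by
      ext (j | v) <;> simp [eq_iff_true_of_subsingleton]
    rw [this, Set.ncard_singleton]
  ncard_internal v := by
    have : (completeBipartiteGraph (Fin n) (Fin 1)).neighborSet (Sum.inr v) =
        Sum.inl '' Set.univ := by
      ext (j | v) <;> simp
    rw [this, Set.ncard_image_of_injective _ Sum.inl_injective, Set.ncard_univ, Nat.card_fin]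
    exact hn
  planar d := planar_of_existsUnique _ _ _ isSide_starSide (existsUnique_starSide hn) d

end StarTree

end CanonicalTree

/-- At time `0` only the star contributes to the sum over trees. -/
theorem treeLoops_zero (M S : Matrix ι ι ℂ) {n : ℕ} (hn : 2 ≤ n) (σ : Fin n → Charge)
    (a : Fin n → ι) : treeLoops M S n 0 σ a = mLoop M σ a := by
  classical
  rcases hn.eq_or_lt with rfl | hn
  · change (thetaHat M S 0 (σ 0) (σ 1) * mHat M (σ 0) (σ 1)) (a 0) (a 1) = _
    rw [thetaHat_zero, one_mul, mHat_apply]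
  · have : NeZero n := ⟨by omega⟩
    have hn : 3 ≤ n := hn
    rw [treeLoops_eq hn, Fintype.sum_eq_single (α := TSP n)
      (Quotient.mk (CanonicalTree.setoid n) (CanonicalTree.star hn))]
    · exact CanonicalTree.value_zero_of_star (Γ := CanonicalTree.star hn) rfl hn M S σ a
    · intro T hT
      rw [TSP.value_eq]
      rcases T.rep.innerEdges.eq_empty_or_nonempty with h | ⟨e, he⟩
      · refine absurd ?_ hT
        rw [← T.mk_rep]
        exact Quotient.sound (CanonicalTree.iso_of_star (T.rep.numInner_eq_one hn h) hn rfl)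
      · exact CanonicalTree.value_zero_of_mem_innerEdges he M S σ a

end InitialValues

/-! ### Uniqueness for linear systems -/

open Set in
/-- Uniqueness for a linear system of differential equations with continuous coefficients. -/
theorem eq_zero_of_linear_system {α J : Type*} [Fintype α] [Fintype J] {T : ℝ} {f : ℝ → α → ℂ}
    {A : ℝ → α → J → ℂ} {g : α → J → α} (h0 : f 0 = 0)
    (hf : ∀ t ∈ Icc 0 T, ∀ x,
      HasDerivWithinAt (fun s => f s x) (∑ j, A t x j * f t (g x j)) (Icc 0 T) t)
    (hA : ∀ x j, ContinuousOn (fun t => A t x j) (Icc 0 T)) {t : ℝ} (ht : t ∈ Icc 0 T) :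
    f t = 0 := by
  have hcont : ContinuousOn (fun t => ∑ x, ∑ j, ‖A t x j‖) (Icc 0 T) :=
    continuousOn_finsetSum _ fun x _ => continuousOn_finsetSum _ fun j _ => (hA x j).norm
  obtain ⟨C, hC⟩ := isCompact_Icc.exists_bound_of_continuousOn hcont
  have hd : ∀ t ∈ Icc 0 T, HasDerivWithinAt f (fun x => ∑ j, A t x j * f t (g x j)) (Icc 0 T) t :=
    fun t ht => hasDerivWithinAt_pi.2 (hf t ht)
  refine eq_zero_of_abs_deriv_le_mul_abs_self_of_eq_zero_right (K := C)
    (fun t ht => (hd t ht).continuousWithinAt)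
    (fun t ht => (hd t (Ico_subset_Icc_self ht)).mono_of_mem_nhdsWithin
      (Icc_mem_nhdsGE_of_mem ht)) h0 (fun t ht => ?_) t ht
  have ht' := Ico_subset_Icc_self ht
  have hCt : ∑ x, ∑ j, ‖A t x j‖ ≤ C := (le_abs_self _).trans (hC t ht')
  have hC0 : 0 ≤ C := le_trans (by positivity) hCt
  refine (pi_norm_le_iff_of_nonneg (by positivity)).2 fun x => ?_
  calc ‖∑ j, A t x j * f t (g x j)‖ ≤ ∑ j, ‖A t x j‖ * ‖f t‖ :=
        (norm_sum_le _ _).trans (Finset.sum_le_sum fun j _ => by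
          rw [norm_mul]
          gcongr
          exact norm_le_pi_norm _ _)
    _ = (∑ j, ‖A t x j‖) * ‖f t‖ := (Finset.sum_mul ..).symm
    _ ≤ C * ‖f t‖ := by
        gcongr
        exact (Finset.single_le_sum (f := fun x => ∑ j, ‖A t x j‖)
          (fun x _ => Finset.sum_nonneg fun j _ => norm_nonneg _) (Finset.mem_univ x)).trans hCt

/-! ### Uniqueness of primitive loops -/

section Uniqueness

variable {ι : Type*} [Fintype ι] [DecidableEq ι] {M S : Matrix ι ι ℂ} {I : Set ℝ}
  {K : (n : ℕ) → ℝ → (Fin n → Charge) → (Fin n → ι) → ℂ}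

namespace IsPrimitiveLoops

theorem hasDerivWithinAt (hK : IsPrimitiveLoops M S I K) {n : ℕ} (hn : 2 ≤ n) (σ : Fin n → Charge)
    (a : Fin n → ι) {t : ℝ} (ht : t ∈ I) :
    HasDerivWithinAt (fun s => K n s σ a)
      (∑ p : Fin n × Fin n with p.1 < p.2, glueTerm S (fun n => K n t) σ a p) I t :=
  hK.equation n hn σ a t ht

/-- The two-point loops solve the matrix Riccati equation `X' = X S X`. -/
theorem hasDerivWithinAt_two (hK : IsPrimitiveLoops M S I K) (hS : S.IsSymm) (σ σ' : Charge) {t : ℝ}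
    (ht : t ∈ I) (a b : ι) :
    HasDerivWithinAt (fun s => K 2 s ![σ, σ'] ![a, b])
      (((Matrix.of fun a b => K 2 t ![σ, σ'] ![a, b]) * S *
        Matrix.of fun a b => K 2 t ![σ, σ'] ![a, b]) a b) I t := by
  have h := hK.hasDerivWithinAt le_rfl ![σ, σ'] ![a, b] ht
  have hp : (Finset.univ.filter fun p : Fin 2 × Fin 2 => p.1 < p.2) = {(0, 1)} := by decide
  have hX : ∀ (τ : Fin 2 → Charge) (a : Fin 2 → ι), K 2 t τ a =
      (Matrix.of fun a b => K 2 t ![τ 0, τ 1] ![a, b]) (a 0) (a 1) := fun τ a => by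
    rw [Matrix.of_apply]
    congr 1 <;> funext i <;> fin_cases i <;> rfl
  rw [hp, Finset.sum_singleton, glueTerm_succ
    (X := fun σ σ' => Matrix.of fun a b => K 2 t ![σ, σ'] ![a, b]) hS hX _ _ rfl] at h
  refine h.congr_deriv ?_
  rw [Matrix.mul_apply]
  refine Finset.sum_congr rfl fun c _ => ?_
  rw [Matrix.of_apply, show Function.update ![a, b] 0 c = ![c, b] by
    funext i; fin_cases i <;> rfl]
  rfl

/-- For a solution `X` of the Riccati equation with `X = M̂` at time `0`, the matrix
`(1 - t M̂ S) X - M̂` solves a homogeneous linear equation and so vanishes. -/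
theorem mul_two_eq (hK : IsPrimitiveLoops M S I K) (hS : S.IsSymm) (hI : I.OrdConnected)
    (hI0 : (0 : ℝ) ∈ I) (hIpos : ∀ t ∈ I, 0 ≤ t) (σ σ' : Charge) {T : ℝ} (hT : T ∈ I) :
    (1 - mHat M σ σ' * sT S T) * (Matrix.of fun a b => K 2 T ![σ, σ'] ![a, b]) = mHat M σ σ' := by
  have hsub : Set.Icc 0 T ⊆ I := hI.out hI0 hT
  let X : ℝ → Matrix ι ι ℂ := fun t => Matrix.of fun a b => K 2 t ![σ, σ'] ![a, b]
  let W : ℝ → Matrix ι ι ℂ := fun t => (1 - mHat M σ σ' * sT S t) * X t - mHat M σ σ'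
  have hX : ∀ t ∈ Set.Icc 0 T, ∀ a b,
      HasDerivWithinAt (fun s => X s a b) ((X t * S * X t) a b) (Set.Icc 0 T) t :=
    fun t ht a b => (hK.hasDerivWithinAt_two hS σ σ' (hsub ht) a b).mono hsub
  have hW0 : W 0 = 0 := by
    ext a b
    have : K 2 0 ![σ, σ'] ![a, b] = mHat M σ σ' a b := by
      rw [hK.initial 2 le_rfl, ← mHat_apply]
      rfl
    simp [W, X, sT_zero, this]
  have hW : ∀ t ∈ Set.Icc 0 T, ∀ a b,
      HasDerivWithinAt (fun s => W s a b) ((W t * (S * X t)) a b) (Set.Icc 0 T) t := by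
    intro t ht a b
    have hWs : ∀ s, W s a b =
        X s a b - (s : ℂ) * ∑ c, (mHat M σ σ' * S) a c * X s c b - mHat M σ σ' a b := fun s => by
      rw [← Matrix.mul_apply]
      simp [W, sT, sub_mul, Matrix.sub_apply]
    have hs : HasDerivWithinAt (fun s : ℝ => (s : ℂ)) 1 (Set.Icc 0 T) t :=
      (hasDerivAt_id t).ofReal_comp.hasDerivWithinAt
    have hsum : HasDerivWithinAt (fun s => ∑ c, (mHat M σ σ' * S) a c * X s c b)
        (∑ c, (mHat M σ σ' * S) a c * (X t * S * X t) c b) (Set.Icc 0 T) t :=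
      HasDerivWithinAt.fun_sum fun c _ => (hX t ht c b).const_mul _
    simp_rw [hWs]
    refine (((hX t ht a b).sub (hs.mul hsum)).sub_const _).congr_deriv ?_
    rw [← Matrix.mul_apply, ← Matrix.mul_apply]
    simp only [W, sT, sub_mul, Matrix.sub_apply, one_mul, Matrix.mul_smul, Matrix.smul_mul,
      Matrix.smul_apply, smul_eq_mul, Matrix.mul_assoc]
    ring
  have hrow : ∀ a, (fun t => W t a) T = 0 := fun a => by
    refine eq_zero_of_linear_system (f := fun t => W t a) (A := fun t b c => (S * X t) c b)
      (g := fun _ c => c) (congrFun hW0 a) (fun t ht b => ?_) (fun b c t ht => ?_)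
      (Set.right_mem_Icc.2 (hIpos T hT))
    · refine (hW t ht a b).congr_deriv ?_
      rw [Matrix.mul_apply]
      exact Finset.sum_congr rfl fun c _ => mul_comm _ _
    · simp_rw [Matrix.mul_apply]
      exact (HasDerivWithinAt.fun_sum fun d _ =>
        (hX t ht d b).const_mul (S c d)).continuousWithinAt
  exact sub_eq_zero.1 (show W T = 0 from funext hrow)

theorem propagatorsExist (hK : IsPrimitiveLoops M S I K) (hS : S.IsSymm) (hI : I.OrdConnected)
    (hI0 : (0 : ℝ) ∈ I) (hIpos : ∀ t ∈ I, 0 ≤ t) {t : ℝ} (ht : t ∈ I) : PropagatorsExist M S t := by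
  intro σ σ'
  have h := hK.mul_two_eq hS hI hI0 hIpos σ σ' ht
  -- The inverse is `1 + X S_t`.
  refine IsUnit.of_mul_eq_one
    (1 + (Matrix.of fun a b => K 2 t ![σ, σ'] ![a, b]) * sT S t) ?_
  rw [mul_add, mul_one, ← mul_assoc, h, sub_add_cancel]

theorem two_eq (hK : IsPrimitiveLoops M S I K) (hS : S.IsSymm) (hI : I.OrdConnected)
    (hI0 : (0 : ℝ) ∈ I) (hIpos : ∀ t ∈ I, 0 ≤ t) {t : ℝ} (ht : t ∈ I) (σ σ' : Charge) (a b : ι) :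
    K 2 t ![σ, σ'] ![a, b] = (thetaHat M S t σ σ' * mHat M σ σ') a b := by
  rw [← hK.mul_two_eq hS hI hI0 hIpos σ σ' ht, ← Matrix.mul_assoc,
    thetaHat_mul (hK.propagatorsExist hS hI hI0 hIpos ht σ σ'), Matrix.one_mul, Matrix.of_apply]

/-- By strong induction on `n`: once the shorter loops are known, the primitive equation for `n ≥ 3` is
an inhomogeneous linear system, so that the difference of two solutions solves the homogeneous one. -/
theorem eq_treeLoops (hK : IsPrimitiveLoops M S I K) (hS : S.IsSymm) (hI : I.OrdConnected)
    (hI0 : (0 : ℝ) ∈ I) (hIpos : ∀ t ∈ I, 0 ≤ t) (n : ℕ) (hn : 2 ≤ n) {T : ℝ} (hT : T ∈ I)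
    (σ : Fin n → Charge) (a : Fin n → ι) : K n T σ a = treeLoops M S n T σ a := by
  have htwo : ∀ t ∈ I, ∀ (σ : Fin 2 → Charge) (a : Fin 2 → ι), K 2 t σ a =
      (thetaHat M S t (σ 0) (σ 1) * mHat M (σ 0) (σ 1)) (a 0) (a 1) := fun t ht σ a => by
    rw [← hK.two_eq hS hI hI0 hIpos ht]
    congr 1 <;> funext i <;> fin_cases i <;> rfl
  induction n using Nat.strong_induction_on generalizing T with
  | _ n ih =>
    rcases hn.eq_or_lt with rfl | hn
    · exact htwo T hT σ a
    have : NeZero n := ⟨by omega⟩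
    have hn : 3 ≤ n := hn
    have hsub : Set.Icc 0 T ⊆ I := hI.out hI0 hT
    have hprop : ∀ t ∈ I, PropagatorsExist M S t :=
      fun t ht => hK.propagatorsExist hS hI hI0 hIpos ht
    refine sub_eq_zero.1 (congrFun (eq_zero_of_linear_system (J := Fin n × ι)
      (f := fun t a => K n t σ a - treeLoops M S n t σ a)
      (A := fun t a j => (thetaHat M S t (σ j.1) (σ (j.1 + 1)) * mHat M (σ j.1) (σ (j.1 + 1)) * S)
        (a j.1) j.2)
      (g := fun a j => Function.update a j.1 j.2) ?_ (fun t ht a => ?_) (fun a j t ht => ?_)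
      (Set.right_mem_Icc.2 (hIpos T hT))) a)
    · funext a
      exact sub_eq_zero.2 ((hK.initial n (by omega) σ a).trans
        (treeLoops_zero M S (by omega) σ a).symm)
    · have h1 := (hK.hasDerivWithinAt (n := n) (by omega) σ a (hsub ht)).mono hsub
      have h2 := (hasDerivAt_treeLoops hS (hprop t (hsub ht)) (n := n) (by omega) σ
        a).hasDerivWithinAt (s := Set.Icc 0 T)
      have hsymm : ∀ σ σ' a b, (thetaHat M S t σ σ' * mHat M σ σ') a b =
          (thetaHat M S t σ' σ * mHat M σ' σ) b a :=
        fun σ σ' a b => thetaHat_mul_mHat_symm hS (hprop t (hsub ht) σ' σ) a b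
      refine (h1.sub h2).congr_deriv ?_
      rw [sum_glueTerm (X := fun σ σ' => thetaHat M S t σ σ' * mHat M σ σ') hS
          (htwo t (hsub ht)) hsymm hn,
        sum_glueTerm (X := fun σ σ' => thetaHat M S t σ σ' * mHat M σ σ') hS
          (fun _ _ => rfl) hsymm hn]
      -- The terms of non-adjacent pairs only involve shorter loops.
      have hadm : ∑ p ∈ admissiblePairs n, glueTerm S (fun n => K n t) σ a p =
          ∑ p ∈ admissiblePairs n, glueTerm S (fun n => treeLoops M S n t) σ a p := by
        refine Finset.sum_congr rfl fun p hp => ?_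
        obtain ⟨hp1, hp2⟩ := mem_admissiblePairs.1 hp
        have := p.2.isLt
        unfold glueTerm
        refine Finset.sum_congr rfl fun c _ => Finset.sum_congr rfl fun d _ => ?_
        exact congrArg₂ (· * ·) (congrArg (· * S c d) (ih _ (by omega) (by omega) (hsub ht) _ _))
          (ih _ (by omega) (by omega) (hsub ht) _ _)
      rw [hadm, add_sub_add_right_eq_sub, ← Finset.sum_sub_distrib, Fintype.sum_prod_type]
      refine Finset.sum_congr rfl fun k _ => ?_
      rw [← Finset.sum_sub_distrib]
      exact Finset.sum_congr rfl fun c _ => (mul_sub _ _ _).symm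
    · have h := ((continuousAt_thetaHat (hprop t (hsub ht) (σ j.1) (σ (j.1 + 1)))).mul
        (continuousAt_const (y := mHat M (σ j.1) (σ (j.1 + 1))))).mul (continuousAt_const (y := S))
      exact ((continuous_apply_apply (a j.1) j.2).continuousAt.comp h).continuousWithinAt

end IsPrimitiveLoops

theorem isPrimitiveLoops_treeLoops (hS : S.IsSymm) (h : ∀ t ∈ I, PropagatorsExist M S t) :
    IsPrimitiveLoops M S I (treeLoops M S) where
  initial _ hn σ a := treeLoops_zero M S hn σ a
  equation _ hn σ a t ht := (hasDerivAt_treeLoops hS (h t ht) hn σ a).hasDerivWithinAt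

end Uniqueness

theorem lemma4p1 {ι : Type*} [Fintype ι] [DecidableEq ι]
    (Λ M S : Matrix ι ι ℂ) (z : ℝ → ℂ) (I : Set ℝ)
    (hI : I.OrdConnected) (hI0 : (0 : ℝ) ∈ I) (hIpos : ∀ t ∈ I, 0 ≤ t)
    (hΛ : Λ.IsHermitian) (hS : S.IsSymm)
    (hz : ∀ t ∈ I, 0 < (z t).im)
    (hM : ∀ t ∈ I, IsUnit (Λ - z t • (1 : Matrix ι ι ℂ) - (t : ℂ) • varianceOp S M) ∧
      M = (Λ - z t • (1 : Matrix ι ι ℂ) - (t : ℂ) • varianceOp S M)⁻¹) :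
    (∀ K : (n : ℕ) → ℝ → (Fin n → Charge) → (Fin n → ι) → ℂ, IsPrimitiveLoops M S I K →
      ∀ t ∈ I, PropagatorsExist M S t ∧
        (∀ (σ₁ σ₂ : Charge) (a b : ι),
          K 2 t ![σ₁, σ₂] ![a, b] = (thetaHat M S t σ₁ σ₂ * mHat M σ₁ σ₂) a b) ∧
        (∀ (n : ℕ) [NeZero n], 3 ≤ n → ∀ (σ : Fin n → Charge) (a : Fin n → ι),
          K n t σ a = ∑ Γ : TSP n, Γ.value M S t σ a)) ∧
    ((∀ t ∈ I, PropagatorsExist M S t) →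
      ∃ K : (n : ℕ) → ℝ → (Fin n → Charge) → (Fin n → ι) → ℂ, IsPrimitiveLoops M S I K) := by
  refine ⟨fun K hK t ht => ⟨hK.propagatorsExist hS hI hI0 hIpos ht, fun σ₁ σ₂ a b =>
    hK.two_eq hS hI hI0 hIpos ht σ₁ σ₂ a b, fun n _ hn σ a => ?_⟩, fun h =>
    ⟨treeLoops M S, isPrimitiveLoops_treeLoops hS h⟩⟩
  rw [hK.eq_treeLoops hS hI hI0 hIpos n (by omega) ht, treeLoops_eq hn]
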